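/- **Model.** Let $Z_1,Z_2,\dots$ be i.i.d. with density $f(\cdot,\theta_0)$ with respect to a measure $\mu$, where $\{f(\cdot,\theta):\theta\in\Theta\}$ is a family of positive probability densities, $\Theta\subset\mathbb R$. Write $\ell=\partial_\theta\log f$, $\ell^\theta=\partial_\theta^2\log f$, $\ell^{\theta\theta}=\partial_\theta^3\log f$; $E$ is the expectation under $f(\cdot,\theta_0)$. **Regularity conditions.** (a) $\Theta$ is compact, $\theta_0\in\operatorname{int}\Theta$, and $\log f(z,\cdot)$ is $7$ times continuously differentiable on $\Theta$ for each $z$. (b) There is a function $M$ with $|\partial_\theta^m\log f(z,\theta)|\le M(z)$ for all $z$, $\theta\in\Theta$, $0\le m\le 7$, and $E[M(Z)^q]<\infty$ for some $q>16$. (c) If $\theta\in\Theta$, $\theta\ne\theta_0$, then $f(\cdot,\theta)$ and $f(\cdot,\theta_0)$ are not $\mu$-a.e. equal. (d) $\partial_\theta^m\log f(\cdot,\theta)$ is measurable for each $\theta\in\Theta$, $m\le 7$. (e) The class $\mathfrak F=\{\partial_\theta^m\log f(\cdot,\theta):\theta\in\Theta,1\le m\le7\}$ satisfies $$\int_0^1\sup_{Q}\sqrt{\log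 N\big(\varepsilon\|M\|_{Q,2},\mathfrak F,L_2(Q)\big)}\,d\varepsilon<\infty,$$ the supremum being over finitely supported probability measures $Q$ with $\|M\|_{Q,2}=(\int M^2dQ)^{1/2}>0$, and $N(r,\mathfrak F,L_2(Q))$ the least number of open $L_2(Q)$-balls of radius $r$ covering $\mathfrak F$. (f) $\mathcal I:=-E[\ell^\theta(Z,\theta_0)]>0$. (g) For each $g\in\{1,\ell,\ell^2,\ell^\theta,\ell\,\ell^\theta,\ell^{\theta\theta}\}$ there are $\delta>0$ and a $\mu$-integrable $G$ with $|\partial_\theta(g(z,\theta)f(z,\theta))|\le G(z)$ for $\mu$-a.e. $z$ and all $|\theta-\theta_0|<\delta$. **Estimators.** Let $\widehat\theta$ be a maximum likelihood estimator: for each sample, a maximizer over $\Theta$ of $n^{-1}\sum_{i=1}^n\log f(Z_i,\theta)$. Write $\overline{h}=n^{-1}\sum_{i=1}^n h(Z_i,\widehat\theta)$. Consider * bootstrap: $\widehat\theta_B=2\widehat\theta-E^*[\widehat\theta^*]$, where $\widehat\theta^*$ is the MLE of a sample of size $n$ drawn i.i.d. from the empirical distribution of $Z_1,\dots,Z_n$,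 and $E^*$ is the expectation over these draws; * jackknife: $\widehat\theta_J=n\widehat\theta-\frac{n-1}{n}\sum_{i=1}^n\widehat\theta_{(i)}$, where $\widehat\theta_{(i)}$ is the MLE of the sample without $Z_i$; * analytical, not imposing the information equality: $\widetilde\theta_a=\widehat\theta-\frac1n\Big(-\frac{\overline{\ell^{\theta\theta}}\;\overline{\ell^2}}{2(\overline{\ell^\theta})^3}+\frac{\overline{\ell\ell^\theta}}{(\overline{\ell^\theta})^2}\Big)$; * analytical, imposing the information equality: $\widehat\theta_a=\widehat\theta-\frac1n\Big(\frac{\overline{\ell^{\theta\theta}}}{2(\overline{\ell^\theta})^2}+\frac{\overline{\ell\ell^\theta}}{(\overline{\ell^\theta})^2}\Big)$; * analytical, with integrals: $\widehat\theta_c$, which is $\widehat\theta_a$ with each average $\overline h$ replaced by $\int h(z,\widehat\theta)f(z,\widehat\theta)\,d\mu(z)$. **Higher-order variance.** An estimator $\tilde\theta$ has higher-order variance $\sigma^2+\upsilon/n$ if $$\sqrt n(\tilde\theta-\theta_0)=A_1+\frac{A_2}{\sqrt n}+\frac{A_3}{n}+o_p(n^{-1}),$$ where $A_1=n^{-1/2}\sum_{i}\psi(Z_i)$,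 $A_2$ and $A_3$ are fixed polynomials (of degree at most $2$ and $3$) in finitely many normalized sums $n^{-1/2}\sum_i g_j(Z_i)$, the functions $\psi,g_j$ have mean zero and finite fourth moments, and $$\operatorname{Var}(A_1)+\frac1n\big(\operatorname{Var}(A_2)+2\sqrt n\,E[A_1A_2]+2E[A_1A_3]\big)=\sigma^2+\frac{\upsilon}{n}+O(n^{-2}).$$ **Proposition.** Under the regularity conditions, each of the five estimators $\widehat\theta_B,\widehat\theta_J,\widetilde\theta_a,\widehat\theta_a,\widehat\theta_c$ has higher-order variance $$\mathcal I^{-1}+\frac1n\Upsilon,\qquad \Upsilon=E[X^2]E[Y^2]+(E[XY])^2,$$ where $X=\mathcal I^{-1}U$, $Y=\tfrac12\mathcal I^{-2}\mathcal Q_1U+\mathcal I^{-1}V$, with $U=\ell(Z,\theta_0)$, $V=\ell^\theta(Z,\theta_0)-E[\ell^\theta(Z,\theta_0)]$, $\mathcal Q_1=E[\ell^{\theta\theta}(Z,\theta_0)]$. -/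

import Mathlib

open MeasureTheory ProbabilityTheory Filter Topology Asymptotics
open scoped ENNReal

noncomputable section

namespace BiasCorrectedMLE

variable {𝓩 : Type*}

/-! ### The parametric model

A family of densities `f z θ` with respect to a dominating measure `μ` on the sample space `𝓩`,
with parameter set `Θ ⊆ ℝ`. -/

/-- The probability distribution with density `f (·, θ)` with respect to `μ`. -/
def law [MeasurableSpace 𝓩] (μ : Measure 𝓩) (f : 𝓩 → ℝ → ℝ) (θ : ℝ) : Measure 𝓩 :=
  μ.withDensity fun z => ENNReal.ofReal (f z θ)

/-- `∂ᵐ log f(z, θ) / ∂θᵐ`, the derivative being taken within the parameter set `Θ`. -/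
def logLikDeriv (f : 𝓩 → ℝ → ℝ) (Θ : Set ℝ) (m : ℕ) (z : 𝓩) (θ : ℝ) : ℝ :=
  iteratedDerivWithin m (fun t => Real.log (f z t)) Θ θ

/-- The score `ℓ(z, θ)`. -/
abbrev score (f : 𝓩 → ℝ → ℝ) (Θ : Set ℝ) : 𝓩 → ℝ → ℝ := logLikDeriv f Θ 1

/-- `ℓ^θ(z, θ)`, the derivative of the score. -/
abbrev score' (f : 𝓩 → ℝ → ℝ) (Θ : Set ℝ) : 𝓩 → ℝ → ℝ := logLikDeriv f Θ 2

/-- `ℓ^θθ(z, θ)`, the second derivative of the score. -/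
abbrev score'' (f : 𝓩 → ℝ → ℝ) (Θ : Set ℝ) : 𝓩 → ℝ → ℝ := logLikDeriv f Θ 3

/-- `𝓘 = -E[ℓ^θ(Z, θ₀)]`. -/
def info [MeasurableSpace 𝓩] (μ : Measure 𝓩) (f : 𝓩 → ℝ → ℝ) (Θ : Set ℝ) (θ₀ : ℝ) : ℝ :=
  -∫ z, score' f Θ z θ₀ ∂(law μ f θ₀)

/-- `𝓠₁ = E[ℓ^θθ(Z, θ₀)]`. -/
def Q₁ [MeasurableSpace 𝓩] (μ : Measure 𝓩) (f : 𝓩 → ℝ → ℝ) (Θ : Set ℝ) (θ₀ : ℝ) : ℝ :=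
  ∫ z, score'' f Θ z θ₀ ∂(law μ f θ₀)

/-- `U(z) = ℓ(z, θ₀)`. -/
def U (f : 𝓩 → ℝ → ℝ) (Θ : Set ℝ) (θ₀ : ℝ) (z : 𝓩) : ℝ := score f Θ z θ₀

/-- `V(z) = ℓ^θ(z, θ₀) - E[ℓ^θ(Z, θ₀)]`. -/
def V [MeasurableSpace 𝓩] (μ : Measure 𝓩) (f : 𝓩 → ℝ → ℝ) (Θ : Set ℝ) (θ₀ : ℝ) (z : 𝓩) : ℝ :=
  score' f Θ z θ₀ - ∫ y, score' f Θ y θ₀ ∂(law μ f θ₀)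

/-- `X = 𝓘⁻¹ U`. -/
def X [MeasurableSpace 𝓩] (μ : Measure 𝓩) (f : 𝓩 → ℝ → ℝ) (Θ : Set ℝ) (θ₀ : ℝ) (z : 𝓩) : ℝ :=
  (info μ f Θ θ₀)⁻¹ * U f Θ θ₀ z

/-- `Y = ½ 𝓘⁻² 𝓠₁ U + 𝓘⁻¹ V`. -/
def Y [MeasurableSpace 𝓩] (μ : Measure 𝓩) (f : 𝓩 → ℝ → ℝ) (Θ : Set ℝ) (θ₀ : ℝ) (z : 𝓩) : ℝ :=
  1 / 2 * (info μ f Θ θ₀)⁻¹ ^ 2 * Q₁ μ f Θ θ₀ * U f Θ θ₀ z + (info μ f Θ θ₀)⁻¹ * V μ f Θ θ₀ z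

/-- `Υ = E[X²] E[Y²] + E[XY]²`. -/
def Upsilon [MeasurableSpace 𝓩] (μ : Measure 𝓩) (f : 𝓩 → ℝ → ℝ) (Θ : Set ℝ) (θ₀ : ℝ) : ℝ :=
  (∫ z, X μ f Θ θ₀ z ^ 2 ∂(law μ f θ₀)) * (∫ z, Y μ f Θ θ₀ z ^ 2 ∂(law μ f θ₀))
    + (∫ z, X μ f Θ θ₀ z * Y μ f Θ θ₀ z ∂(law μ f θ₀)) ^ 2

/-! ### The uniform entropy condition -/

/-- The `L₂(Q)` seminorm for the finitely supported probability measure `Q = ∑ⱼ wⱼ δ_{xⱼ}`. -/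
def l2norm {k : ℕ} (x : Fin k → 𝓩) (w : Fin k → ℝ) (h : 𝓩 → ℝ) : ℝ :=
  Real.sqrt (∑ j, w j * h (x j) ^ 2)

/-- The covering number `N(r, F, L₂(Q))`: the least number of open `L₂(Q)`-balls of radius `r`
needed to cover `F`, the centres being arbitrary functions. -/
def coveringNumber {k : ℕ} (x : Fin k → 𝓩) (w : Fin k → ℝ) (F : Set (𝓩 → ℝ)) (r : ℝ) : ℕ∞ :=
  ⨅ (C : Finset (𝓩 → ℝ)) (_ : ∀ h ∈ F, ∃ c ∈ C, l2norm x w (h - c) < r), (C.card : ℕ∞)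

open Classical in
/-- `√(log N)`, infinite when `N` is infinite. -/
def sqrtLog (N : ℕ∞) : ℝ≥0∞ :=
  if N = ⊤ then ⊤ else ENNReal.ofReal (Real.sqrt (Real.log (N.toNat : ℝ)))

/-- The uniform entropy integral of the class `F` with envelope `M`:
`∫₀¹ sup_Q √(log N(ε ‖M‖_{Q,2}, F, L₂(Q))) dε`, the supremum being over the finitely supported
probability measures `Q` with `‖M‖_{Q,2} > 0`. -/
def entropyIntegral (F : Set (𝓩 → ℝ)) (M : 𝓩 → ℝ) : ℝ≥0∞ :=
  ∫⁻ ε in Set.Ioo (0 : ℝ) 1,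
    ⨆ (k : ℕ) (x : Fin k → 𝓩) (w : Fin k → ℝ) (_ : w ∈ stdSimplex ℝ (Fin k))
      (_ : 0 < l2norm x w M), sqrtLog (coveringNumber x w F (ε * l2norm x w M))

/-- The class of functions `∂ᵐ log f(·, θ)/∂θᵐ`, `θ ∈ Θ`, `1 ≤ m ≤ 7`. -/
def derivClass (f : 𝓩 → ℝ → ℝ) (Θ : Set ℝ) : Set (𝓩 → ℝ) :=
  {h | ∃ θ ∈ Θ, ∃ m : ℕ, 1 ≤ m ∧ m ≤ 7 ∧ h = fun z => logLikDeriv f Θ m z θ}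

/-! ### Regularity conditions -/

/-- Near `θ₀`, the `θ`-derivative of `g(z, θ) f(z, θ)` is dominated by a `μ`-integrable function:
the usual condition for `∫ g(z, θ) f(z, θ) dμ(z)` to be differentiable under the integral sign. -/
def DominatedNear [MeasurableSpace 𝓩] (μ : Measure 𝓩) (f : 𝓩 → ℝ → ℝ) (θ₀ : ℝ)
    (g : 𝓩 → ℝ → ℝ) : Prop :=
  ∃ δ > 0, ∃ G : 𝓩 → ℝ, Integrable G μ ∧
    ∀ᵐ z ∂μ, ∀ θ, |θ - θ₀| < δ → |deriv (fun t => g z t * f z t) θ| ≤ G z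

/-- The regularity conditions on the model, with envelope function `M`. -/
structure RegularityConditions [MeasurableSpace 𝓩] (μ : Measure 𝓩) (f : 𝓩 → ℝ → ℝ)
    (Θ : Set ℝ) (θ₀ : ℝ) (M : 𝓩 → ℝ) : Prop where
  /-- `f(·, θ)` is a positive probability density for every `θ ∈ Θ` -/
  density_pos : ∀ θ ∈ Θ, ∀ z, 0 < f z θ
  density_one : ∀ θ ∈ Θ, ∫⁻ z, ENNReal.ofReal (f z θ) ∂μ = 1
  /-- smoothness of the log-density -/
  smooth : ∀ z, ContDiffOn ℝ 7 (fun θ => Real.log (f z θ)) Θ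
  compact : IsCompact Θ
  interior : θ₀ ∈ interior Θ
  /-- envelope, with a finite moment of some order `q > 16` -/
  envelope : ∀ m ≤ 7, ∀ θ ∈ Θ, ∀ z, |logLikDeriv f Θ m z θ| ≤ M z
  moment : ∃ q : ℝ, 16 < q ∧ MemLp M (ENNReal.ofReal q) (law μ f θ₀)
  /-- identification -/
  identified : ∀ θ ∈ Θ, θ ≠ θ₀ → ¬ ((fun z => f z θ) =ᵐ[μ] fun z => f z θ₀)
  /-- measurability -/
  measurable : ∀ θ ∈ Θ, ∀ m ≤ 7, AEMeasurable (fun z => logLikDeriv f Θ m z θ) μ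
  /-- entropy -/
  entropy : entropyIntegral (derivClass f Θ) M < ⊤
  /-- nonzero information -/
  info_pos : 0 < info μ f Θ θ₀
  /-- differentiation under the integral sign, for `∫ g f dμ` with
  `g = 1, ℓ, ℓ², ℓ^θ, ℓ ℓ^θ, ℓ^θθ` -/
  dom_one : DominatedNear μ f θ₀ fun _ _ => 1
  dom_score : DominatedNear μ f θ₀ fun z θ => score f Θ z θ
  dom_score_sq : DominatedNear μ f θ₀ fun z θ => score f Θ z θ ^ 2
  dom_score' : DominatedNear μ f θ₀ fun z θ => score' f Θ z θ
  dom_score_score' : DominatedNear μ f θ₀ fun z θ => score f Θ z θ * score' f Θ z θ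
  dom_score'' : DominatedNear μ f θ₀ fun z θ => score'' f Θ z θ

/-! ### Estimators -/

/-- An estimator: a function of the sample, for every sample size. -/
abbrev Estimator (𝓩 : Type*) := ∀ n : ℕ, (Fin n → 𝓩) → ℝ

/-- The sample average `n⁻¹ ∑ᵢ h(zᵢ)`. -/
def avg {n : ℕ} (z : Fin n → 𝓩) (h : 𝓩 → ℝ) : ℝ := (n : ℝ)⁻¹ * ∑ i, h (z i)

/-- `θhat` is a maximum likelihood estimator: for every sample it selects a maximizer over `Θ` of
the average log-likelihood. -/
def IsMLE (f : 𝓩 → ℝ → ℝ) (Θ : Set ℝ) (θhat : Estimator 𝓩) : Prop :=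
  ∀ (n : ℕ) (z : Fin n → 𝓩), θhat n z ∈ Θ ∧
    IsMaxOn (fun θ => avg z fun y => Real.log (f y θ)) Θ (θhat n z)

/-- Bootstrap bias correction `2 θhat - E*[θhat*]`. Here `E*` is the average of `θhat` over the `nⁿ`
equally likely resamples of size `n`, i.e. over i.i.d. draws from the empirical distribution. -/
def bootstrap (θhat : Estimator 𝓩) : Estimator 𝓩 := fun n z =>
  2 * θhat n z - ((n : ℝ) ^ n)⁻¹ * ∑ r : Fin n → Fin n, θhat n (z ∘ r)

/-- Jackknife bias correction `n θhat - ((n-1)/n) ∑ᵢ θhat₍ᵢ₎`, where `θhat₍ᵢ₎` is computed from the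
sample without its `i`-th observation. (The value at the empty sample is irrelevant.) -/
def jackknife (θhat : Estimator 𝓩) : Estimator 𝓩
  | 0, z => θhat 0 z
  | m + 1, z => ((m : ℝ) + 1) * θhat (m + 1) z
      - (m : ℝ) / ((m : ℝ) + 1) * ∑ i : Fin (m + 1), θhat m (i.removeNth z)

/-- Analytical bias correction by sample averages, not using the information equality. -/
def analyticNoInfo (f : 𝓩 → ℝ → ℝ) (Θ : Set ℝ) (θhat : Estimator 𝓩) : Estimator 𝓩 := fun n z =>
  let t := θhat n z
  t - (n : ℝ)⁻¹ *
    (-(avg z (fun y => score'' f Θ y t) * avg z (fun y => score f Θ y t ^ 2))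
        / (2 * avg z (fun y => score' f Θ y t) ^ 3)
      + avg z (fun y => score f Θ y t * score' f Θ y t)
        / avg z (fun y => score' f Θ y t) ^ 2)

/-- Analytical bias correction by sample averages, using the information equality. -/
def analyticInfo (f : 𝓩 → ℝ → ℝ) (Θ : Set ℝ) (θhat : Estimator 𝓩) : Estimator 𝓩 := fun n z =>
  let t := θhat n z
  t - (n : ℝ)⁻¹ *
    (avg z (fun y => score'' f Θ y t) / (2 * avg z (fun y => score' f Θ y t) ^ 2)
      + avg z (fun y => score f Θ y t * score' f Θ y t)
        / avg z (fun y => score' f Θ y t) ^ 2)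

/-- Analytical bias correction by integrals against the estimated density. -/
def analyticIntegral [MeasurableSpace 𝓩] (μ : Measure 𝓩) (f : 𝓩 → ℝ → ℝ) (Θ : Set ℝ)
    (θhat : Estimator 𝓩) : Estimator 𝓩 := fun n z =>
  let t := θhat n z
  t - (n : ℝ)⁻¹ *
    ((∫ y, score'' f Θ y t * f y t ∂μ) / (2 * (∫ y, score' f Θ y t * f y t ∂μ) ^ 2)
      + (∫ y, score f Θ y t * score' f Θ y t * f y t ∂μ)
        / (∫ y, score' f Θ y t * f y t ∂μ) ^ 2)

/-! ### Stochastic expansions and higher-order variance -/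

/-- The normalized sum `n^{-1/2} ∑ᵢ h(zᵢ)`. -/
def normSum {n : ℕ} (z : Fin n → 𝓩) (h : 𝓩 → ℝ) : ℝ := (Real.sqrt n)⁻¹ * ∑ i, h (z i)

/-- The leading three terms of a stochastic expansion: `A₁` is the normalized sum of a mean-zero
influence function `ψ`, and `A₂`, `A₃` are fixed polynomials, of degree at most two and three, in
finitely many normalized sums of mean-zero functions `g j`. All functions have fourth moments, so
that the moments entering the higher-order variance are finite. -/
structure ExpansionTerms [MeasurableSpace 𝓩] (P : Measure 𝓩) where
  ψ : 𝓩 → ℝ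
  k : ℕ
  g : Fin k → 𝓩 → ℝ
  p₂ : MvPolynomial (Fin k) ℝ
  p₃ : MvPolynomial (Fin k) ℝ
  memLp_ψ : MemLp ψ 4 P
  mean_ψ : ∫ z, ψ z ∂P = 0
  memLp_g : ∀ j, MemLp (g j) 4 P
  mean_g : ∀ j, ∫ z, g j z ∂P = 0
  degree_p₂ : p₂.totalDegree ≤ 2
  degree_p₃ : p₃.totalDegree ≤ 3

namespace ExpansionTerms

variable [MeasurableSpace 𝓩] {P : Measure 𝓩} (e : ExpansionTerms P)

def A₁ {n : ℕ} (z : Fin n → 𝓩) : ℝ := normSum z e.ψ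

def A₂ {n : ℕ} (z : Fin n → 𝓩) : ℝ := MvPolynomial.eval (fun j => normSum z (e.g j)) e.p₂

def A₃ {n : ℕ} (z : Fin n → 𝓩) : ℝ := MvPolynomial.eval (fun j => normSum z (e.g j)) e.p₃

end ExpansionTerms

variable {Ω : Type*}

/-- The sample of size `n` from the sequence of observations `Z`. -/
def sample (Z : ℕ → Ω → 𝓩) (n : ℕ) (ω : Ω) : Fin n → 𝓩 := fun i => Z i ω

/-- `√n (est - θ₀) = A₁ + A₂/√n + A₃/n + o_p(n⁻¹)`. -/
def HasExpansion [MeasurableSpace Ω] (Pr : Measure Ω) (Z : ℕ → Ω → 𝓩) (θ₀ : ℝ) (est : Estimator 𝓩)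
    [MeasurableSpace 𝓩] {P : Measure 𝓩} (e : ExpansionTerms P) : Prop :=
  TendstoInMeasure Pr
    (fun (n : ℕ) (ω : Ω) =>
      let z := sample Z n ω
      (n : ℝ) * (Real.sqrt n * (est n z - θ₀)
        - (e.A₁ z + e.A₂ z / Real.sqrt n + e.A₃ z / n)))
    atTop (fun _ => 0)

/-- `Var(A₁) + υ/n`, where `υ = Var(A₂) + 2 √n E[A₁ A₂] + 2 E[A₁ A₃]`, at sample size `n`. -/
def expansionVariance [MeasurableSpace Ω] (Pr : Measure Ω) (Z : ℕ → Ω → 𝓩)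
    [MeasurableSpace 𝓩] {P : Measure 𝓩} (e : ExpansionTerms P)
    (n : ℕ) : ℝ :=
  variance (fun ω => e.A₁ (sample Z n ω)) Pr
    + (variance (fun ω => e.A₂ (sample Z n ω)) Pr
        + 2 * Real.sqrt n * ∫ ω, e.A₁ (sample Z n ω) * e.A₂ (sample Z n ω) ∂Pr
        + 2 * ∫ ω, e.A₁ (sample Z n ω) * e.A₃ (sample Z n ω) ∂Pr) / n

/-- The estimator `est` has higher-order variance `σ² + υ/n`: it has a stochastic expansion whose
leading three terms have variance `σ² + υ/n` up to order `n⁻¹`, the error being `O(n⁻²)`.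
(For i.i.d. data, by the central limit theorem, the terms of such an expansion are almost surely
determined by the estimator, so that `σ²` and `υ` do not depend on the choice of the expansion.) -/
def HasHigherOrderVariance [MeasurableSpace Ω] (Pr : Measure Ω) (Z : ℕ → Ω → 𝓩)
    [MeasurableSpace 𝓩] (P : Measure 𝓩) (θ₀ : ℝ) (est : Estimator 𝓩) (σsq υ : ℝ) : Prop :=
  ∃ e : ExpansionTerms P, HasExpansion Pr Z θ₀ est e ∧
    (fun n : ℕ => expansionVariance Pr Z e n - (σsq + υ / n)) =O[atTop]
      fun n : ℕ => ((n : ℝ) ^ 2)⁻¹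

end BiasCorrectedMLE

end

open BiasCorrectedMLE

/-!
Write `X̃, Ỹ, …` for the normalized sums of `X, Y, …`.

**Expansion of the maximum likelihood estimator.** Wald's compactness argument
(`exists_separation`, from the positivity of the Kullback–Leibler divergence) shows that, with
probability tending to one, every maximizer of the likelihood is a critical point near `θ₀`, in a
region where the average log-likelihood is uniformly concave (`IsLocalSample`,
`exists_localModel`). Solving the Taylor-expanded score equation by successive substitution
(`root_expansion`) gives
`√n (θhat - θ₀) = X̃ + X̃ Ỹ / √n + cubicTerm / n + o_p(n⁻¹)` (`tendsto_mle_remainder`).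

**Effect of a bias correction.** The first-order bias of `θhat` is `b / n` with `b = E[XY]`. Let
`T = b + φ̃ / √n + o_p(n^{-1/2})` be an asymptotically linear estimate of `b` (`LinExp`), and
consider `θhat - T / n`. Its expansion has the terms `A₁ = X̃`, `A₂ = X̃ Ỹ - b`,
`A₃ = cubicTerm - φ̃`. Exact moments of normalized sums (`HasMean.sum_two` to `HasMean.sum_four`)
give `√n E[A₁ A₂] = E[X²Y]`, `E[A₁ A₃] = cubicCov - E[Xφ] + O(n⁻¹)` and
`Var(A₂) = E[X²] E[Y²] + (E[XY])² + O(n⁻¹)`. Hence the higher-order variance is `𝓘⁻¹ + Υ / n` as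
soon as `E[Xφ] = E[X²Y] + cubicCov` (`IsBiasEstimate`, `hasHigherOrderVariance_of_isBiasEstimate`).
This covariance condition does not depend on how the bias is estimated. Heuristically, `X` is the
efficient influence function, so the covariance of any regular estimate of `b(θ)` with `X̃` is
`b'(θ₀) / 𝓘`; here it is checked for each analytical estimate from the delta method, the information
equality and the third Bartlett identity (`isBiasEstimate_analyticNoInfo`,
`isBiasEstimate_analyticInfo`, `isBiasEstimate_analyticIntegral`).

**Jackknife and bootstrap.** The same expansion of a root, taken about `θhat` instead of `θ₀`,
describes the estimate for a second sample close to the first one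
(`exists_estimate_expansion`). Averaged over the leave-one-out samples or over all resamples, its
linear term vanishes because the score averages to zero at `θhat`, its quadratic term is the
correction of `analyticNoInfo`, and the rest is `O(n⁻²)` (`exists_jackknife_close`,
`exists_bootstrap_close`). Both estimators therefore share the expansion of `analyticNoInfo`. For
the bootstrap, resamples far from the sample are rare enough, by a fourth-moment bound, for the
compactness of the parameter set to control them.
-/

noncomputable section

namespace BiasCorrectedMLE

/-! ### Stochastic orders of magnitude -/

section StochasticOrder

variable {Ω : Type*} [MeasurableSpace Ω] {Pr : Measure Ω}

/-- The filter on `ℕ × Ω` of the events that hold with probability tending to one: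
`S` belongs to it when the (outer) probability of `{ω | (n, ω) ∉ S}` tends to zero as `n → ∞`.
Thus `Tendsto A (whp Pr) (𝓝 a)` is convergence in probability of `ω ↦ A (n, ω)` to the
constant `a`, and needs no measurability. -/
def whp (Pr : Measure Ω) : Filter (ℕ × Ω) where
  sets := {S | Tendsto (fun n => Pr {ω | (n, ω) ∉ S}) atTop (𝓝 0)}
  univ_sets := by simp
  sets_of_superset := by
    intro S T hS hST
    refine tendsto_of_tendsto_of_tendsto_of_le_of_le tendsto_const_nhds hS
      (fun n => zero_le) fun n => measure_mono fun ω hω h => hω (hST h)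
  inter_sets := by
    intro S T hS hT
    have := Tendsto.add hS hT
    rw [add_zero] at this
    refine tendsto_of_tendsto_of_tendsto_of_le_of_le tendsto_const_nhds this
      (fun n => zero_le) fun n => (measure_mono ?_).trans (measure_union_le _ _)
    intro ω hω
    by_contra h
    simp only [Set.mem_union, Set.mem_ofPred_eq, not_or, not_not] at h
    exact hω h

lemma eventually_whp {p : ℕ × Ω → Prop} :
    (∀ᶠ x in whp Pr, p x) ↔ Tendsto (fun n => Pr {ω | ¬ p (n, ω)}) atTop (𝓝 0) := Iff.rfl

lemma tendsto_fst_whp : Tendsto Prod.fst (whp Pr) (atTop : Filter ℕ) := by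
  rw [tendsto_atTop]
  intro N
  rw [eventually_whp]
  refine tendsto_const_nhds.congr' ?_
  filter_upwards [eventually_ge_atTop N] with n hn
  simp [hn]

lemma tendstoInMeasure_of_tendsto_whp {A : ℕ → Ω → ℝ}
    (h : Tendsto (fun p : ℕ × Ω => A p.1 p.2) (whp Pr) (𝓝 0)) :
    TendstoInMeasure Pr A atTop (fun _ => 0) := by
  rw [tendstoInMeasure_iff_norm]
  intro ε hε
  have := (Metric.tendsto_nhds.1 h) ε hε
  rw [eventually_whp] at this
  simpa [not_lt] using this

/-- `A` is bounded in probability, `A = O_p(1)`: multiplying `A` by anything that tends to zero in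
probability gives something that tends to zero in probability. -/
def OpOne (Pr : Measure Ω) (A : ℕ × Ω → ℝ) : Prop :=
  ∀ B : ℕ × Ω → ℝ, Tendsto B (whp Pr) (𝓝 0) → Tendsto (fun p => B p * A p) (whp Pr) (𝓝 0)

lemma OpOne.mul {A A' : ℕ × Ω → ℝ} (h : OpOne Pr A) (h' : OpOne Pr A') :
    OpOne Pr (fun p => A p * A' p) := by
  intro B hB
  simpa [mul_assoc] using h' _ (h B hB)

lemma OpOne.add {A A' : ℕ × Ω → ℝ} (h : OpOne Pr A) (h' : OpOne Pr A') :
    OpOne Pr (fun p => A p + A' p) := by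
  intro B hB
  simpa [mul_add] using (h B hB).add (h' B hB)

lemma OpOne.of_tendsto {A : ℕ × Ω → ℝ} {a : ℝ} (h : Tendsto A (whp Pr) (𝓝 a)) : OpOne Pr A := by
  intro B hB
  simpa using hB.mul h

lemma OpOne.const (a : ℝ) : OpOne Pr (fun _ => a) := .of_tendsto tendsto_const_nhds

lemma OpOne.mono {A A' : ℕ × Ω → ℝ} (h : OpOne Pr A) (hle : ∀ᶠ p in whp Pr, |A' p| ≤ |A p|) :
    OpOne Pr A' := by
  intro B hB
  refine squeeze_zero_norm' ?_ (tendsto_zero_iff_norm_tendsto_zero.1 (h B hB))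
  filter_upwards [hle] with p hp
  simpa [abs_mul] using mul_le_mul_of_nonneg_left hp (abs_nonneg (B p))

lemma OpOne.abs {A : ℕ × Ω → ℝ} (h : OpOne Pr A) : OpOne Pr (fun p => |A p|) :=
  h.mono (by simp)

lemma OpOne.pow {A : ℕ × Ω → ℝ} (h : OpOne Pr A) (k : ℕ) : OpOne Pr (fun p => A p ^ k) := by
  induction k with
  | zero => simpa using OpOne.const 1
  | succ k ih => simpa [pow_succ] using ih.mul h

lemma tendsto_inv_sqrt_whp :
    Tendsto (fun p : ℕ × Ω => (Real.sqrt p.1)⁻¹) (whp Pr) (𝓝 0) := by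
  have : Tendsto (fun n : ℕ => (Real.sqrt n)⁻¹) atTop (𝓝 0) :=
    (Real.tendsto_sqrt_atTop.comp tendsto_natCast_atTop_atTop).inv_tendsto_atTop
  exact this.comp tendsto_fst_whp

/-- Chebyshev's inequality: a bounded second moment gives boundedness in probability. -/
lemma OpOne.of_integral_sq_le [IsFiniteMeasure Pr] {A : ℕ × Ω → ℝ} {C : ℝ}
    (hA : ∀ n, MemLp (fun ω => A (n, ω)) 2 Pr)
    (hC : ∀ n, ∫ ω, A (n, ω) ^ 2 ∂Pr ≤ C) : OpOne Pr A := by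
  intro B hB
  rw [Metric.tendsto_nhds]
  intro ε hε
  rw [eventually_whp, ENNReal.tendsto_nhds_zero]
  intro η hη
  obtain ⟨η', hη', hηη⟩ : ∃ η' : ℝ, 0 < η' ∧ ENNReal.ofReal η' ≤ η := by
    rcases eq_or_ne η ⊤ with rfl | hT
    · exact ⟨1, one_pos, le_top⟩
    · exact ⟨η.toReal, ENNReal.toReal_pos hη.ne' hT, by rw [ENNReal.ofReal_toReal hT]⟩
  have hC0 : 0 ≤ C := (integral_nonneg fun ω => sq_nonneg _).trans (hC 0)
  set T : ℝ := 2 * (C + 1) / η' with hT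
  have hT0 : 0 < T := by positivity
  have hbig : ∀ n, Pr {ω | T ≤ A (n, ω) ^ 2} ≤ ENNReal.ofReal (η' / 2) := by
    intro n
    have h1 := mul_meas_ge_le_integral_of_nonneg (μ := Pr)
      (ae_of_all _ fun ω => sq_nonneg (A (n, ω))) (hA n).integrable_sq T
    have h2 : Pr.real {ω | T ≤ A (n, ω) ^ 2} ≤ η' / 2 := by
      have h3 : T * Pr.real {ω | T ≤ A (n, ω) ^ 2} ≤ C := h1.trans (hC n)
      have h4 : Pr.real {ω | T ≤ A (n, ω) ^ 2} ≤ C / T := by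
        rw [le_div_iff₀ hT0]; linarith
      refine h4.trans ?_
      rw [hT, div_div_eq_mul_div, div_le_iff₀ (by positivity)]
      nlinarith
    rw [← ENNReal.ofReal_toReal (measure_ne_top Pr _)]
    exact ENNReal.ofReal_le_ofReal h2
  have hsmall := (Metric.tendsto_nhds.1 hB) (ε / (Real.sqrt T)) (by positivity)
  rw [eventually_whp, ENNReal.tendsto_nhds_zero] at hsmall
  filter_upwards [hsmall (ENNReal.ofReal (η' / 2)) (by simpa using hη')] with n hn
  calc Pr {ω | ¬ dist (B (n, ω) * A (n, ω)) 0 < ε}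
      ≤ Pr ({ω | ¬ dist (B (n, ω)) 0 < ε / Real.sqrt T} ∪ {ω | T ≤ A (n, ω) ^ 2}) := by
        refine measure_mono fun ω hω => ?_
        by_contra h
        simp only [Set.mem_union, Set.mem_ofPred_eq, not_or, not_not, not_le] at h
        refine hω ?_
        obtain ⟨h1, h2⟩ := h
        have h3 : |A (n, ω)| < Real.sqrt T := by
          rw [← Real.sqrt_sq_eq_abs]; exact Real.sqrt_lt_sqrt (sq_nonneg _) h2
        rw [Real.dist_eq, sub_zero] at h1 ⊢
        rw [abs_mul]
        calc |B (n, ω)| * |A (n, ω)| ≤ |B (n, ω)| * Real.sqrt T := by gcongr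
          _ < ε := by rwa [lt_div_iff₀ (by positivity)] at h1
    _ ≤ _ := measure_union_le _ _
    _ ≤ ENNReal.ofReal (η' / 2) + ENNReal.ofReal (η' / 2) := add_le_add hn (hbig n)
    _ = ENNReal.ofReal η' := by rw [← ENNReal.ofReal_add (by positivity) (by positivity)]; simp
    _ ≤ η := hηη

end StochasticOrder

/-! ### Moments of sums of independent random vectors -/

section Moments

variable {Ω : Type*} [MeasurableSpace Ω] {Pr : Measure Ω}

/-- The random variable `A` is integrable with expectation `v`. -/
structure HasMean (Pr : Measure Ω) (A : Ω → ℝ) (v : ℝ) : Prop where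
  integrable : Integrable A Pr
  integral_eq : ∫ ω, A ω ∂Pr = v

namespace HasMean

variable {A B : Ω → ℝ} {u v : ℝ}

lemma add (hA : HasMean Pr A u) (hB : HasMean Pr B v) :
    HasMean Pr (fun ω => A ω + B ω) (u + v) :=
  ⟨hA.1.add hB.1, by rw [integral_add hA.1 hB.1, hA.2, hB.2]⟩

lemma sub (hA : HasMean Pr A u) (hB : HasMean Pr B v) :
    HasMean Pr (fun ω => A ω - B ω) (u - v) :=
  ⟨hA.1.sub hB.1, by rw [integral_sub hA.1 hB.1, hA.2, hB.2]⟩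

lemma const_mul (c : ℝ) (hA : HasMean Pr A u) : HasMean Pr (fun ω => c * A ω) (c * u) :=
  ⟨hA.1.const_mul c, by rw [integral_const_mul, hA.2]⟩

lemma const [IsProbabilityMeasure Pr] (c : ℝ) : HasMean Pr (fun _ => c) c :=
  ⟨integrable_const c, by simp⟩

lemma congr (hA : HasMean Pr A u) (hAB : ∀ ω, B ω = A ω) (huv : v = u) : HasMean Pr B v := by
  obtain rfl : B = A := funext hAB
  exact huv ▸ hA

lemma mul_of_indepFun (hA : HasMean Pr A u) (hB : HasMean Pr B v) (h : IndepFun A B Pr) :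
    HasMean Pr (fun ω => A ω * B ω) (u * v) :=
  ⟨h.integrable_mul hA.1 hB.1, by
    rw [h.integral_fun_mul_eq_mul_integral hA.1.aestronglyMeasurable hB.1.aestronglyMeasurable,
      hA.2, hB.2]⟩

end HasMean

variable {ι J : Type*} {ξ : ι → Ω → J → ℝ}
  {m₂ : J → J → ℝ} {m₃ : J → J → J → ℝ} {m₄ : J → J → J → J → ℝ}

/-- A function of the partial sum over `s` is independent of a function of a summand outside `s`. -/
lemma HasMean.mul_of_sum_indep (hind : iIndepFun ξ Pr) (hm : ∀ i, AEMeasurable (ξ i) Pr)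
    {s : Finset ι} {i : ι} (hi : i ∉ s) {F G : (J → ℝ) → ℝ} (hF : Measurable F)
    (hG : Measurable G) {u v : ℝ} (hu : HasMean Pr (fun ω => F fun j => ∑ k ∈ s, ξ k ω j) u)
    (hv : HasMean Pr (fun ω => G (ξ i ω)) v) :
    HasMean Pr (fun ω => F (fun j => ∑ k ∈ s, ξ k ω j) * G (ξ i ω)) (u * v) := by
  refine hu.mul_of_indepFun hv ?_
  have h := (hind.indepFun_finsetSum_of_notMem₀ hm hi).comp hF hG
  have e : (F ∘ (∑ k ∈ s, ξ k)) = fun ω => F fun j => ∑ k ∈ s, ξ k ω j := by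
    funext ω
    simp only [Function.comp_apply]
    congr 1
    funext j
    simp [Finset.sum_apply]
  rw [e] at h
  exact h

lemma HasMean.sum_one (h1 : ∀ i p, HasMean Pr (fun ω => ξ i ω p) 0) (s : Finset ι) (p : J) :
    HasMean Pr (fun ω => ∑ i ∈ s, ξ i ω p) 0 :=
  ⟨integrable_finsetSum _ fun i _ => (h1 i p).1, by
    rw [integral_finsetSum _ fun i _ => (h1 i p).1]
    exact Finset.sum_eq_zero fun i _ => (h1 i p).2⟩

/-- Second moments of sums of independent mean-zero random vectors. As for the higher moments below,
a summand is added to the partial sum, from which it is independent, and the product is expanded. -/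
lemma HasMean.sum_two [IsProbabilityMeasure Pr] (hind : iIndepFun ξ Pr)
    (hm : ∀ i, AEMeasurable (ξ i) Pr)
    (h1 : ∀ i p, HasMean Pr (fun ω => ξ i ω p) 0)
    (h2 : ∀ i p q, HasMean Pr (fun ω => ξ i ω p * ξ i ω q) (m₂ p q))
    (s : Finset ι) (p q : J) :
    HasMean Pr (fun ω => (∑ i ∈ s, ξ i ω p) * ∑ i ∈ s, ξ i ω q) (s.card * m₂ p q) := by
  classical
  induction s using Finset.induction_on with
  | empty => simpa using HasMean.const 0
  | insert i s hi ih =>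
    have a := fun (p : J) => HasMean.sum_one h1 s p
    have mx : ∀ p : J, Measurable fun x : J → ℝ => x p := fun p => measurable_pi_apply p
    have t1 := HasMean.mul_of_sum_indep hind hm hi (mx p) (mx q) (a p) (h1 i q)
    have t2 := HasMean.mul_of_sum_indep hind hm hi (mx q) (mx p) (a q) (h1 i p)
    refine (((ih.add t1).add t2).add (h2 i p q)).congr (fun ω => ?_) ?_
    · simp only [Finset.sum_insert hi]; ring
    · rw [Finset.card_insert_of_notMem hi]; push_cast; ring

lemma HasMean.sum_three [IsProbabilityMeasure Pr] (hind : iIndepFun ξ Pr)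
    (hm : ∀ i, AEMeasurable (ξ i) Pr)
    (h1 : ∀ i p, HasMean Pr (fun ω => ξ i ω p) 0)
    (h2 : ∀ i p q, HasMean Pr (fun ω => ξ i ω p * ξ i ω q) (m₂ p q))
    (h3 : ∀ i p q r, HasMean Pr (fun ω => ξ i ω p * ξ i ω q * ξ i ω r) (m₃ p q r))
    (s : Finset ι) (p q r : J) :
    HasMean Pr (fun ω => (∑ i ∈ s, ξ i ω p) * (∑ i ∈ s, ξ i ω q) * ∑ i ∈ s, ξ i ω r)
      (s.card * m₃ p q r) := by
  classical
  induction s using Finset.induction_on with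
  | empty => simpa using HasMean.const 0
  | insert i s hi ih =>
    have a := fun (p : J) => HasMean.sum_one h1 s p
    have b := fun (p q : J) => HasMean.sum_two hind hm h1 h2 s p q
    have mx : ∀ p : J, Measurable fun x : J → ℝ => x p := fun p => measurable_pi_apply p
    have mxx : ∀ p q : J, Measurable fun x : J → ℝ => x p * x q := fun p q => (mx p).mul (mx q)
    have u := fun p q r =>
      HasMean.mul_of_sum_indep hind hm hi (mxx p q) (mx r) (b p q) (h1 i r)
    have v := fun p q r =>
      HasMean.mul_of_sum_indep hind hm hi (mx p) (mxx q r) (a p) (h2 i q r)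
    refine (((((((ih.add (u p q r)).add (u p r q)).add (u q r p)).add (v p q r)).add
      (v q p r)).add (v r p q)).add (h3 i p q r)).congr (fun ω => ?_) ?_
    · simp only [Finset.sum_insert hi]; ring
    · rw [Finset.card_insert_of_notMem hi]; push_cast; ring

lemma HasMean.sum_four [IsProbabilityMeasure Pr] (hind : iIndepFun ξ Pr)
    (hm : ∀ i, AEMeasurable (ξ i) Pr)
    (h1 : ∀ i p, HasMean Pr (fun ω => ξ i ω p) 0)
    (h2 : ∀ i p q, HasMean Pr (fun ω => ξ i ω p * ξ i ω q) (m₂ p q))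
    (h3 : ∀ i p q r, HasMean Pr (fun ω => ξ i ω p * ξ i ω q * ξ i ω r) (m₃ p q r))
    (h4 : ∀ i p q r t,
      HasMean Pr (fun ω => ξ i ω p * ξ i ω q * ξ i ω r * ξ i ω t) (m₄ p q r t))
    (s : Finset ι) (p q r t : J) :
    HasMean Pr (fun ω => (∑ i ∈ s, ξ i ω p) * (∑ i ∈ s, ξ i ω q) * (∑ i ∈ s, ξ i ω r) *
        ∑ i ∈ s, ξ i ω t)
      (s.card * m₄ p q r t + s.card * (s.card - 1) *
        (m₂ p q * m₂ r t + m₂ p r * m₂ q t + m₂ p t * m₂ q r)) := by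
  classical
  induction s using Finset.induction_on with
  | empty => simpa using HasMean.const 0
  | insert i s hi ih =>
    have a := fun (p : J) => HasMean.sum_one h1 s p
    have b := fun (p q : J) => HasMean.sum_two hind hm h1 h2 s p q
    have c := fun (p q r : J) => HasMean.sum_three hind hm h1 h2 h3 s p q r
    have mx : ∀ p : J, Measurable fun x : J → ℝ => x p := fun p => measurable_pi_apply p
    have mxx : ∀ p q : J, Measurable fun x : J → ℝ => x p * x q := fun p q => (mx p).mul (mx q)
    have mxxx : ∀ p q r : J, Measurable fun x : J → ℝ => x p * x q * x r :=
      fun p q r => (mxx p q).mul (mx r)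
    have u := fun p q r t =>
      HasMean.mul_of_sum_indep hind hm hi (mxxx p q r) (mx t) (c p q r) (h1 i t)
    have v := fun p q r t =>
      HasMean.mul_of_sum_indep hind hm hi (mxx p q) (mxx r t) (b p q) (h2 i r t)
    have w := fun p q r t =>
      HasMean.mul_of_sum_indep hind hm hi (mx p) (mxxx q r t) (a p) (h3 i q r t)
    refine (((((((((((((((ih.add (u p q r t)).add (u p q t r)).add (u p r t q)).add
      (u q r t p)).add (v p q r t)).add (v p r q t)).add (v p t q r)).add (v q r p t)).add
      (v q t p r)).add (v r t p q)).add (w p q r t)).add (w q p r t)).add (w r p q t)).add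
      (w t p q r)).add (h4 i p q r t)).congr (fun ω => ?_) ?_
    · simp only [Finset.sum_insert hi]; ring
    · rw [Finset.card_insert_of_notMem hi]
      push_cast
      ring

end Moments

/-! ### Moments of normalized sums of i.i.d. observations -/

lemma normSum_sample {Ω 𝓩 : Type*} (Z : ℕ → Ω → 𝓩) (n : ℕ) (ω : Ω) (h : 𝓩 → ℝ) :
    normSum (sample Z n ω) h = (Real.sqrt n)⁻¹ * ∑ i ∈ Finset.range n, h (Z i ω) := by
  rw [normSum, Finset.sum_range]
  rfl

/-- `n^{1/2} (n⁻¹ ∑ h(Zᵢ) - E h) = n^{-1/2} ∑ (h(Zᵢ) - E h)`. -/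
lemma sqrt_mul_avg_sub {𝓩 : Type*} {n : ℕ} (z : Fin n → 𝓩) (h : 𝓩 → ℝ) (c : ℝ) :
    Real.sqrt n * (avg z h - c) = normSum z (fun y => h y - c) := by
  rcases Nat.eq_zero_or_pos n with rfl | hn
  · simp [normSum]
  have hn' : (0 : ℝ) < n := by positivity
  have h2 : Real.sqrt n * Real.sqrt n = n := Real.mul_self_sqrt hn'.le
  have h3 : Real.sqrt n ≠ 0 := by positivity
  rw [avg, normSum, Finset.sum_sub_distrib, Finset.sum_const, Finset.card_univ, Fintype.card_fin,
    nsmul_eq_mul]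
  field_simp
  rw [pow_two, h2]

section NormSum

variable {Ω : Type*} [MeasurableSpace Ω] {Pr : Measure Ω} {𝓩 : Type*} [MeasurableSpace 𝓩]
  {P : Measure 𝓩}

lemma memLp_mul_of_holder {p q : ℝ≥0∞} (hpq : p⁻¹ + p⁻¹ = q⁻¹) {a b : 𝓩 → ℝ} (ha : MemLp a p P)
    (hb : MemLp b p P) : MemLp (fun z => a z * b z) q P :=
  have : ENNReal.HolderTriple p p q := ⟨hpq⟩
  hb.mul' ha

lemma ennreal_inv_two_mul_add (k : ℕ) :
    ((2 * k : ℕ) : ℝ≥0∞)⁻¹ + ((2 * k : ℕ) : ℝ≥0∞)⁻¹ = ((k : ℕ) : ℝ≥0∞)⁻¹ := by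
  rw [← two_mul, Nat.cast_mul, ENNReal.mul_inv (by simp) (by simp), ← mul_assoc]
  norm_num [ENNReal.mul_inv_cancel]

lemma MemLp.mul_sixteen {a b : 𝓩 → ℝ} (ha : MemLp a 16 P) (hb : MemLp b 16 P) :
    MemLp (fun z => a z * b z) 8 P :=
  memLp_mul_of_holder (by simpa using ennreal_inv_two_mul_add 8) ha hb

lemma MemLp.mul_eight {a b : 𝓩 → ℝ} (ha : MemLp a 8 P) (hb : MemLp b 8 P) :
    MemLp (fun z => a z * b z) 4 P :=
  memLp_mul_of_holder (by simpa using ennreal_inv_two_mul_add 4) ha hb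

lemma MemLp.mul_four {a b : 𝓩 → ℝ} (ha : MemLp a 4 P) (hb : MemLp b 4 P) :
    MemLp (fun z => a z * b z) 2 P :=
  memLp_mul_of_holder (by simpa using ennreal_inv_two_mul_add 2) ha hb

lemma MemLp.integrable_mul_mul_mul {a b c d : 𝓩 → ℝ} (ha : MemLp a 4 P) (hb : MemLp b 4 P)
    (hc : MemLp c 4 P) (hd : MemLp d 4 P) : Integrable (fun z => a z * b z * c z * d z) P :=
  ((MemLp.mul_four ha hb).integrable_mul (MemLp.mul_four hc hd)).congr
    (ae_of_all _ fun z => by simp [mul_assoc])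

/-- The observations `Z i` are independent with common distribution `P`. -/
structure IIDSample (Pr : Measure Ω) (P : Measure 𝓩) (Z : ℕ → Ω → 𝓩) : Prop where
  indep : iIndepFun Z Pr
  measurePreserving : ∀ i, MeasurePreserving (Z i) Pr P

variable {Z : ℕ → Ω → 𝓩}

lemma HasMean.comp_measurePreserving {h : 𝓩 → ℝ} {v : ℝ} (hh : HasMean P h v) {φ : Ω → 𝓩}
    (hφ : MeasurePreserving φ Pr P) : HasMean Pr (fun ω => h (φ ω)) v := by
  refine ⟨(hφ.integrable_comp hh.1.aestronglyMeasurable).2 hh.1, ?_⟩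
  have h' : AEStronglyMeasurable h (Pr.map φ) := by rw [hφ.map_eq]; exact hh.1.aestronglyMeasurable
  rw [← hh.2, ← hφ.map_eq, integral_map hφ.measurable.aemeasurable h']

variable {J : Type*} [Finite J] {g : J → 𝓩 → ℝ}

lemma IIDSample.iIndepFun_comp (hZ : IIDSample Pr P Z) (hg : ∀ j, MemLp (g j) 4 P) :
    iIndepFun (fun i ω j => g j (Z i ω)) Pr := by
  refine hZ.indep.comp₀ (fun _ z j => g j z) (fun i => (hZ.measurePreserving i).aemeasurable)
    fun i => ?_
  rw [(hZ.measurePreserving i).map_eq]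
  exact aemeasurable_pi_lambda _ fun j => (hg j).aestronglyMeasurable.aemeasurable

lemma IIDSample.aemeasurable_comp (hZ : IIDSample Pr P Z) (hg : ∀ j, MemLp (g j) 4 P) (i : ℕ) :
    AEMeasurable (fun ω j => g j (Z i ω)) Pr :=
  aemeasurable_pi_lambda _ fun j =>
    ((hg j).comp_measurePreserving (hZ.measurePreserving i)).aestronglyMeasurable.aemeasurable

variable [IsProbabilityMeasure P]

lemma MemLp.integrable_mul_four {a b : 𝓩 → ℝ} (ha : MemLp a 4 P) (hb : MemLp b 4 P) :
    Integrable (fun z => a z * b z) P :=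
  (MemLp.mul_four ha hb).integrable one_le_two

lemma MemLp.integrable_mul_mul {a b c : 𝓩 → ℝ} (ha : MemLp a 4 P) (hb : MemLp b 4 P)
    (hc : MemLp c 4 P) : Integrable (fun z => a z * b z * c z) P :=
  (MemLp.mul_four ha hb).integrable_mul (hc.mono_exponent (p := 2) (by norm_num))

lemma IIDSample.hasMean_normSum_one (hZ : IIDSample Pr P Z) {h : 𝓩 → ℝ} (hh : MemLp h 4 P)
    (h0 : ∫ z, h z ∂P = 0) (n : ℕ) :
    HasMean Pr (fun ω => normSum (sample Z n ω) h) 0 := by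
  have h1 : ∀ i (_ : Unit), HasMean Pr (fun ω => h (Z i ω)) 0 := fun i _ =>
    (HasMean.mk (hh.integrable (by norm_num)) h0).comp_measurePreserving (hZ.measurePreserving i)
  exact ((HasMean.sum_one h1 (Finset.range n) ()).const_mul (Real.sqrt n)⁻¹).congr
    (fun ω => normSum_sample Z n ω h) (by simp)

variable [IsProbabilityMeasure Pr]

lemma IIDSample.hasMean_normSum_two (hZ : IIDSample Pr P Z) (hg : ∀ j, MemLp (g j) 4 P)
    (h0 : ∀ j, ∫ z, g j z ∂P = 0) {n : ℕ} (hn : n ≠ 0) (p q : J) :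
    HasMean Pr (fun ω => normSum (sample Z n ω) (g p) * normSum (sample Z n ω) (g q))
      (∫ z, g p z * g q z ∂P) := by
  have h1 : ∀ i p, HasMean Pr (fun ω => g p (Z i ω)) 0 := fun i p =>
    (HasMean.mk ((hg p).integrable (by norm_num)) (h0 p)).comp_measurePreserving
      (hZ.measurePreserving i)
  have h2 : ∀ i p q, HasMean Pr (fun ω => g p (Z i ω) * g q (Z i ω)) (∫ z, g p z * g q z ∂P) :=
    fun i p q => (HasMean.mk (MemLp.integrable_mul_four (hg p) (hg q)) rfl).comp_measurePreserving
      (hZ.measurePreserving i)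
  have hs := HasMean.sum_two (hZ.iIndepFun_comp hg) (hZ.aemeasurable_comp hg) h1 h2
    (Finset.range n) p q
  have hn' : (0 : ℝ) < n := by positivity
  refine (hs.const_mul ((Real.sqrt n)⁻¹ ^ 2)).congr (fun ω => ?_) ?_
  · rw [normSum_sample, normSum_sample]; ring
  · rw [inv_pow, Real.sq_sqrt hn'.le, Finset.card_range]; field_simp

lemma IIDSample.hasMean_normSum_three (hZ : IIDSample Pr P Z) (hg : ∀ j, MemLp (g j) 4 P)
    (h0 : ∀ j, ∫ z, g j z ∂P = 0) {n : ℕ} (hn : n ≠ 0) (p q r : J) :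
    HasMean Pr (fun ω => normSum (sample Z n ω) (g p) * normSum (sample Z n ω) (g q) *
        normSum (sample Z n ω) (g r))
      ((Real.sqrt n)⁻¹ * ∫ z, g p z * g q z * g r z ∂P) := by
  have h1 : ∀ i p, HasMean Pr (fun ω => g p (Z i ω)) 0 := fun i p =>
    (HasMean.mk ((hg p).integrable (by norm_num)) (h0 p)).comp_measurePreserving
      (hZ.measurePreserving i)
  have h2 : ∀ i p q, HasMean Pr (fun ω => g p (Z i ω) * g q (Z i ω)) (∫ z, g p z * g q z ∂P) :=
    fun i p q => (HasMean.mk (MemLp.integrable_mul_four (hg p) (hg q)) rfl).comp_measurePreserving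
      (hZ.measurePreserving i)
  have h3 : ∀ i p q r, HasMean Pr (fun ω => g p (Z i ω) * g q (Z i ω) * g r (Z i ω))
      (∫ z, g p z * g q z * g r z ∂P) := fun i p q r =>
    (HasMean.mk (MemLp.integrable_mul_mul (hg p) (hg q) (hg r)) rfl).comp_measurePreserving
      (hZ.measurePreserving i)
  have hs := HasMean.sum_three (hZ.iIndepFun_comp hg) (hZ.aemeasurable_comp hg) h1 h2 h3
    (Finset.range n) p q r
  have hn' : (0 : ℝ) < n := by positivity
  refine (hs.const_mul ((Real.sqrt n)⁻¹ ^ 3)).congr (fun ω => ?_) ?_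
  · simp only [normSum_sample]; ring
  · rw [pow_succ, inv_pow, Real.sq_sqrt hn'.le, Finset.card_range]; field_simp

lemma IIDSample.hasMean_normSum_four (hZ : IIDSample Pr P Z) (hg : ∀ j, MemLp (g j) 4 P)
    (h0 : ∀ j, ∫ z, g j z ∂P = 0) {n : ℕ} (hn : n ≠ 0) (p q r t : J) :
    HasMean Pr (fun ω => normSum (sample Z n ω) (g p) * normSum (sample Z n ω) (g q) *
        normSum (sample Z n ω) (g r) * normSum (sample Z n ω) (g t))
      ((n : ℝ)⁻¹ * ∫ z, g p z * g q z * g r z * g t z ∂P +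
        (1 - (n : ℝ)⁻¹) * ((∫ z, g p z * g q z ∂P) * (∫ z, g r z * g t z ∂P) +
          (∫ z, g p z * g r z ∂P) * (∫ z, g q z * g t z ∂P) +
          (∫ z, g p z * g t z ∂P) * (∫ z, g q z * g r z ∂P))) := by
  have h1 : ∀ i p, HasMean Pr (fun ω => g p (Z i ω)) 0 := fun i p =>
    (HasMean.mk ((hg p).integrable (by norm_num)) (h0 p)).comp_measurePreserving
      (hZ.measurePreserving i)
  have h2 : ∀ i p q, HasMean Pr (fun ω => g p (Z i ω) * g q (Z i ω)) (∫ z, g p z * g q z ∂P) :=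
    fun i p q => (HasMean.mk (MemLp.integrable_mul_four (hg p) (hg q)) rfl).comp_measurePreserving
      (hZ.measurePreserving i)
  have h3 : ∀ i p q r, HasMean Pr (fun ω => g p (Z i ω) * g q (Z i ω) * g r (Z i ω))
      (∫ z, g p z * g q z * g r z ∂P) := fun i p q r =>
    (HasMean.mk (MemLp.integrable_mul_mul (hg p) (hg q) (hg r)) rfl).comp_measurePreserving
      (hZ.measurePreserving i)
  have h4 : ∀ i p q r t,
      HasMean Pr (fun ω => g p (Z i ω) * g q (Z i ω) * g r (Z i ω) * g t (Z i ω))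
        (∫ z, g p z * g q z * g r z * g t z ∂P) := fun i p q r t => by
    exact (HasMean.mk (MemLp.integrable_mul_mul_mul (hg p) (hg q) (hg r) (hg t))
      rfl).comp_measurePreserving (hZ.measurePreserving i)
  have hs := HasMean.sum_four (hZ.iIndepFun_comp hg) (hZ.aemeasurable_comp hg) h1 h2 h3 h4
    (Finset.range n) p q r t
  have hn' : (0 : ℝ) < n := by positivity
  refine (hs.const_mul ((Real.sqrt n)⁻¹ ^ 4)).congr (fun ω => ?_) ?_
  · simp only [normSum_sample]; ring
  · rw [show (Real.sqrt n)⁻¹ ^ 4 = ((Real.sqrt n) ^ 2)⁻¹ ^ 2 by rw [← inv_pow]; ring,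
      Real.sq_sqrt hn'.le, Finset.card_range]
    field_simp

/-- A normalized sum of mean-zero square-integrable terms is bounded in probability. -/
lemma IIDSample.opOne_normSum (hZ : IIDSample Pr P Z) {h : 𝓩 → ℝ} (hh : MemLp h 2 P)
    (h0 : ∫ z, h z ∂P = 0) :
    OpOne Pr (fun p => normSum (sample Z p.1 p.2) h) := by
  have hmem : ∀ i, MemLp (fun ω => h (Z i ω)) 2 Pr := fun i =>
    hh.comp_measurePreserving (hZ.measurePreserving i)
  have h1 : ∀ i (_ : Unit), HasMean Pr (fun ω => h (Z i ω)) 0 := fun i _ =>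
    (HasMean.mk (hh.integrable one_le_two) h0).comp_measurePreserving (hZ.measurePreserving i)
  have h2 : ∀ i (_ _ : Unit), HasMean Pr (fun ω => h (Z i ω) * h (Z i ω))
      (∫ z, h z * h z ∂P) := fun i _ _ =>
    (HasMean.mk (hh.integrable_mul hh) rfl).comp_measurePreserving (hZ.measurePreserving i)
  have hind : iIndepFun (fun i ω (_ : Unit) => h (Z i ω)) Pr := by
    refine hZ.indep.comp₀ (fun _ z _ => h z) (fun i => (hZ.measurePreserving i).aemeasurable)
      fun i => ?_
    rw [(hZ.measurePreserving i).map_eq]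
    exact aemeasurable_pi_lambda _ fun j => hh.aestronglyMeasurable.aemeasurable
  have hm : ∀ i, AEMeasurable (fun ω (_ : Unit) => h (Z i ω)) Pr := fun i =>
    aemeasurable_pi_lambda _ fun _ => (hmem i).aestronglyMeasurable.aemeasurable
  refine OpOne.of_integral_sq_le (C := ∫ z, h z * h z ∂P) (fun n => ?_) fun n => ?_
  · simp only [normSum_sample]
    exact (memLp_finsetSum _ fun i _ => hmem i).const_mul _
  · have hs := HasMean.sum_two hind hm h1 h2 (Finset.range n) () ()
    have := ((hs.const_mul ((Real.sqrt n)⁻¹ ^ 2)).congr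
      (B := fun ω => normSum (sample Z n ω) h ^ 2) (fun ω => by rw [normSum_sample]; ring) rfl).2
    rw [this, inv_pow, Real.sq_sqrt (Nat.cast_nonneg n), Finset.card_range, ← mul_assoc]
    have h0 : 0 ≤ ∫ z, h z * h z ∂P := integral_nonneg fun z => mul_self_nonneg _
    exact mul_le_of_le_one_left h0 (by rw [mul_comm]; exact mul_inv_le_one)

/-- The weak law of large numbers for square-integrable functions. -/
lemma IIDSample.tendsto_avg (hZ : IIDSample Pr P Z) {h : 𝓩 → ℝ} (hh : MemLp h 2 P) :
    Tendsto (fun p : ℕ × Ω => avg (sample Z p.1 p.2) h) (whp Pr) (𝓝 (∫ z, h z ∂P)) := by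
  have h1 := hZ.opOne_normSum (h := fun z => h z - ∫ z, h z ∂P) (hh.sub (memLp_const _)) (by
    rw [integral_sub (hh.integrable one_le_two) (integrable_const _)]; simp)
  have h2 := (h1 _ tendsto_inv_sqrt_whp).add_const (∫ z, h z ∂P)
  rw [zero_add] at h2
  refine h2.congr' ?_
  filter_upwards [tendsto_fst_whp.eventually (eventually_gt_atTop 0)] with p hp
  have h3 : Real.sqrt p.1 ≠ 0 := by positivity
  rw [← sqrt_mul_avg_sub, ← mul_assoc, inv_mul_cancel₀ h3]
  ring

end NormSum

/-! ### Resampling averages -/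

section Resample

/-- The average over all `nⁿ` resampling maps, i.e. the expectation over `n` i.i.d. uniform draws
from `Fin n`. -/
def resampleAvg {n : ℕ} (F : (Fin n → Fin n) → ℝ) : ℝ := ((n : ℝ) ^ n)⁻¹ * ∑ r, F r

variable {n : ℕ}

lemma resampleAvg_add (F G : (Fin n → Fin n) → ℝ) :
    resampleAvg (fun r => F r + G r) = resampleAvg F + resampleAvg G := by
  simp [resampleAvg, Finset.sum_add_distrib, mul_add]

lemma resampleAvg_sub (F G : (Fin n → Fin n) → ℝ) :
    resampleAvg (fun r => F r - G r) = resampleAvg F - resampleAvg G := by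
  simp [resampleAvg, Finset.sum_sub_distrib, mul_sub]

lemma resampleAvg_const_mul (c : ℝ) (F : (Fin n → Fin n) → ℝ) :
    resampleAvg (fun r => c * F r) = c * resampleAvg F := by
  simp only [resampleAvg, ← Finset.mul_sum]; ring

lemma resampleAvg_const (hn : n ≠ 0) (c : ℝ) :
    resampleAvg (fun _ : Fin n → Fin n => c) = c := by
  have : (n : ℝ) ^ n ≠ 0 := by positivity
  simp [resampleAvg, this]

lemma resampleAvg_mono {F G : (Fin n → Fin n) → ℝ} (h : ∀ r, F r ≤ G r) :
    resampleAvg F ≤ resampleAvg G :=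
  mul_le_mul_of_nonneg_left (Finset.sum_le_sum fun r _ => h r) (by positivity)

lemma abs_resampleAvg_le (F : (Fin n → Fin n) → ℝ) :
    |resampleAvg F| ≤ resampleAvg fun r => |F r| := by
  rw [resampleAvg, abs_mul, abs_of_nonneg (by positivity)]
  exact mul_le_mul_of_nonneg_left (Finset.abs_sum_le_sum_abs _ _) (by positivity)

/-- The uniform distribution on `Fin n`. -/
def uniformFin (n : ℕ) : Measure (Fin n) := (n : ℝ≥0∞)⁻¹ • Measure.count

lemma isProbabilityMeasure_uniformFin (hn : n ≠ 0) : IsProbabilityMeasure (uniformFin n) := by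
  refine ⟨?_⟩
  simp only [uniformFin, Measure.smul_apply, smul_eq_mul, Measure.count_univ]
  simp [ENNReal.inv_mul_cancel, hn]

lemma hasMean_uniformFin (hn : n ≠ 0) (F : Fin n → ℝ) :
    HasMean (uniformFin n) F ((n : ℝ)⁻¹ * ∑ i, F i) := by
  have := isProbabilityMeasure_uniformFin hn
  refine ⟨.of_finite, ?_⟩
  rw [integral_fintype .of_finite, Finset.mul_sum]
  simp [uniformFin, Measure.real]

lemma integral_pi_uniformFin (hn : n ≠ 0) (F : (Fin n → Fin n) → ℝ) :
    ∫ r, F r ∂(Measure.pi fun _ : Fin n => uniformFin n) = resampleAvg F := by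
  have := isProbabilityMeasure_uniformFin hn
  rw [integral_fintype .of_finite, resampleAvg, Finset.mul_sum]
  have h (r : Fin n → Fin n) :
      (Measure.pi fun _ : Fin n => uniformFin n).real {r} = ((n : ℝ) ^ n)⁻¹ := by
    rw [Measure.real, Measure.pi_singleton]
    simp [uniformFin]
  simp [h]

variable {𝓩 : Type*} (z : Fin n → 𝓩) {J : Type*} (g : J → 𝓩 → ℝ)

lemma iIndepFun_resample (hn : n ≠ 0) :
    iIndepFun (fun (i : Fin n) (r : Fin n → Fin n) j => g j (z (r i)))
      (Measure.pi fun _ : Fin n => uniformFin n) := by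
  have := isProbabilityMeasure_uniformFin hn
  exact iIndepFun_pi (X := fun _ k j => g j (z k)) fun _ => Measurable.of_discrete.aemeasurable

lemma hasMean_resample (hn : n ≠ 0) (h : 𝓩 → ℝ) (i : Fin n) :
    HasMean (Measure.pi fun _ : Fin n => uniformFin n) (fun r => h (z (r i))) (avg z h) := by
  have := isProbabilityMeasure_uniformFin hn
  exact (hasMean_uniformFin hn fun i => h (z i)).comp_measurePreserving
    (measurePreserving_eval _ i)

section

variable {z g} (hn : n ≠ 0) (h0 : ∀ j, avg z (g j) = 0)
include hn h0

lemma resampleAvg_avg (p : J) : resampleAvg (fun r => avg (z ∘ r) (g p)) = 0 := by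
  have := isProbabilityMeasure_uniformFin hn
  rw [← integral_pi_uniformFin hn]
  have h1 : ∀ i p, HasMean (Measure.pi fun _ : Fin n => uniformFin n)
      (fun r => g p (z (r i))) 0 := fun i p => h0 p ▸ hasMean_resample z hn (g p) i
  exact (((HasMean.sum_one h1 Finset.univ p).const_mul (n : ℝ)⁻¹).congr (fun r => rfl)
    (by simp)).2

lemma resampleAvg_avg_mul_avg (p q : J) :
    resampleAvg (fun r => avg (z ∘ r) (g p) * avg (z ∘ r) (g q))
      = (n : ℝ)⁻¹ * avg z (fun y => g p y * g q y) := by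
  have := isProbabilityMeasure_uniformFin hn
  rw [← integral_pi_uniformFin hn]
  have h1 : ∀ i p, HasMean (Measure.pi fun _ : Fin n => uniformFin n)
      (fun r => g p (z (r i))) 0 := fun i p => h0 p ▸ hasMean_resample z hn (g p) i
  have h2 : ∀ i p q, HasMean (Measure.pi fun _ : Fin n => uniformFin n)
      (fun r => g p (z (r i)) * g q (z (r i))) (avg z fun y => g p y * g q y) := fun i p q =>
    hasMean_resample z hn (fun y => g p y * g q y) i
  refine (((HasMean.sum_two (iIndepFun_resample z g hn)
    (fun _ => Measurable.of_discrete.aemeasurable) h1 h2 Finset.univ p q).const_mul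
      ((n : ℝ)⁻¹ ^ 2)).congr (fun r => ?_) ?_).2
  · simp only [avg, Function.comp]; ring
  · simp only [Finset.card_univ, Fintype.card_fin]; field_simp

lemma resampleAvg_avg_mul_avg_mul_avg (p q t : J) :
    resampleAvg (fun r => avg (z ∘ r) (g p) * avg (z ∘ r) (g q) * avg (z ∘ r) (g t))
      = (n : ℝ)⁻¹ ^ 2 * avg z (fun y => g p y * g q y * g t y) := by
  have := isProbabilityMeasure_uniformFin hn
  rw [← integral_pi_uniformFin hn]
  have h1 : ∀ i p, HasMean (Measure.pi fun _ : Fin n => uniformFin n)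
      (fun r => g p (z (r i))) 0 := fun i p => h0 p ▸ hasMean_resample z hn (g p) i
  have h2 : ∀ i p q, HasMean (Measure.pi fun _ : Fin n => uniformFin n)
      (fun r => g p (z (r i)) * g q (z (r i))) (avg z fun y => g p y * g q y) := fun i p q =>
    hasMean_resample z hn (fun y => g p y * g q y) i
  have h3 : ∀ i p q t, HasMean (Measure.pi fun _ : Fin n => uniformFin n)
      (fun r => g p (z (r i)) * g q (z (r i)) * g t (z (r i)))
      (avg z fun y => g p y * g q y * g t y) := fun i p q t =>
    hasMean_resample z hn (fun y => g p y * g q y * g t y) i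
  refine (((HasMean.sum_three (iIndepFun_resample z g hn)
    (fun _ => Measurable.of_discrete.aemeasurable) h1 h2 h3 Finset.univ p q t).const_mul
      ((n : ℝ)⁻¹ ^ 3)).congr (fun r => ?_) ?_).2
  · simp only [avg, Function.comp]; ring
  · simp only [Finset.card_univ, Fintype.card_fin]; field_simp

lemma resampleAvg_avg_pow_four_le (p : J) :
    resampleAvg (fun r => avg (z ∘ r) (g p) ^ 4)
      ≤ (n : ℝ)⁻¹ ^ 2 * (3 * avg z (fun y => g p y ^ 4)) := by
  have := isProbabilityMeasure_uniformFin hn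
  rw [← integral_pi_uniformFin hn]
  have h1 : ∀ i p, HasMean (Measure.pi fun _ : Fin n => uniformFin n)
      (fun r => g p (z (r i))) 0 := fun i p => h0 p ▸ hasMean_resample z hn (g p) i
  have h2 : ∀ i p q, HasMean (Measure.pi fun _ : Fin n => uniformFin n)
      (fun r => g p (z (r i)) * g q (z (r i))) (avg z fun y => g p y * g q y) := fun i p q =>
    hasMean_resample z hn (fun y => g p y * g q y) i
  have h3 : ∀ i p q t, HasMean (Measure.pi fun _ : Fin n => uniformFin n)
      (fun r => g p (z (r i)) * g q (z (r i)) * g t (z (r i)))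
      (avg z fun y => g p y * g q y * g t y) := fun i p q t =>
    hasMean_resample z hn (fun y => g p y * g q y * g t y) i
  have h4 : ∀ i p q t u, HasMean (Measure.pi fun _ : Fin n => uniformFin n)
      (fun r => g p (z (r i)) * g q (z (r i)) * g t (z (r i)) * g u (z (r i)))
      (avg z fun y => g p y * g q y * g t y * g u y) := fun i p q t u =>
    hasMean_resample z hn (fun y => g p y * g q y * g t y * g u y) i
  set A := avg z fun y => g p y ^ 4 with hA
  set B := avg z fun y => g p y * g p y with hB
  have hn1 : (1 : ℝ) ≤ n := by exact_mod_cast Nat.one_le_iff_ne_zero.2 hn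
  have hBA : B ^ 2 ≤ A := by
    have h := sq_sum_le_card_mul_sum_sq (s := Finset.univ) (f := fun i => g p (z i) * g p (z i))
    simp only [Finset.card_univ, Fintype.card_fin] at h
    rw [hA, hB, avg, avg, mul_pow]
    calc _ ≤ (n : ℝ)⁻¹ ^ 2 * (n * ∑ i, (g p (z i) * g p (z i)) ^ 2) := by gcongr
      _ = (n : ℝ)⁻¹ * ∑ i, (g p (z i) * g p (z i)) ^ 2 := by field_simp
      _ = _ := by congr 1; exact Finset.sum_congr rfl fun i _ => by ring
  have e : (fun y => g p y * g p y * g p y * g p y) = fun y => g p y ^ 4 := by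
    funext y; ring
  have hs := ((HasMean.sum_four (iIndepFun_resample z g hn)
    (fun _ => Measurable.of_discrete.aemeasurable) h1 h2 h3 h4 Finset.univ p p p p).const_mul
      ((n : ℝ)⁻¹ ^ 4)).congr (B := fun r => avg (z ∘ r) (g p) ^ 4)
      (v := (n : ℝ)⁻¹ ^ 4 * (n * A + n * (n - 1) * (3 * B ^ 2)))
      (fun r => by simp only [avg, Function.comp]; ring)
      (by simp only [Finset.card_univ, Fintype.card_fin]; rw [e, ← hA, ← hB]; ring)
  rw [hs.2]
  have h5 : (n : ℝ) * A + n * (n - 1) * (3 * B ^ 2) ≤ n ^ 2 * (3 * A) := by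
    have hA0 : 0 ≤ A := (sq_nonneg B).trans hBA
    nlinarith [mul_nonneg (mul_nonneg (by linarith : (0:ℝ) ≤ n) (by linarith : (0:ℝ) ≤ n - 1))
      (sub_nonneg.2 hBA), mul_nonneg (by linarith : (0:ℝ) ≤ n) hA0,
      mul_nonneg (mul_nonneg (by linarith : (0:ℝ) ≤ n) (by linarith : (0:ℝ) ≤ n - 1)) hA0]
  calc _ ≤ (n : ℝ)⁻¹ ^ 4 * (n ^ 2 * (3 * A)) := by gcongr
    _ = _ := by field_simp

end

end Resample

/-! ### Expansion of a root of a perturbed equation -/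

section Root

/-- First-order term of the root `δ` of `c₁ + (J + e₂) δ + (K₃ + e₃) δ² / 2 + ⋯ = 0`, as a power
series in the small quantities `c₁, e₂, e₃`. -/
def rootLin (J c₁ : ℝ) : ℝ := -(J⁻¹ * c₁)

/-- The second-order term of the root is `rootLin` times this linear form. -/
def rootSlope (J K₃ c₁ e₂ : ℝ) : ℝ := -(J⁻¹ * (K₃ * rootLin J c₁ / 2 + e₂))

/-- Third-order term of the root. -/
def rootCubic (J K₃ K₄ c₁ e₂ e₃ : ℝ) : ℝ :=
  -(J⁻¹ * (e₂ * (rootLin J c₁ * rootSlope J K₃ c₁ e₂) + e₃ * rootLin J c₁ ^ 2 / 2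
    + K₃ * rootLin J c₁ * (rootLin J c₁ * rootSlope J K₃ c₁ e₂) + K₄ * rootLin J c₁ ^ 3 / 6))

variable {ι : Type*} {l : Filter ι} {ε f g : ι → ℝ}

lemma isBigO_mul_pow {a b : ℕ} (hf : f =O[l] fun i => ε i ^ a) (hg : g =O[l] fun i => ε i ^ b) :
    (fun i => f i * g i) =O[l] fun i => ε i ^ (a + b) := by
  simpa [pow_add] using hf.mul hg

lemma isBigO_pow_of_le (hε : ε =O[l] fun _ => (1 : ℝ)) {a b : ℕ} (hab : b ≤ a)
    (hf : f =O[l] fun i => ε i ^ a) : f =O[l] fun i => ε i ^ b := by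
  obtain ⟨c, rfl⟩ := Nat.exists_eq_add_of_le hab
  refine hf.trans ?_
  have := (isBigO_refl (fun i => ε i ^ b) l).mul (hε.pow c)
  simpa [pow_add] using this

variable {J K₃ K₄ c₁ e₂ e₃ e₄ r δ : ι → ℝ}

lemma rootLin_isBigO (hJ : (fun i => (J i)⁻¹) =O[l] fun i => ε i ^ 0)
    (hc : c₁ =O[l] fun i => ε i ^ 1) :
    (fun i => rootLin (J i) (c₁ i)) =O[l] fun i => ε i ^ 1 :=
  (isBigO_mul_pow hJ hc).neg_left

lemma rootSlope_isBigO (hJ : (fun i => (J i)⁻¹) =O[l] fun i => ε i ^ 0)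
    (hK₃ : K₃ =O[l] fun i => ε i ^ 0)
    (hc : c₁ =O[l] fun i => ε i ^ 1) (he₂ : e₂ =O[l] fun i => ε i ^ 1) :
    (fun i => rootSlope (J i) (K₃ i) (c₁ i) (e₂ i)) =O[l] fun i => ε i ^ 1 := by
  have h : (fun i => K₃ i * rootLin (J i) (c₁ i) / 2) =O[l] fun i => ε i ^ 1 := by
    simpa [div_eq_inv_mul] using
      (isBigO_mul_pow hK₃ (rootLin_isBigO hJ hc)).const_mul_left (2⁻¹ : ℝ)
  exact (isBigO_mul_pow hJ (h.add he₂)).neg_left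

lemma rootCubic_isBigO (hJ : (fun i => (J i)⁻¹) =O[l] fun i => ε i ^ 0)
    (hK₃ : K₃ =O[l] fun i => ε i ^ 0) (hK₄ : K₄ =O[l] fun i => ε i ^ 0)
    (hc : c₁ =O[l] fun i => ε i ^ 1) (he₂ : e₂ =O[l] fun i => ε i ^ 1)
    (he₃ : e₃ =O[l] fun i => ε i ^ 1) :
    (fun i => rootCubic (J i) (K₃ i) (K₄ i) (c₁ i) (e₂ i) (e₃ i)) =O[l] fun i => ε i ^ 3 := by
  have hx := rootLin_isBigO hJ hc
  have hxy := isBigO_mul_pow hx (rootSlope_isBigO hJ hK₃ hc he₂)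
  have hx2 : (fun i => rootLin (J i) (c₁ i) ^ 2) =O[l] fun i => ε i ^ 2 := by
    simpa [pow_two] using isBigO_mul_pow hx hx
  have hx3 : (fun i => rootLin (J i) (c₁ i) ^ 3) =O[l] fun i => ε i ^ 3 := by
    simpa [pow_succ] using isBigO_mul_pow hx2 hx
  have h2 : (fun i => e₃ i * rootLin (J i) (c₁ i) ^ 2 / 2) =O[l] fun i => ε i ^ 3 := by
    simpa [div_eq_inv_mul] using (isBigO_mul_pow he₃ hx2).const_mul_left (2⁻¹ : ℝ)
  have h4 : (fun i => K₄ i * rootLin (J i) (c₁ i) ^ 3 / 6) =O[l] fun i => ε i ^ 3 := by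
    simpa [div_eq_inv_mul] using (isBigO_mul_pow hK₄ hx3).const_mul_left (6⁻¹ : ℝ)
  exact (isBigO_mul_pow hJ ((((isBigO_mul_pow he₂ hxy).add h2).add
    (isBigO_mul_pow (isBigO_mul_pow hK₃ hx) hxy)).add h4)).neg_left

/-- Third-order expansion of a small root of a perturbed equation, obtained by substituting the
approximation of each order into the equation. -/
lemma root_expansion (hε : ε =O[l] fun _ => (1 : ℝ)) (hJ0 : ∀ᶠ i in l, J i ≠ 0)
    (hJ : (fun i => (J i)⁻¹) =O[l] fun i => ε i ^ 0)
    (hK₃ : K₃ =O[l] fun i => ε i ^ 0) (hK₄ : K₄ =O[l] fun i => ε i ^ 0)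
    (hc : c₁ =O[l] fun i => ε i ^ 1) (he₂ : e₂ =O[l] fun i => ε i ^ 1)
    (he₃ : e₃ =O[l] fun i => ε i ^ 1) (he₄ : e₄ =O[l] fun i => ε i ^ 1)
    (hδ : δ =O[l] fun i => ε i ^ 1) (hr : r =O[l] fun i => ε i ^ 4)
    (heq : ∀ᶠ i in l, c₁ i + (J i + e₂ i) * δ i + (K₃ i + e₃ i) * δ i ^ 2 / 2
      + (K₄ i + e₄ i) * δ i ^ 3 / 6 + r i = 0) :
    (fun i => δ i - (rootLin (J i) (c₁ i) + rootLin (J i) (c₁ i) *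
      rootSlope (J i) (K₃ i) (c₁ i) (e₂ i)
      + rootCubic (J i) (K₃ i) (K₄ i) (c₁ i) (e₂ i) (e₃ i))) =O[l] fun i => ε i ^ 4 := by
  have low : ∀ {f : ι → ℝ} {a : ℕ} (b : ℕ), b ≤ a → (f =O[l] fun i => ε i ^ a) →
      f =O[l] fun i => ε i ^ b := fun b hab hf => isBigO_pow_of_le hε hab hf
  have div : ∀ {f : ι → ℝ} {a : ℕ} (c : ℝ), (f =O[l] fun i => ε i ^ a) →
      (fun i => f i / c) =O[l] fun i => ε i ^ a := fun c hf => by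
    simpa [div_eq_inv_mul] using hf.const_mul_left c⁻¹
  set x := fun i => rootLin (J i) (c₁ i) with hx_def
  set y := fun i => rootSlope (J i) (K₃ i) (c₁ i) (e₂ i) with hy_def
  have hx : x =O[l] fun i => ε i ^ 1 := rootLin_isBigO hJ hc
  have hy : y =O[l] fun i => ε i ^ 1 := rootSlope_isBigO hJ hK₃ hc he₂
  have hxy := isBigO_mul_pow hx hy
  have hδ2 : (fun i => δ i ^ 2) =O[l] fun i => ε i ^ 2 := by
    simpa [pow_two] using isBigO_mul_pow hδ hδ
  have hδ3 : (fun i => δ i ^ 3) =O[l] fun i => ε i ^ 3 := by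
    simpa [pow_succ] using isBigO_mul_pow hδ2 hδ
  have hK₃e : (fun i => K₃ i + e₃ i) =O[l] fun i => ε i ^ 0 := hK₃.add (low 0 (by simp) he₃)
  have hK₄e : (fun i => K₄ i + e₄ i) =O[l] fun i => ε i ^ 0 := hK₄.add (low 0 (by simp) he₄)
  have hroot : ∀ᶠ i in l, δ i = -((J i)⁻¹ * (c₁ i + e₂ i * δ i + (K₃ i + e₃ i) * δ i ^ 2 / 2
      + (K₄ i + e₄ i) * δ i ^ 3 / 6 + r i)) := by
    filter_upwards [hJ0, heq] with i h0 hi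
    have h : J i * δ i = -(c₁ i + e₂ i * δ i + (K₃ i + e₃ i) * δ i ^ 2 / 2
      + (K₄ i + e₄ i) * δ i ^ 3 / 6 + r i) := by linear_combination hi
    rw [← mul_neg, ← h, inv_mul_cancel_left₀ h0]
  have h1 : (fun i => δ i - x i) =O[l] fun i => ε i ^ 2 := by
    have : (fun i => δ i - x i) =ᶠ[l] fun i => -((J i)⁻¹ * (e₂ i * δ i
        + (K₃ i + e₃ i) * δ i ^ 2 / 2 + (K₄ i + e₄ i) * δ i ^ 3 / 6 + r i)) := by
      filter_upwards [hroot] with i hJδ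
      simp only [hx_def, rootLin]
      linear_combination hJδ
    refine this.trans_isBigO (isBigO_mul_pow (b := 2) hJ (((?_ : _ =O[l] _).add ?_).add
      ?_ |>.add ?_)).neg_left
    · exact isBigO_mul_pow he₂ hδ
    · exact div 2 (isBigO_mul_pow hK₃e hδ2)
    · exact low 2 (by norm_num) (div 6 (isBigO_mul_pow hK₄e hδ3))
    · exact low 2 (by norm_num) hr
  -- each approximation of `δ` improves that of its powers, which gives the next approximation
  have h1' : (fun i => δ i ^ 2 - x i ^ 2) =O[l] fun i => ε i ^ 3 := by
    refine (isBigO_mul_pow h1 (hδ.add hx)).congr_left fun i => ?_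
    ring
  have h2 : (fun i => δ i - (x i + x i * y i)) =O[l] fun i => ε i ^ 3 := by
    have : (fun i => δ i - (x i + x i * y i)) =ᶠ[l] fun i => -((J i)⁻¹ * (e₂ i * (δ i - x i)
        + K₃ i * (δ i ^ 2 - x i ^ 2) / 2 + e₃ i * δ i ^ 2 / 2
        + (K₄ i + e₄ i) * δ i ^ 3 / 6 + r i)) := by
      filter_upwards [hroot] with i hJδ
      have hyi : y i = -((J i)⁻¹ * (K₃ i * x i / 2 + e₂ i)) := rfl
      have hxi : x i = -((J i)⁻¹ * c₁ i) := rfl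
      linear_combination hJδ - hxi - x i * hyi
    refine this.trans_isBigO (isBigO_mul_pow (b := 3) hJ ((((?_ : _ =O[l] _).add ?_).add
      ?_ |>.add ?_).add ?_)).neg_left
    · exact isBigO_mul_pow he₂ h1
    · exact div 2 (isBigO_mul_pow hK₃ h1')
    · exact div 2 (isBigO_mul_pow he₃ hδ2)
    · exact div 6 (isBigO_mul_pow hK₄e hδ3)
    · exact low 3 (by norm_num) hr
  have h2' : (fun i => δ i ^ 2 - x i ^ 2 - 2 * x i * (x i * y i)) =O[l] fun i => ε i ^ 4 := by
    refine ((isBigO_mul_pow hxy hxy).add (isBigO_mul_pow (b := 1) h2 ((hδ.add hx).add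
      (low 1 (by norm_num) hxy)))).congr_left fun i => ?_
    ring
  have h3' : (fun i => δ i ^ 3 - x i ^ 3) =O[l] fun i => ε i ^ 4 := by
    have hx2 : (fun i => x i ^ 2) =O[l] fun i => ε i ^ 2 := by
      simpa [pow_two] using isBigO_mul_pow hx hx
    refine (isBigO_mul_pow h1 ((hδ2.add (isBigO_mul_pow hδ hx)).add hx2)).congr_left fun i => ?_
    ring
  have : (fun i => δ i - (x i + x i * y i
      + rootCubic (J i) (K₃ i) (K₄ i) (c₁ i) (e₂ i) (e₃ i))) =ᶠ[l]
      fun i => -((J i)⁻¹ * (e₂ i * (δ i - (x i + x i * y i))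
        + K₃ i * (δ i ^ 2 - x i ^ 2 - 2 * x i * (x i * y i)) / 2
        + e₃ i * (δ i ^ 2 - x i ^ 2) / 2 + K₄ i * (δ i ^ 3 - x i ^ 3) / 6
        + e₄ i * δ i ^ 3 / 6 + r i)) := by
    filter_upwards [hroot] with i hJδ
    have hyi : y i = -((J i)⁻¹ * (K₃ i * x i / 2 + e₂ i)) := rfl
    have hxi : x i = -((J i)⁻¹ * c₁ i) := rfl
    have hci : rootCubic (J i) (K₃ i) (K₄ i) (c₁ i) (e₂ i) (e₃ i)
      = -((J i)⁻¹ * (e₂ i * (x i * y i) + e₃ i * x i ^ 2 / 2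
        + K₃ i * x i * (x i * y i) + K₄ i * x i ^ 3 / 6)) := rfl
    linear_combination hJδ - hxi - x i * hyi - hci
  refine this.trans_isBigO (isBigO_mul_pow (b := 4) hJ (((((?_ : _ =O[l] _).add ?_).add
    ?_ |>.add ?_).add ?_).add ?_)).neg_left
  · exact isBigO_mul_pow he₂ h2
  · exact div 2 (isBigO_mul_pow hK₃ h2')
  · exact div 2 (isBigO_mul_pow he₃ h1')
  · exact div 6 (isBigO_mul_pow hK₄ h3')
  · exact div 6 (isBigO_mul_pow he₄ hδ3)
  · exact hr

end Root

/-! ### Taylor expansion with a bounded derivative -/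

section Taylor

lemma abs_le_of_abs_deriv_le {s : Set ℝ} (hs : Convex ℝ s) {g g' : ℝ → ℝ} {K a x : ℝ} {k : ℕ}
    (hg : ∀ y ∈ s, HasDerivAt g (g' y) y) (ha : a ∈ s) (hx : x ∈ s) (h0 : g a = 0) (hK : 0 ≤ K)
    (hb : ∀ y ∈ s, |g' y| ≤ K * |y - a| ^ k) : |g x| ≤ K * |x - a| ^ (k + 1) := by
  have hseg : segment ℝ a x ⊆ s := hs.segment_subset ha hx
  have h := (convex_segment a x).norm_image_sub_le_of_norm_hasDerivWithin_le
    (f := g) (f' := g') (C := K * |x - a| ^ k) (x := a) (y := x)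
    (fun y hy => (hg y (hseg hy)).hasDerivWithinAt) (fun y hy => ?_)
    (left_mem_segment ℝ a x) (right_mem_segment ℝ a x)
  · simpa [h0, pow_succ, mul_assoc] using h
  · refine (hb y (hseg hy)).trans ?_
    rw [segment_eq_uIcc] at hy
    exact mul_le_mul_of_nonneg_left (pow_le_pow_left₀ (abs_nonneg _)
      (Set.abs_sub_left_of_mem_uIcc hy) k) hK

lemma abs_taylor_zero_le {s : Set ℝ} (hs : Convex ℝ s) {g₀ g₁ : ℝ → ℝ} {K a x : ℝ}
    (h₀ : ∀ y ∈ s, HasDerivAt g₀ (g₁ y) y) (ha : a ∈ s) (hx : x ∈ s)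
    (hb : ∀ y ∈ s, |g₁ y| ≤ K) : |g₀ x - g₀ a| ≤ K * |x - a| := by
  have hK : 0 ≤ K := (abs_nonneg _).trans (hb a ha)
  simpa using abs_le_of_abs_deriv_le (k := 0) (g := fun y => g₀ y - g₀ a) hs
    (fun y hy => (h₀ y hy).sub_const _) ha hx (by simp) hK (by simpa using hb)

lemma abs_taylor_one_le {s : Set ℝ} (hs : Convex ℝ s) {g₀ g₁ g₂ : ℝ → ℝ} {K a x : ℝ}
    (h₀ : ∀ y ∈ s, HasDerivAt g₀ (g₁ y) y) (h₁ : ∀ y ∈ s, HasDerivAt g₁ (g₂ y) y)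
    (ha : a ∈ s) (hx : x ∈ s) (hb : ∀ y ∈ s, |g₂ y| ≤ K) :
    |g₀ x - (g₀ a + g₁ a * (x - a))| ≤ K * |x - a| ^ 2 := by
  have hK : 0 ≤ K := (abs_nonneg _).trans (hb a ha)
  refine abs_le_of_abs_deriv_le (k := 1) (g := fun y => g₀ y - (g₀ a + g₁ a * (y - a)))
    (g' := fun y => g₁ y - g₁ a) hs (fun y hy => ?_) ha hx (by simp) hK
    fun y hy => by simpa using abs_taylor_zero_le hs h₁ ha hy hb
  have := (h₀ y hy).sub ((((hasDerivAt_id y).sub_const a).const_mul (g₁ a)).const_add (g₀ a))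
  refine this.congr_deriv ?_
  simp

lemma abs_taylor_two_le {s : Set ℝ} (hs : Convex ℝ s) {g₀ g₁ g₂ g₃ : ℝ → ℝ} {K a x : ℝ}
    (h₀ : ∀ y ∈ s, HasDerivAt g₀ (g₁ y) y) (h₁ : ∀ y ∈ s, HasDerivAt g₁ (g₂ y) y)
    (h₂ : ∀ y ∈ s, HasDerivAt g₂ (g₃ y) y)
    (ha : a ∈ s) (hx : x ∈ s) (hb : ∀ y ∈ s, |g₃ y| ≤ K) :
    |g₀ x - (g₀ a + g₁ a * (x - a) + g₂ a * (x - a) ^ 2 / 2)| ≤ K * |x - a| ^ 3 := by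
  have hK : 0 ≤ K := (abs_nonneg _).trans (hb a ha)
  refine abs_le_of_abs_deriv_le (k := 2)
    (g := fun y => g₀ y - (g₀ a + g₁ a * (y - a) + g₂ a * (y - a) ^ 2 / 2))
    (g' := fun y => g₁ y - (g₁ a + g₂ a * (y - a))) hs (fun y hy => ?_) ha hx (by simp) hK
    fun y hy => abs_taylor_one_le hs h₁ h₂ ha hy hb
  have hid := (hasDerivAt_id y).sub_const a
  have := (h₀ y hy).sub (((hid.const_mul (g₁ a)).const_add (g₀ a)).add
    (((hid.pow 2).const_mul (g₂ a)).div_const 2))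
  refine this.congr_deriv ?_
  simp
  ring

lemma abs_taylor_three_le {s : Set ℝ} (hs : Convex ℝ s) {g₀ g₁ g₂ g₃ g₄ : ℝ → ℝ} {K a x : ℝ}
    (h₀ : ∀ y ∈ s, HasDerivAt g₀ (g₁ y) y) (h₁ : ∀ y ∈ s, HasDerivAt g₁ (g₂ y) y)
    (h₂ : ∀ y ∈ s, HasDerivAt g₂ (g₃ y) y) (h₃ : ∀ y ∈ s, HasDerivAt g₃ (g₄ y) y)
    (ha : a ∈ s) (hx : x ∈ s) (hb : ∀ y ∈ s, |g₄ y| ≤ K) :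
    |g₀ x - (g₀ a + g₁ a * (x - a) + g₂ a * (x - a) ^ 2 / 2 + g₃ a * (x - a) ^ 3 / 6)|
      ≤ K * |x - a| ^ 4 := by
  have hK : 0 ≤ K := (abs_nonneg _).trans (hb a ha)
  refine abs_le_of_abs_deriv_le (k := 3)
    (g := fun y => g₀ y - (g₀ a + g₁ a * (y - a) + g₂ a * (y - a) ^ 2 / 2
      + g₃ a * (y - a) ^ 3 / 6))
    (g' := fun y => g₁ y - (g₁ a + g₂ a * (y - a) + g₃ a * (y - a) ^ 2 / 2)) hs
    (fun y hy => ?_) ha hx (by simp) hK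
    fun y hy => abs_taylor_two_le hs h₁ h₂ h₃ ha hy hb
  have hid := (hasDerivAt_id y).sub_const a
  have := (h₀ y hy).sub ((((hid.const_mul (g₁ a)).const_add (g₀ a)).add
    (((hid.pow 2).const_mul (g₂ a)).div_const 2)).add
    (((hid.pow 3).const_mul (g₃ a)).div_const 6))
  refine this.congr_deriv ?_
  simp
  ring

end Taylor

/-! ### Sample averages -/

section Avg

variable {𝓩 : Type*} {n : ℕ} (z : Fin n → 𝓩) (g h : 𝓩 → ℝ)

lemma avg_add : avg z (fun y => g y + h y) = avg z g + avg z h := by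
  simp [avg, Finset.sum_add_distrib, mul_add]

lemma avg_sub : avg z (fun y => g y - h y) = avg z g - avg z h := by
  simp [avg, Finset.sum_sub_distrib, mul_sub]

lemma avg_const_mul (c : ℝ) : avg z (fun y => c * g y) = c * avg z g := by
  simp only [avg, ← Finset.mul_sum]; ring

lemma avg_const (hn : n ≠ 0) (c : ℝ) : avg z (fun _ => c) = c := by
  simp [avg, hn]

lemma avg_mono {g h : 𝓩 → ℝ} (hgh : ∀ y, g y ≤ h y) : avg z g ≤ avg z h :=
  mul_le_mul_of_nonneg_left (Finset.sum_le_sum fun _ _ => hgh _) (by positivity)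

lemma abs_avg_le {g h : 𝓩 → ℝ} (hgh : ∀ y, |g y| ≤ h y) : |avg z g| ≤ avg z h := by
  rw [avg, abs_mul, abs_of_nonneg (by positivity : (0 : ℝ) ≤ (n : ℝ)⁻¹)]
  exact mul_le_mul_of_nonneg_left ((Finset.abs_sum_le_sum_abs _ _).trans
    (Finset.sum_le_sum fun _ _ => hgh _)) (by positivity)

lemma hasDerivAt_avg {g g' : 𝓩 → ℝ → ℝ} {θ : ℝ}
    (h : ∀ y, HasDerivAt (g y) (g' y θ) θ) :
    HasDerivAt (fun t => avg z fun y => g y t) (avg z fun y => g' y θ) θ := by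
  simp only [avg]
  exact (HasDerivAt.fun_sum fun i _ => h (z i)).const_mul _

end Avg

/-! ### Samples for which the likelihood is well behaved -/

section Local

variable {𝓩 : Type*} {f : 𝓩 → ℝ → ℝ} {Θ : Set ℝ} {θ₀ : ℝ} {M : 𝓩 → ℝ} {r κ C : ℝ} {K : ℕ}
  {h : Fin K → 𝓩 → ℝ}

/-- The facts on the log-likelihood used by the deterministic part of the argument: smoothness and
envelope on the ball of radius `r` about `θ₀`, which is small enough for the average second
derivative to keep its sign there (`small`), and finitely many functions `h k` that bound the
log-likelihood ratio against `θ₀` for every parameter outside that ball. -/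
structure LocalModel (f : 𝓩 → ℝ → ℝ) (Θ : Set ℝ) (θ₀ : ℝ) (M : 𝓩 → ℝ) (r κ C : ℝ)
    (h : Fin K → 𝓩 → ℝ) : Prop where
  r_pos : 0 < r
  κ_pos : 0 < κ
  C_pos : 0 < C
  subset : Metric.ball θ₀ r ⊆ Θ
  deriv : ∀ z, ∀ m ≤ 6, ∀ θ ∈ Metric.ball θ₀ r,
    HasDerivAt (logLikDeriv f Θ m z) (logLikDeriv f Θ (m + 1) z θ) θ
  bound : ∀ m ≤ 7, ∀ θ ∈ Θ, ∀ z, |logLikDeriv f Θ m z θ| ≤ M z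
  diam : ∀ θ ∈ Θ, ∀ θ' ∈ Θ, |θ - θ'| ≤ C
  small : 8 * (C * r) ≤ κ
  far : ∀ θ ∈ Θ, r ≤ |θ - θ₀| → ∃ k, ∀ z, Real.log (f z θ) - Real.log (f z θ₀) ≤ h k z
  h_bound : ∀ k z, |h k z| ≤ 2 * M z

/-- On such a sample every maximum likelihood estimate is a critical point close to `θ₀`, and the
log-likelihood is uniformly strictly concave near `θ₀`. -/
structure IsLocalSample (f : 𝓩 → ℝ → ℝ) (Θ : Set ℝ) (θ₀ : ℝ) (M : 𝓩 → ℝ) (κ C : ℝ)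
    (h : Fin K → 𝓩 → ℝ) {n : ℕ} (z : Fin n → 𝓩) : Prop where
  envelope : avg z M ≤ C
  far : ∀ k, avg z (h k) < 0
  curvature : avg z (fun y => logLikDeriv f Θ 2 y θ₀) ≤ -κ

namespace IsLocalSample

variable {n : ℕ} {z : Fin n → 𝓩} {θhat : Estimator 𝓩}

lemma ne_zero (hz : IsLocalSample f Θ θ₀ M κ C h z) (hL : LocalModel f Θ θ₀ M r κ C h) :
    n ≠ 0 := by
  rintro rfl
  have h1 := hz.curvature
  have h2 := hL.κ_pos
  simp only [avg, CharP.cast_eq_zero, inv_zero, zero_mul] at h1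
  linarith

lemma mem_ball (hz : IsLocalSample f Θ θ₀ M κ C h z) (hL : LocalModel f Θ θ₀ M r κ C h)
    (hθ : IsMLE f Θ θhat) : θhat n z ∈ Metric.ball θ₀ r := by
  rw [Metric.mem_ball, Real.dist_eq]
  by_contra hfar
  obtain ⟨k, hk⟩ := hL.far _ (hθ n z).1 (not_lt.1 hfar)
  have h1 := (hθ n z).2 (hL.subset (Metric.mem_ball_self hL.r_pos))
  have h2 := avg_mono z hk
  rw [avg_sub] at h2
  have h3 := hz.far k
  simp only [Set.mem_ofPred_eq] at h1
  linarith

lemma score_eq_zero (hz : IsLocalSample f Θ θ₀ M κ C h z) (hL : LocalModel f Θ θ₀ M r κ C h)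
    (hθ : IsMLE f Θ θhat) : avg z (fun y => logLikDeriv f Θ 1 y (θhat n z)) = 0 := by
  have hb := hz.mem_ball hL hθ
  have hmax : IsLocalMax (fun t => avg z fun y => logLikDeriv f Θ 0 y t) (θhat n z) := by
    refine ((hθ n z).2.isLocalMax ?_).congr ?_
    · exact Filter.mem_of_superset (Metric.isOpen_ball.mem_nhds hb) hL.subset
    · exact Eventually.of_forall fun t => by simp [logLikDeriv]
  exact hmax.hasDerivAt_eq_zero
    (hasDerivAt_avg z (g' := logLikDeriv f Θ 1) fun y => hL.deriv y 0 (by norm_num) _ hb)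

lemma abs_avg_logLikDeriv_le (hz : IsLocalSample f Θ θ₀ M κ C h z)
    (hL : LocalModel f Θ θ₀ M r κ C h) {m : ℕ} (hm : m ≤ 7) {θ : ℝ} (hθ : θ ∈ Θ) :
    |avg z fun y => logLikDeriv f Θ m y θ| ≤ C :=
  (abs_avg_le z (hL.bound m hm θ hθ)).trans hz.envelope

lemma curvature_le (hz : IsLocalSample f Θ θ₀ M κ C h z) (hL : LocalModel f Θ θ₀ M r κ C h)
    {θ : ℝ} (hθ : θ ∈ Metric.ball θ₀ r) :
    avg z (fun y => logLikDeriv f Θ 2 y θ) ≤ -(κ / 2) := by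
  have h1 := abs_taylor_zero_le (convex_ball θ₀ r) (K := C)
    (g₀ := fun t => avg z fun y => logLikDeriv f Θ 2 y t)
    (g₁ := fun t => avg z fun y => logLikDeriv f Θ 3 y t)
    (fun t ht => hasDerivAt_avg z fun y => hL.deriv y 2 (by norm_num) t ht)
    (Metric.mem_ball_self hL.r_pos) hθ
    (fun t ht => hz.abs_avg_logLikDeriv_le hL (by norm_num) (hL.subset ht))
  have h2 : C * |θ - θ₀| ≤ C * r := by
    rw [Metric.mem_ball, Real.dist_eq] at hθ
    exact mul_le_mul_of_nonneg_left hθ.le hL.C_pos.le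
  have h3 := hz.curvature
  have h4 := hL.small
  have h5 := hL.κ_pos
  have h6 := (abs_le.1 h1).2
  linarith

/-- Third-order Taylor expansion of the score equation at a point near `θ₀`. -/
lemma score_taylor (hz : IsLocalSample f Θ θ₀ M κ C h z) (hL : LocalModel f Θ θ₀ M r κ C h)
    (hθ : IsMLE f Θ θhat) {a : ℝ} (ha : a ∈ Metric.ball θ₀ r) :
    |0 - (avg z (fun y => logLikDeriv f Θ 1 y a)
      + avg z (fun y => logLikDeriv f Θ 2 y a) * (θhat n z - a)
      + avg z (fun y => logLikDeriv f Θ 3 y a) * (θhat n z - a) ^ 2 / 2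
      + avg z (fun y => logLikDeriv f Θ 4 y a) * (θhat n z - a) ^ 3 / 6)|
      ≤ C * |θhat n z - a| ^ 4 := by
  rw [← hz.score_eq_zero hL hθ]
  exact abs_taylor_three_le (convex_ball θ₀ r) (K := C)
    (g₀ := fun t => avg z fun y => logLikDeriv f Θ 1 y t)
    (g₁ := fun t => avg z fun y => logLikDeriv f Θ 2 y t)
    (g₂ := fun t => avg z fun y => logLikDeriv f Θ 3 y t)
    (g₃ := fun t => avg z fun y => logLikDeriv f Θ 4 y t)
    (g₄ := fun t => avg z fun y => logLikDeriv f Θ 5 y t)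
    (fun t ht => hasDerivAt_avg z fun y => hL.deriv y 1 (by norm_num) t ht)
    (fun t ht => hasDerivAt_avg z fun y => hL.deriv y 2 (by norm_num) t ht)
    (fun t ht => hasDerivAt_avg z fun y => hL.deriv y 3 (by norm_num) t ht)
    (fun t ht => hasDerivAt_avg z fun y => hL.deriv y 4 (by norm_num) t ht)
    ha (hz.mem_ball hL hθ)
    (fun t ht => hz.abs_avg_logLikDeriv_le hL (by norm_num) (hL.subset ht))

/-- The distance to the estimate is controlled by the average score. -/
lemma abs_sub_le (hz : IsLocalSample f Θ θ₀ M κ C h z) (hL : LocalModel f Θ θ₀ M r κ C h)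
    (hθ : IsMLE f Θ θhat) {a : ℝ} (ha : a ∈ Metric.ball θ₀ r) :
    |θhat n z - a| ≤ 4 / κ * |avg z fun y => logLikDeriv f Θ 1 y a| := by
  have hb := hz.mem_ball hL hθ
  have h1 := abs_taylor_one_le (convex_ball θ₀ r) (K := C)
    (g₀ := fun t => avg z fun y => logLikDeriv f Θ 1 y t)
    (g₁ := fun t => avg z fun y => logLikDeriv f Θ 2 y t)
    (g₂ := fun t => avg z fun y => logLikDeriv f Θ 3 y t)
    (fun t ht => hasDerivAt_avg z fun y => hL.deriv y 1 (by norm_num) t ht)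
    (fun t ht => hasDerivAt_avg z fun y => hL.deriv y 2 (by norm_num) t ht)
    ha hb (fun t ht => hz.abs_avg_logLikDeriv_le hL (by norm_num) (hL.subset ht))
  rw [hz.score_eq_zero hL hθ] at h1
  have h2 := hz.curvature_le hL ha
  have hκ := hL.κ_pos
  set S := avg z fun y => logLikDeriv f Θ 1 y a
  set T := avg z fun y => logLikDeriv f Θ 2 y a
  set d := θhat n z - a with hd
  have h3 : |d| ≤ 2 * r := by
    have e : d = (θhat n z - θ₀) - (a - θ₀) := by rw [hd]; ring
    rw [Metric.mem_ball, Real.dist_eq] at ha hb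
    rw [e]
    exact (abs_sub _ _).trans (by linarith)
  have h4 : C * |d| ^ 2 ≤ κ / 4 * |d| := by
    have : C * |d| ≤ κ / 4 := by
      have := mul_le_mul_of_nonneg_left h3 hL.C_pos.le
      have := hL.small
      linarith
    calc C * |d| ^ 2 = C * |d| * |d| := by ring
      _ ≤ _ := mul_le_mul_of_nonneg_right this (abs_nonneg _)
  have h5 : |T * d| ≤ |S| + κ / 4 * |d| := by
    have e : T * d = -(0 - (S + T * d)) - S := by ring
    rw [e]
    refine (abs_sub _ _).trans ?_
    rw [abs_neg]
    linarith
  have h6 : κ / 2 * |d| ≤ |T * d| := by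
    rw [abs_mul]
    refine mul_le_mul_of_nonneg_right ?_ (abs_nonneg _)
    rw [abs_of_neg (by linarith)]
    linarith
  rw [div_mul_eq_mul_div, le_div_iff₀ hκ]
  linarith

end IsLocalSample

/-- Difference between the average over the sample `z'` and the average over the sample `z` of the
`m`-th derivative of the log-likelihood, at the maximum likelihood estimate for `z`. -/
def derivDiff (f : 𝓩 → ℝ → ℝ) (Θ : Set ℝ) (θhat : Estimator 𝓩) {n n' : ℕ} (z : Fin n → 𝓩)
    (z' : Fin n' → 𝓩) (m : ℕ) : ℝ :=
  avg z' (fun y => logLikDeriv f Θ m y (θhat n z)) - avg z (fun y => logLikDeriv f Θ m y (θhat n z))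

/-- Total size of the first four differences `derivDiff`. -/
def derivDiffSize (f : 𝓩 → ℝ → ℝ) (Θ : Set ℝ) (θhat : Estimator 𝓩) {n n' : ℕ} (z : Fin n → 𝓩)
    (z' : Fin n' → 𝓩) : ℝ :=
  ∑ m : Fin 4, |derivDiff f Θ θhat z z' (m + 1)|

/-- The average of the `m`-th derivative of the log-likelihood at the estimate. -/
def avgDeriv (f : 𝓩 → ℝ → ℝ) (Θ : Set ℝ) (θhat : Estimator 𝓩) {n : ℕ} (z : Fin n → 𝓩)
    (m : ℕ) : ℝ :=
  avg z (fun y => logLikDeriv f Θ m y (θhat n z))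

lemma abs_derivDiff_le {θhat : Estimator 𝓩} {n n' : ℕ} {z : Fin n → 𝓩} {z' : Fin n' → 𝓩} {m : ℕ}
    (hm : 1 ≤ m) (hm' : m ≤ 4) :
    |derivDiff f Θ θhat z z' m| ≤ derivDiffSize f Θ θhat z z' := by
  have := Finset.single_le_sum (f := fun m : Fin 4 => |derivDiff f Θ θhat z z' (m + 1)|)
    (fun _ _ => abs_nonneg _) (Finset.mem_univ (⟨m - 1, by omega⟩ : Fin 4))
  simpa [derivDiffSize, Nat.sub_add_cancel hm] using this

lemma derivDiffSize_nonneg {θhat : Estimator 𝓩} {n n' : ℕ} {z : Fin n → 𝓩} {z' : Fin n' → 𝓩} :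
    0 ≤ derivDiffSize f Θ θhat z z' :=
  Finset.sum_nonneg fun _ _ => abs_nonneg _

variable {θhat : Estimator 𝓩}

/-- Pairs of samples, of possibly different sizes. -/
abbrev SamplePair (𝓩 : Type*) := (Σ n : ℕ, (Fin n → 𝓩)) × (Σ n : ℕ, (Fin n → 𝓩))

section

variable (hL : LocalModel f Θ θ₀ M r κ C h) (hθ : IsMLE f Θ θhat) {s : Set (SamplePair 𝓩)}
  (hs : ∀ p ∈ s, IsLocalSample f Θ θ₀ M κ C h p.1.2)
include hL hθ hs

lemma avgDeriv_isBigO {m : ℕ} (hm : m ≤ 7) :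
    (fun p : SamplePair 𝓩 => avgDeriv f Θ θhat p.1.2 m) =O[𝓟 s]
      fun p => derivDiffSize f Θ θhat p.1.2 p.2.2 ^ 0 := by
  refine isBigO_principal.2 ⟨C, fun p hp => ?_⟩
  simpa [avgDeriv] using (hs p hp).abs_avg_logLikDeriv_le hL hm (hθ p.1.1 p.1.2).1

lemma inv_avgDeriv_isBigO :
    (fun p : SamplePair 𝓩 => (avgDeriv f Θ θhat p.1.2 2)⁻¹) =O[𝓟 s]
      fun p => derivDiffSize f Θ θhat p.1.2 p.2.2 ^ 0 := by
  refine isBigO_principal.2 ⟨2 / κ, fun p hp => ?_⟩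
  have h1 := (hs p hp).curvature_le hL ((hs p hp).mem_ball hL hθ)
  have hκ := hL.κ_pos
  rw [Real.norm_eq_abs, abs_inv, pow_zero, norm_one, mul_one, ← inv_div]
  refine inv_anti₀ (by positivity) ?_
  rw [avgDeriv, abs_of_neg (by linarith)]
  linarith

omit hL hθ hs in
lemma derivDiff_isBigO {m : ℕ} (hm : 1 ≤ m) (hm' : m ≤ 4) :
    (fun p : SamplePair 𝓩 => derivDiff f Θ θhat p.1.2 p.2.2 m) =O[𝓟 s]
      fun p => derivDiffSize f Θ θhat p.1.2 p.2.2 ^ 1 := by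
  refine isBigO_principal.2 ⟨1, fun p _ => ?_⟩
  rw [pow_one, one_mul, Real.norm_eq_abs, Real.norm_of_nonneg derivDiffSize_nonneg]
  exact abs_derivDiff_le hm hm'

end

/-- Expansion of the estimate for a sample `z'` about the estimate for another sample `z`, with a
bound that is uniform in the samples and their sizes. -/
lemma exists_estimate_expansion (hL : LocalModel f Θ θ₀ M r κ C h) (hθ : IsMLE f Θ θhat) :
    ∃ B, 0 ≤ B ∧ ∀ (n n' : ℕ) (z : Fin n → 𝓩) (z' : Fin n' → 𝓩),
      IsLocalSample f Θ θ₀ M κ C h z → IsLocalSample f Θ θ₀ M κ C h z' →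
      |θhat n' z' - θhat n z -
        (rootLin (avgDeriv f Θ θhat z 2) (derivDiff f Θ θhat z z' 1)
        + rootLin (avgDeriv f Θ θhat z 2) (derivDiff f Θ θhat z z' 1)
          * rootSlope (avgDeriv f Θ θhat z 2) (avgDeriv f Θ θhat z 3)
            (derivDiff f Θ θhat z z' 1) (derivDiff f Θ θhat z z' 2)
        + rootCubic (avgDeriv f Θ θhat z 2) (avgDeriv f Θ θhat z 3) (avgDeriv f Θ θhat z 4)
            (derivDiff f Θ θhat z z' 1) (derivDiff f Θ θhat z z' 2) (derivDiff f Θ θhat z z' 3))|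
        ≤ B * derivDiffSize f Θ θhat z z' ^ 4 := by
  -- `O` along the principal filter of a set of pairs is a bound that is uniform on that set
  let s : Set (SamplePair 𝓩) := {p | IsLocalSample f Θ θ₀ M κ C h p.1.2 ∧
    IsLocalSample f Θ θ₀ M κ C h p.2.2}
  have hs : ∀ p ∈ s, IsLocalSample f Θ θ₀ M κ C h p.1.2 := fun p hp => hp.1
  have hc : ∀ p ∈ s, avg p.2.2 (fun y => logLikDeriv f Θ 1 y (θhat p.1.1 p.1.2))
      = derivDiff f Θ θhat p.1.2 p.2.2 1 := fun p hp => by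
    rw [derivDiff, hp.1.score_eq_zero hL hθ, sub_zero]
  have hδ : (fun p : SamplePair 𝓩 => θhat p.2.1 p.2.2 - θhat p.1.1 p.1.2) =O[𝓟 s]
      fun p => derivDiffSize f Θ θhat p.1.2 p.2.2 ^ 1 := by
    refine isBigO_principal.2 ⟨4 / κ, fun p hp => ?_⟩
    have := hp.2.abs_sub_le hL hθ (hp.1.mem_ball hL hθ)
    rw [hc p hp] at this
    rw [pow_one, Real.norm_eq_abs, Real.norm_of_nonneg derivDiffSize_nonneg]
    refine this.trans (mul_le_mul_of_nonneg_left (abs_derivDiff_le le_rfl (by norm_num)) ?_)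
    exact (div_pos (by norm_num) hL.κ_pos).le
  have hroot := root_expansion (l := 𝓟 s)
    (ε := fun p : SamplePair 𝓩 => derivDiffSize f Θ θhat p.1.2 p.2.2)
    (J := fun p => avgDeriv f Θ θhat p.1.2 2) (K₃ := fun p => avgDeriv f Θ θhat p.1.2 3)
    (K₄ := fun p => avgDeriv f Θ θhat p.1.2 4)
    (c₁ := fun p => derivDiff f Θ θhat p.1.2 p.2.2 1)
    (e₂ := fun p => derivDiff f Θ θhat p.1.2 p.2.2 2)
    (e₃ := fun p => derivDiff f Θ θhat p.1.2 p.2.2 3)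
    (e₄ := fun p => derivDiff f Θ θhat p.1.2 p.2.2 4)
    (δ := fun p => θhat p.2.1 p.2.2 - θhat p.1.1 p.1.2)
    (r := fun p => 0 - (avg p.2.2 (fun y => logLikDeriv f Θ 1 y (θhat p.1.1 p.1.2))
      + avg p.2.2 (fun y => logLikDeriv f Θ 2 y (θhat p.1.1 p.1.2))
        * (θhat p.2.1 p.2.2 - θhat p.1.1 p.1.2)
      + avg p.2.2 (fun y => logLikDeriv f Θ 3 y (θhat p.1.1 p.1.2))
        * (θhat p.2.1 p.2.2 - θhat p.1.1 p.1.2) ^ 2 / 2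
      + avg p.2.2 (fun y => logLikDeriv f Θ 4 y (θhat p.1.1 p.1.2))
        * (θhat p.2.1 p.2.2 - θhat p.1.1 p.1.2) ^ 3 / 6))
    ?_ ?_ (inv_avgDeriv_isBigO hL hθ hs) (avgDeriv_isBigO hL hθ hs (by norm_num))
    (avgDeriv_isBigO hL hθ hs (by norm_num)) (derivDiff_isBigO le_rfl (by norm_num))
    (derivDiff_isBigO (by norm_num) (by norm_num)) (derivDiff_isBigO (by norm_num) (by norm_num))
    (derivDiff_isBigO (by norm_num) (by norm_num)) hδ ?_ ?_
  · obtain ⟨B, hB⟩ := isBigO_principal.1 hroot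
    refine ⟨max B 0, le_max_right _ _, fun n n' z z' hz hz' => ?_⟩
    have := hB (⟨n, z⟩, ⟨n', z'⟩) ⟨hz, hz'⟩
    rw [Real.norm_eq_abs, Real.norm_of_nonneg (pow_nonneg derivDiffSize_nonneg 4)] at this
    exact this.trans (mul_le_mul_of_nonneg_right (le_max_left _ _)
      (pow_nonneg derivDiffSize_nonneg 4))
  · refine isBigO_principal.2 ⟨8 * C, fun p hp => ?_⟩
    rw [norm_one, mul_one, Real.norm_of_nonneg derivDiffSize_nonneg, derivDiffSize]
    calc _ ≤ ∑ m : Fin 4, 2 * C := Finset.sum_le_sum fun m _ => by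
          have h1 := hp.1.abs_avg_logLikDeriv_le hL (m := m + 1) (by omega)
            (hθ p.1.1 p.1.2).1
          have h2 := hp.2.abs_avg_logLikDeriv_le hL (m := m + 1) (by omega)
            (hθ p.1.1 p.1.2).1
          exact (abs_sub _ _).trans (by linarith)
      _ = _ := by simp; ring
  · refine eventually_principal.2 fun p hp => ne_of_lt ?_
    have h1 := hp.1.curvature_le hL (hp.1.mem_ball hL hθ)
    have hκ := hL.κ_pos
    rw [avgDeriv]
    linarith
  · refine IsBigO.trans (isBigO_principal.2 ⟨C, fun p hp => ?_⟩)
      ((hδ.pow 4).congr_right fun p => by rw [pow_one])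
    simpa using hp.2.score_taylor hL hθ (hp.1.mem_ball hL hθ)
  · refine eventually_principal.2 fun p hp => ?_
    rw [hc p hp]
    simp only [derivDiff, avgDeriv]
    ring

/-- Size of the terms of the expansion. The second sample is arbitrary. -/
lemma exists_root_terms_le (hL : LocalModel f Θ θ₀ M r κ C h) (hθ : IsMLE f Θ θhat) :
    ∃ B, 0 ≤ B ∧ ∀ (n n' : ℕ) (z : Fin n → 𝓩) (z' : Fin n' → 𝓩),
      IsLocalSample f Θ θ₀ M κ C h z →
      |rootLin (avgDeriv f Θ θhat z 2) (derivDiff f Θ θhat z z' 1)|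
        ≤ B * derivDiffSize f Θ θhat z z' ∧
      |rootSlope (avgDeriv f Θ θhat z 2) (avgDeriv f Θ θhat z 3)
        (derivDiff f Θ θhat z z' 1) (derivDiff f Θ θhat z z' 2)|
        ≤ B * derivDiffSize f Θ θhat z z' ∧
      |rootCubic (avgDeriv f Θ θhat z 2) (avgDeriv f Θ θhat z 3) (avgDeriv f Θ θhat z 4)
        (derivDiff f Θ θhat z z' 1) (derivDiff f Θ θhat z z' 2) (derivDiff f Θ θhat z z' 3)|
        ≤ B * derivDiffSize f Θ θhat z z' ^ 3 := by
  let s : Set (SamplePair 𝓩) := {p | IsLocalSample f Θ θ₀ M κ C h p.1.2}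
  have hs : ∀ p ∈ s, IsLocalSample f Θ θ₀ M κ C h p.1.2 := fun p hp => hp
  have hJ := inv_avgDeriv_isBigO hL hθ hs
  have h3 := avgDeriv_isBigO hL hθ hs (m := 3) (by norm_num)
  have h4 := avgDeriv_isBigO hL hθ hs (m := 4) (by norm_num)
  have d1 := derivDiff_isBigO (f := f) (Θ := Θ) (θhat := θhat) (s := s) (m := 1) le_rfl
    (by norm_num)
  have d2 := derivDiff_isBigO (f := f) (Θ := Θ) (θhat := θhat) (s := s) (m := 2) (by norm_num)
    (by norm_num)
  have d3 := derivDiff_isBigO (f := f) (Θ := Θ) (θhat := θhat) (s := s) (m := 3) (by norm_num)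
    (by norm_num)
  obtain ⟨B₁, hB₁⟩ := isBigO_principal.1 (rootLin_isBigO hJ d1)
  obtain ⟨B₂, hB₂⟩ := isBigO_principal.1 (rootSlope_isBigO hJ h3 d1 d2)
  obtain ⟨B₃, hB₃⟩ := isBigO_principal.1 (rootCubic_isBigO hJ h3 h4 d1 d2 d3)
  refine ⟨max (max B₁ B₂) (max B₃ 0), by simp, fun n n' z z' hz => ?_⟩
  have e0 : 0 ≤ derivDiffSize f Θ θhat z z' := derivDiffSize_nonneg
  have b1 := hB₁ (⟨n, z⟩, ⟨n', z'⟩) hz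
  have b2 := hB₂ (⟨n, z⟩, ⟨n', z'⟩) hz
  have b3 := hB₃ (⟨n, z⟩, ⟨n', z'⟩) hz
  simp only [pow_one, Real.norm_eq_abs, abs_of_nonneg e0, abs_of_nonneg (pow_nonneg e0 3)]
    at b1 b2 b3
  exact ⟨b1.trans (by gcongr; simp), b2.trans (by gcongr; simp), b3.trans (by gcongr; simp)⟩

/-- A local sample that remains so under small perturbations, and has a bounded average of `M⁴`. -/
structure IsGoodSample (f : 𝓩 → ℝ → ℝ) (Θ : Set ℝ) (θ₀ : ℝ) (M : 𝓩 → ℝ) (κ C η B : ℝ)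
    (h : Fin K → 𝓩 → ℝ) {n : ℕ} (z : Fin n → 𝓩) : Prop where
  envelope : avg z M ≤ C - η
  far : ∀ k, avg z (h k) ≤ -η
  curvature : avg z (fun y => logLikDeriv f Θ 2 y θ₀) ≤ -κ - η
  fourth : avg z (fun y => M y ^ 4) ≤ B

lemma IsGoodSample.isLocalSample {η B : ℝ} (hη : 0 < η) {n : ℕ} {z : Fin n → 𝓩}
    (hz : IsGoodSample f Θ θ₀ M κ C η B h z) : IsLocalSample f Θ θ₀ M κ C h z :=
  ⟨by linarith [hz.envelope], fun k => by linarith [hz.far k], by linarith [hz.curvature]⟩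

/-- In the applications `z` is the data, and `z'` a leave-one-out sample or a resample. -/
lemma IsGoodSample.isLocalSample_of_close {η B : ℝ} {n n' : ℕ} {z : Fin n → 𝓩}
    (hz : IsGoodSample f Θ θ₀ M κ C η B h z) {z' : Fin n' → 𝓩}
    (h1 : |avg z' M - avg z M| < η) (h2 : ∀ k, |avg z' (h k) - avg z (h k)| < η)
    (h3 : |avg z' (fun y => logLikDeriv f Θ 2 y θ₀)
      - avg z (fun y => logLikDeriv f Θ 2 y θ₀)| < η) :
    IsLocalSample f Θ θ₀ M κ C h z' :=
  ⟨by linarith [hz.envelope, (abs_lt.1 h1).2], fun k => by linarith [hz.far k, (abs_lt.1 (h2 k)).2],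
    by linarith [hz.curvature, (abs_lt.1 h3).2]⟩

end Local

/-! ### The jackknife -/

section Jackknife

variable {𝓩 : Type*} {f : 𝓩 → ℝ → ℝ} {Θ : Set ℝ} {θ₀ : ℝ} {M : 𝓩 → ℝ} {r κ C η B : ℝ} {K : ℕ}
  {h : Fin K → 𝓩 → ℝ} {θhat : Estimator 𝓩}

lemma LocalModel.center_mem (hL : LocalModel f Θ θ₀ M r κ C h) : θ₀ ∈ Θ :=
  hL.subset (Metric.mem_ball_self hL.r_pos)

lemma LocalModel.envelope_nonneg (hL : LocalModel f Θ θ₀ M r κ C h) (y : 𝓩) : 0 ≤ M y :=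
  (abs_nonneg _).trans (hL.bound 0 (by norm_num) θ₀ hL.center_mem y)

lemma avg_removeNth_sub {m : ℕ} (hm : m ≠ 0) (z : Fin (m + 1) → 𝓩) (i : Fin (m + 1))
    (g : 𝓩 → ℝ) :
    avg (i.removeNth z) g - avg z g = (avg z g - g (z i)) / m := by
  have hm' : (m : ℝ) ≠ 0 := by exact_mod_cast hm
  have hm1 : (m : ℝ) + 1 ≠ 0 := by positivity
  simp only [avg, Fin.removeNth, Fin.sum_univ_succAbove (fun j => g (z j)) i]
  push_cast
  field_simp
  ring

/-- The bias estimate of `analyticNoInfo`, before division by the sample size. -/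
def noInfoBias (f : 𝓩 → ℝ → ℝ) (Θ : Set ℝ) (θhat : Estimator 𝓩) {n : ℕ} (z : Fin n → 𝓩) : ℝ :=
  -(avgDeriv f Θ θhat z 3 * avg z (fun y => score f Θ y (θhat n z) ^ 2))
      / (2 * avgDeriv f Θ θhat z 2 ^ 3)
    + avg z (fun y => score f Θ y (θhat n z) * score' f Θ y (θhat n z))
      / avgDeriv f Θ θhat z 2 ^ 2

lemma analyticNoInfo_eq {n : ℕ} (z : Fin n → 𝓩) :
    analyticNoInfo f Θ θhat n z = θhat n z - (n : ℝ)⁻¹ * noInfoBias f Θ θhat z := rfl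

lemma IsGoodSample.avg_sq_le {n : ℕ} {z : Fin n → 𝓩} (hn : n ≠ 0)
    (hz : IsGoodSample f Θ θ₀ M κ C η B h z) : avg z (fun y => M y ^ 2) ≤ 1 + B := by
  calc avg z (fun y => M y ^ 2) ≤ avg z (fun y => 1 + M y ^ 4) :=
        avg_mono z fun y => by nlinarith [sq_nonneg (M y ^ 2 - 1), sq_nonneg (M y ^ 2)]
    _ = 1 + avg z (fun y => M y ^ 4) := by rw [avg_add, avg_const z hn]
    _ ≤ _ := by linarith [hz.fourth]

lemma IsGoodSample.exists_noInfoBias_le (hL : LocalModel f Θ θ₀ M r κ C h)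
    (hθ : IsMLE f Θ θhat) (hη : 0 < η) (hB : 0 ≤ B) :
    ∃ A, 0 ≤ A ∧ ∀ (n : ℕ) (z : Fin n → 𝓩), IsGoodSample f Θ θ₀ M κ C η B h z →
      |noInfoBias f Θ θhat z| ≤ A := by
  have hκ := hL.κ_pos
  have hC := hL.C_pos
  refine ⟨C * (1 + B) * (2 / κ) ^ 3 + (1 + B) * (2 / κ) ^ 2, by positivity, fun n z hz => ?_⟩
  have hz' := hz.isLocalSample hη
  have hn := hz'.ne_zero hL
  have hsq := hz.avg_sq_le hn
  have hb := fun m (hm : m ≤ 7) y => hL.bound m hm _ (hθ n z).1 y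
  have hS : |avg z (fun y => score f Θ y (θhat n z) ^ 2)| ≤ 1 + B :=
    (abs_avg_le z fun y => by
      rw [abs_pow]; exact pow_le_pow_left₀ (abs_nonneg _) (hb 1 (by norm_num) y) 2).trans hsq
  have hR : |avg z (fun y => score f Θ y (θhat n z) * score' f Θ y (θhat n z))| ≤ 1 + B :=
    (abs_avg_le z fun y => by
      rw [abs_mul, pow_two]
      exact mul_le_mul (hb 1 (by norm_num) y) (hb 2 (by norm_num) y) (abs_nonneg _)
        (hL.envelope_nonneg y)).trans hsq
  have hQ : |avgDeriv f Θ θhat z 3| ≤ C :=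
    hz'.abs_avg_logLikDeriv_le hL (by norm_num) (hθ n z).1
  have hJ : |(avgDeriv f Θ θhat z 2)⁻¹| ≤ 2 / κ := by
    have h1 := hz'.curvature_le hL (hz'.mem_ball hL hθ)
    rw [abs_inv, ← inv_div]
    refine inv_anti₀ (by positivity) ?_
    rw [avgDeriv, abs_of_neg (by linarith)]
    linarith
  rw [noInfoBias]
  set S := avg z (fun y => score f Θ y (θhat n z) ^ 2)
  set R := avg z (fun y => score f Θ y (θhat n z) * score' f Θ y (θhat n z))
  set Q := avgDeriv f Θ θhat z 3
  set J := avgDeriv f Θ θhat z 2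
  have e : -(Q * S) / (2 * J ^ 3) + R / J ^ 2 = -(Q * S * J⁻¹ ^ 3 / 2) + R * J⁻¹ ^ 2 := by
    rw [div_eq_mul_inv, mul_inv, div_eq_mul_inv R, inv_pow, inv_pow]; ring
  rw [e]
  refine (abs_add_le _ _).trans (add_le_add ?_ ?_)
  · rw [abs_neg, abs_div, abs_two]
    refine (half_le_self (abs_nonneg _)).trans ?_
    rw [abs_mul, abs_mul, abs_pow]
    gcongr
  · rw [abs_mul, abs_pow]
    gcongr

set_option maxHeartbeats 1000000 in
/-- The jackknife bias correction agrees with `analyticNoInfo` up to `O(n⁻²)`: the expansion of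
the leave-one-out estimates about the full-sample estimate has a first-order term that sums to
zero, because the score averages to zero at the estimate, and a second-order term that sums to the
analytical bias estimate. -/
lemma exists_jackknife_close (hL : LocalModel f Θ θ₀ M r κ C h) (hθ : IsMLE f Θ θhat)
    (hη : 0 < η) (hB : 0 ≤ B) :
    ∃ (N : ℕ) (A : ℝ), ∀ n ≥ N, ∀ z : Fin n → 𝓩, IsGoodSample f Θ θ₀ M κ C η B h z →
      |jackknife θhat n z - analyticNoInfo f Θ θhat n z| ≤ A * ((n : ℝ) ^ 2)⁻¹ := by
  obtain ⟨B₁, hB₁, hexp⟩ := exists_estimate_expansion hL hθ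
  obtain ⟨B₂, hB₂, hterm⟩ := exists_root_terms_le hL hθ
  obtain ⟨A₀, hA₀, hbias⟩ := IsGoodSample.exists_noInfoBias_le hL hθ hη hB
  have hC := hL.C_pos
  have hM0 := hL.envelope_nonneg
  -- `m ≥ N` ensures that removing one observation moves no average by as much as `η`
  obtain ⟨N, hN⟩ := exists_nat_ge (max (256 * (1 + B) / η ^ 2) (8 * C / η))
  set D := (B₁ * η + B₂) * 4 ^ 3 with hD
  have hD0 : 0 ≤ D := by positivity
  refine ⟨N + 2, 2 * A₀ + 4 * (D * (4 * (C ^ 3 + 1 + B))), fun n hn z hz => ?_⟩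
  obtain ⟨m, rfl⟩ : ∃ m, n = m + 1 := ⟨n - 1, by omega⟩
  have hmN : N ≤ m := by omega
  have hm1 : 1 ≤ m := by omega
  have hm1' : (1 : ℝ) ≤ m := by exact_mod_cast hm1
  have hm0 : (0 : ℝ) < m := by linarith
  have hz' := hz.isLocalSample hη
  have hmbig : max (256 * (1 + B) / η ^ 2) (8 * C / η) ≤ m := hN.trans (by exact_mod_cast hmN)
  have hm256 : 256 * (1 + B) ≤ m * η ^ 2 := by
    rw [← div_le_iff₀ (by positivity)]; exact (le_max_left _ _).trans hmbig
  have hm8 : 8 * C ≤ m * η := by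
    rw [← div_le_iff₀ hη]; exact (le_max_right _ _).trans hmbig
  have hsum4 : ∑ i, M (z i) ^ 4 ≤ (m + 1) * B := by
    have := hz.fourth
    rw [avg, inv_mul_le_iff₀ (by positivity)] at this
    exact_mod_cast this
  -- each observation is small compared with the sample size
  have hMi : ∀ i, C + M (z i) ≤ m * η / 4 := by
    intro i
    have h1 : M (z i) ^ 4 ≤ (m + 1) * B :=
      (Finset.single_le_sum (f := fun i => M (z i) ^ 4) (fun j _ => by positivity)
        (Finset.mem_univ i)).trans hsum4
    have h2 : M (z i) ^ 2 ≤ (m * η / 8) ^ 2 := by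
      have h3 : M (z i) ^ 2 ≤ 1 + M (z i) ^ 4 := by
        nlinarith [sq_nonneg (M (z i) ^ 2 - 1), sq_nonneg (M (z i) ^ 2)]
      have h4 : (m : ℝ) * (256 * (1 + B)) ≤ m * (m * η ^ 2) :=
        mul_le_mul_of_nonneg_left hm256 hm0.le
      nlinarith [mul_nonneg hm0.le hB, mul_nonneg (sub_nonneg.2 hm1') hB]
    have h5 := abs_le_of_sq_le_sq h2 (by positivity)
    linarith [le_abs_self (M (z i))]
  -- effect of removing one observation on an average
  have hclose : ∀ (i : Fin (m + 1)) (g : 𝓩 → ℝ) (c : ℝ), 0 ≤ c → (∀ y, |g y| ≤ c * M y) →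
      |avg (i.removeNth z) g - avg z g| ≤ c * ((C + M (z i)) / m) := by
    intro i g c hc hg
    rw [avg_removeNth_sub (by omega), abs_div, abs_of_pos hm0, ← mul_div_assoc]
    refine div_le_div_of_nonneg_right ?_ hm0.le
    refine (abs_sub _ _).trans ?_
    have h1 : |avg z g| ≤ c * C := by
      refine (abs_avg_le z hg).trans ?_
      rw [avg_const_mul]
      exact mul_le_mul_of_nonneg_left hz'.envelope hc
    linarith [hg (z i)]
  set u : Fin (m + 1) → ℝ := fun i => (C + M (z i)) / m with hu
  have hu0 : ∀ i, 0 ≤ u i := fun i => div_nonneg (add_nonneg hC.le (hM0 _)) hm0.le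
  have hul : ∀ i, u i ≤ η / 4 := fun i => by
    rw [hu, div_le_iff₀ hm0]; linarith [hMi i]
  have hloc : ∀ i : Fin (m + 1), IsLocalSample f Θ θ₀ M κ C h (i.removeNth z) := by
    intro i
    have hone : ∀ m' ≤ 7, ∀ y, |logLikDeriv f Θ m' y θ₀| ≤ 1 * M y := fun m' hm' y => by
      rw [one_mul]; exact hL.bound m' hm' _ hL.center_mem y
    refine hz.isLocalSample_of_close ?_ (fun k => ?_) ?_
    · have := hclose i M 1 zero_le_one fun y => by rw [abs_of_nonneg (hM0 y), one_mul]
      linarith [hul i]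
    · have := hclose i (h k) 2 zero_le_two (hL.h_bound k)
      linarith [hul i]
    · have := hclose i _ 1 zero_le_one (hone 2 (by norm_num))
      linarith [hul i]
  have hθΘ := (hθ (m + 1) z).1
  have hsize : ∀ i : Fin (m + 1), derivDiffSize f Θ θhat z (i.removeNth z) ≤ 4 * u i := by
    intro i
    calc _ ≤ ∑ _m : Fin 4, 1 * u i := Finset.sum_le_sum fun k _ =>
          hclose i _ 1 zero_le_one fun y => by
            rw [one_mul]; exact hL.bound _ (by omega) _ hθΘ y
      _ = _ := by simp
  set J := avgDeriv f Θ θhat z 2 with hJ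
  set Q := avgDeriv f Θ θhat z 3 with hQ
  set S := avg z (fun y => score f Θ y (θhat (m + 1) z) ^ 2) with hS
  set R := avg z (fun y => score f Θ y (θhat (m + 1) z) * score' f Θ y (θhat (m + 1) z)) with hR
  set bias := noInfoBias f Θ θhat z with hbias_def
  have hbias_eq : bias = -(Q * S * J⁻¹ ^ 3 / 2) + R * J⁻¹ ^ 2 := by
    rw [hbias_def, noInfoBias, div_eq_mul_inv, mul_inv, div_eq_mul_inv, inv_pow, inv_pow]; ring
  set lead : Fin (m + 1) → ℝ := fun i =>
    rootLin J (derivDiff f Θ θhat z (i.removeNth z) 1)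
      + rootLin J (derivDiff f Θ θhat z (i.removeNth z) 1)
        * rootSlope J Q (derivDiff f Θ θhat z (i.removeNth z) 1)
          (derivDiff f Θ θhat z (i.removeNth z) 2) with hlead
  have hrem : ∀ i : Fin (m + 1),
      |θhat m (i.removeNth z) - θhat (m + 1) z - lead i| ≤ D * u i ^ 3 := by
    intro i
    have h1 := hexp _ _ z (i.removeNth z) hz' (hloc i)
    have h2 := (hterm _ _ z (i.removeNth z) hz').2.2
    rw [← hJ, ← hQ] at h1 h2
    set c := rootCubic J Q (avgDeriv f Θ θhat z 4) (derivDiff f Θ θhat z (i.removeNth z) 1)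
      (derivDiff f Θ θhat z (i.removeNth z) 2) (derivDiff f Θ θhat z (i.removeNth z) 3)
    set ε := derivDiffSize f Θ θhat z (i.removeNth z)
    have hε0 : 0 ≤ ε := derivDiffSize_nonneg
    have hε1 : ε ≤ η := (hsize i).trans (by linarith [hul i])
    have e : θhat m (i.removeNth z) - θhat (m + 1) z - lead i
        = (θhat m (i.removeNth z) - θhat (m + 1) z - (lead i + c)) + c := by ring
    rw [e]
    calc _ ≤ B₁ * ε ^ 4 + B₂ * ε ^ 3 := (abs_add_le _ _).trans (add_le_add h1 h2)
      _ = (B₁ * ε + B₂) * ε ^ 3 := by ring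
      _ ≤ (B₁ * η + B₂) * (4 * u i) ^ 3 := by
          gcongr
          exact hsize i
      _ = D * u i ^ 3 := by rw [hD]; ring
  -- the linear terms cancel because the score averages to zero at the estimate
  have hleadsum : ∑ i, lead i = (m + 1) / m ^ 2 * bias := by
    have hsc : avg z (fun y => logLikDeriv f Θ 1 y (θhat (m + 1) z)) = 0 :=
      hz'.score_eq_zero hL hθ
    have hd1 : ∀ i : Fin (m + 1), derivDiff f Θ θhat z (i.removeNth z) 1
        = -(score f Θ (z i) (θhat (m + 1) z) / m) := fun i => by
      rw [derivDiff, avg_removeNth_sub (by omega), hsc, zero_sub, neg_div]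
    have hd2 : ∀ i : Fin (m + 1), derivDiff f Θ θhat z (i.removeNth z) 2
        = (J - score' f Θ (z i) (θhat (m + 1) z)) / m := fun i => by
      rw [derivDiff, avg_removeNth_sub (by omega)]; rfl
    have hs1 : ∑ i, score f Θ (z i) (θhat (m + 1) z) = 0 := by
      simpa [avg, hm0.ne', (by positivity : (m : ℝ) + 1 ≠ 0)] using hsc
    have hs2 : ∑ i, score f Θ (z i) (θhat (m + 1) z) ^ 2 = (m + 1) * S := by
      rw [hS, avg]; push_cast; field_simp
    have hs3 : ∑ i, score f Θ (z i) (θhat (m + 1) z) * score' f Θ (z i) (θhat (m + 1) z)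
        = (m + 1) * R := by
      rw [hR, avg]; push_cast; field_simp
    have hl : ∀ i, lead i = (J⁻¹ / m - J⁻¹ ^ 2 * J / m ^ 2) * score f Θ (z i) (θhat (m + 1) z)
        - J⁻¹ ^ 3 * Q / (2 * m ^ 2) * score f Θ (z i) (θhat (m + 1) z) ^ 2
        + J⁻¹ ^ 2 / m ^ 2 *
          (score f Θ (z i) (θhat (m + 1) z) * score' f Θ (z i) (θhat (m + 1) z)) := fun i => by
      simp only [hlead, rootLin, rootSlope, hd1, hd2]
      ring
    rw [Finset.sum_congr rfl fun i _ => hl i, Finset.sum_add_distrib, Finset.sum_sub_distrib,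
      ← Finset.mul_sum, ← Finset.mul_sum, ← Finset.mul_sum, hs1, hs2, hs3, hbias_eq]
    ring
  -- `O(n⁻²)`: a sum of `n` terms with cubes of order `n⁻³` and a bounded average of `M³`
  have hu3 : ∑ i, u i ^ 3 ≤ (m + 1) * (4 * (C ^ 3 + 1 + B)) / m ^ 3 := by
    have h1 : ∀ i, u i ^ 3 ≤ (4 * (C ^ 3 + 1) + 4 * M (z i) ^ 4) / m ^ 3 := fun i => by
      rw [hu, div_pow]
      refine div_le_div_of_nonneg_right ?_ (by positivity)
      have h2 := add_pow_le hC.le (hM0 (z i)) 3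
      have h3 : M (z i) ^ 3 ≤ 1 + M (z i) ^ 4 := by
        nlinarith [sq_nonneg (M (z i) ^ 2 - M (z i)), sq_nonneg (M (z i) ^ 2 - 1),
          sq_nonneg (M (z i)), hM0 (z i), sq_nonneg (M (z i) - 1)]
      norm_num at h2
      linarith
    refine (Finset.sum_le_sum fun i _ => h1 i).trans ?_
    rw [← Finset.sum_div, Finset.sum_add_distrib, ← Finset.mul_sum, Finset.sum_const,
      Finset.card_univ, Fintype.card_fin, nsmul_eq_mul]
    refine div_le_div_of_nonneg_right ?_ (by positivity)
    rw [← Finset.mul_sum]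
    push_cast
    linarith
  set E := ∑ i : Fin (m + 1), (θhat m (i.removeNth z) - θhat (m + 1) z - lead i) with hE
  have hEle : |E| ≤ D * ((m + 1) * (4 * (C ^ 3 + 1 + B)) / m ^ 3) := by
    refine (Finset.abs_sum_le_sum_abs _ _).trans ?_
    refine (Finset.sum_le_sum fun i _ => hrem i).trans ?_
    rw [← Finset.mul_sum]
    exact mul_le_mul_of_nonneg_left hu3 hD0
  have hsum : ∑ i : Fin (m + 1), θhat m (i.removeNth z)
      = E + (m + 1) * θhat (m + 1) z + (m + 1) / m ^ 2 * bias := by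
    rw [hE, ← hleadsum, Finset.sum_sub_distrib, Finset.sum_sub_distrib, Finset.sum_const,
      Finset.card_univ, Fintype.card_fin, nsmul_eq_mul]
    push_cast
    ring
  have hdiff : jackknife θhat (m + 1) z - analyticNoInfo f Θ θhat (m + 1) z
      = -(bias / (m * (m + 1))) - m / (m + 1) * E := by
    rw [analyticNoInfo_eq, jackknife, hsum, ← hbias_def]
    push_cast
    field_simp
    ring
  have hbound := hbias _ z hz
  rw [hdiff]
  refine (abs_sub _ _).trans ?_
  rw [abs_neg, abs_div, abs_mul _ E, abs_of_nonneg (by positivity : (0 : ℝ) ≤ m / (m + 1)),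
    abs_of_nonneg (by positivity : (0 : ℝ) ≤ m * (m + 1)), add_mul]
  have hm2 : ((m : ℝ) + 1) ≤ 2 * m := by linarith
  push_cast
  refine add_le_add ?_ ?_
  · rw [← div_eq_mul_inv, div_le_div_iff₀ (by positivity) (by positivity)]
    have : |bias| * ((m : ℝ) + 1) ^ 2 ≤ A₀ * ((m + 1) * (2 * m)) := by
      rw [pow_two]; gcongr
    linarith
  · calc _ ≤ (m : ℝ) / (m + 1) * (D * ((m + 1) * (4 * (C ^ 3 + 1 + B)) / m ^ 3)) := by gcongr
      _ = D * (4 * (C ^ 3 + 1 + B)) / m ^ 2 := by field_simp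
      _ ≤ 4 * (D * (4 * (C ^ 3 + 1 + B))) * (((m : ℝ) + 1) ^ 2)⁻¹ := by
        rw [← div_eq_mul_inv, div_le_div_iff₀ (by positivity) (by positivity)]
        have h1 : ((m : ℝ) + 1) ^ 2 ≤ 4 * m ^ 2 := by
          calc ((m : ℝ) + 1) ^ 2 ≤ (2 * m) ^ 2 := by gcongr
            _ = _ := by ring
        have h2 : 0 ≤ D * (4 * (C ^ 3 + 1 + B)) := by positivity
        calc D * (4 * (C ^ 3 + 1 + B)) * ((m : ℝ) + 1) ^ 2
            ≤ D * (4 * (C ^ 3 + 1 + B)) * (4 * m ^ 2) := mul_le_mul_of_nonneg_left h1 h2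
          _ = _ := by ring

end Jackknife

/-! ### The bootstrap -/

section Bootstrap

variable {𝓩 : Type*} {f : 𝓩 → ℝ → ℝ} {Θ : Set ℝ} {θ₀ : ℝ} {M : 𝓩 → ℝ} {r κ C η B : ℝ} {K : ℕ}
  {h : Fin K → 𝓩 → ℝ} {θhat : Estimator 𝓩}

/-- The functions whose resampling averages control the bootstrap estimate: the functions `h k`,
the first four log-likelihood derivatives at `t`, the envelope and the curvature at `θ₀`. -/
def controlFamily (f : 𝓩 → ℝ → ℝ) (Θ : Set ℝ) (θ₀ : ℝ) (M : 𝓩 → ℝ) (h : Fin K → 𝓩 → ℝ) (t : ℝ) :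
    Fin K ⊕ Fin 4 ⊕ Fin 2 → 𝓩 → ℝ :=
  Sum.elim h (Sum.elim (fun m y => logLikDeriv f Θ (m + 1) y t)
    ![M, fun y => logLikDeriv f Θ 2 y θ₀])

/-- The members of `controlFamily` at the estimate, centred at their sample averages. -/
def centredFamily (f : 𝓩 → ℝ → ℝ) (Θ : Set ℝ) (θ₀ : ℝ) (M : 𝓩 → ℝ) (h : Fin K → 𝓩 → ℝ)
    (θhat : Estimator 𝓩) {n : ℕ} (z : Fin n → 𝓩) (j : Fin K ⊕ Fin 4 ⊕ Fin 2) (y : 𝓩) : ℝ :=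
  controlFamily f Θ θ₀ M h (θhat n z) j y - avg z (controlFamily f Θ θ₀ M h (θhat n z) j)

/-- Total deviation of a resample from the sample. -/
def resampleDev (f : 𝓩 → ℝ → ℝ) (Θ : Set ℝ) (θ₀ : ℝ) (M : 𝓩 → ℝ) (h : Fin K → 𝓩 → ℝ)
    (θhat : Estimator 𝓩) {n : ℕ} (z : Fin n → 𝓩) (ρ : Fin n → Fin n) : ℝ :=
  ∑ j, |avg (z ∘ ρ) (centredFamily f Θ θ₀ M h θhat z j)|

lemma abs_controlFamily_le (hL : LocalModel f Θ θ₀ M r κ C h) {t : ℝ} (ht : t ∈ Θ)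
    (j : Fin K ⊕ Fin 4 ⊕ Fin 2) (y : 𝓩) : |controlFamily f Θ θ₀ M h t j y| ≤ 2 * M y := by
  have hM := hL.envelope_nonneg y
  rcases j with k | m | m
  · exact hL.h_bound k y
  · exact (hL.bound _ (by omega) t ht y).trans (by linarith)
  · fin_cases m
    · simp [controlFamily, abs_of_nonneg hM]
      linarith
    · exact (hL.bound 2 (by norm_num) θ₀ hL.center_mem y).trans (by linarith)

lemma avg_centredFamily {n : ℕ} (hn : n ≠ 0) (z : Fin n → 𝓩) (j : Fin K ⊕ Fin 4 ⊕ Fin 2) :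
    avg z (centredFamily f Θ θ₀ M h θhat z j) = 0 := by
  have := avg_sub z (controlFamily f Θ θ₀ M h (θhat n z) j)
    (fun _ => avg z (controlFamily f Θ θ₀ M h (θhat n z) j))
  rw [avg_const z hn, sub_self] at this
  exact this

lemma avg_comp_centredFamily {n : ℕ} (hn : n ≠ 0) (z : Fin n → 𝓩) (ρ : Fin n → Fin n)
    (j : Fin K ⊕ Fin 4 ⊕ Fin 2) :
    avg (z ∘ ρ) (centredFamily f Θ θ₀ M h θhat z j)
      = avg (z ∘ ρ) (controlFamily f Θ θ₀ M h (θhat n z) j)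
        - avg z (controlFamily f Θ θ₀ M h (θhat n z) j) := by
  have := avg_sub (z ∘ ρ) (controlFamily f Θ θ₀ M h (θhat n z) j)
    (fun _ => avg z (controlFamily f Θ θ₀ M h (θhat n z) j))
  rw [avg_const _ hn] at this
  exact this

lemma derivDiff_resample {n : ℕ} (hn : n ≠ 0) (z : Fin n → 𝓩) (ρ : Fin n → Fin n) (m : Fin 4) :
    derivDiff f Θ θhat z (z ∘ ρ) (m + 1)
      = avg (z ∘ ρ) (centredFamily f Θ θ₀ M h θhat z (.inr (.inl m))) := by
  rw [avg_comp_centredFamily hn]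
  rfl

lemma abs_avg_centredFamily_le {n : ℕ} (z : Fin n → 𝓩) (ρ : Fin n → Fin n)
    (j : Fin K ⊕ Fin 4 ⊕ Fin 2) :
    |avg (z ∘ ρ) (centredFamily f Θ θ₀ M h θhat z j)| ≤ resampleDev f Θ θ₀ M h θhat z ρ :=
  Finset.single_le_sum
    (f := fun j => |avg (z ∘ ρ) (centredFamily f Θ θ₀ M h θhat z j)|)
    (fun _ _ => abs_nonneg _) (Finset.mem_univ j)

lemma derivDiffSize_le_resampleDev {n : ℕ} (hn : n ≠ 0) (z : Fin n → 𝓩) (ρ : Fin n → Fin n) :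
    derivDiffSize f Θ θhat z (z ∘ ρ) ≤ resampleDev f Θ θ₀ M h θhat z ρ := by
  rw [derivDiffSize, resampleDev, Fintype.sum_sum_type, Fintype.sum_sum_type]
  simp only [derivDiff_resample (θ₀ := θ₀) (M := M) (h := h) hn]
  have h1 : 0 ≤ ∑ x : Fin K, |avg (z ∘ ρ) (centredFamily f Θ θ₀ M h θhat z (.inl x))| :=
    Finset.sum_nonneg fun _ _ => abs_nonneg _
  have h2 : 0 ≤ ∑ x : Fin 2, |avg (z ∘ ρ) (centredFamily f Θ θ₀ M h θhat z (.inr (.inr x)))| :=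
    Finset.sum_nonneg fun _ _ => abs_nonneg _
  linarith

/-- Under resampling the total deviation has fourth moment `O(n⁻²)`. -/
lemma exists_resampleAvg_dev_le (hL : LocalModel f Θ θ₀ M r κ C h) (hθ : IsMLE f Θ θhat)
    (hη : 0 < η) (hB : 0 ≤ B) :
    ∃ A, 0 ≤ A ∧ ∀ (n : ℕ) (z : Fin n → 𝓩), IsGoodSample f Θ θ₀ M κ C η B h z →
      resampleAvg (fun ρ => resampleDev f Θ θ₀ M h θhat z ρ ^ 4) ≤ A * ((n : ℝ)⁻¹ ^ 2) := by
  have hC := hL.C_pos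
  refine ⟨(K + 6) ^ 3 * ((K + 6) * (3 * (8 * (16 * B + (2 * C) ^ 4)))), by positivity,
    fun n z hz => ?_⟩
  have hz' := hz.isLocalSample hη
  have hn := hz'.ne_zero hL
  have hθΘ := (hθ n z).1
  set g := centredFamily f Θ θ₀ M h θhat z with hg
  have hcard : ((Finset.univ : Finset (Fin K ⊕ Fin 4 ⊕ Fin 2)).card : ℝ) = K + 6 := by
    simp
  have hg4 : ∀ j, avg z (fun y => g j y ^ 4) ≤ 8 * (16 * B + (2 * C) ^ 4) := by
    intro j
    set a := avg z (controlFamily f Θ θ₀ M h (θhat n z) j) with ha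
    have ha' : |a| ≤ 2 * C := by
      refine (abs_avg_le z (abs_controlFamily_le hL hθΘ j)).trans ?_
      rw [avg_const_mul]
      linarith [hz'.envelope]
    have hy : ∀ y, g j y ^ 4 ≤ 8 * (2 * C) ^ 4 + 128 * M y ^ 4 := fun y => by
      have h1 : |g j y| ≤ 2 * M y + 2 * C := by
        refine (abs_sub _ _).trans (add_le_add (abs_controlFamily_le hL hθΘ j y) ha')
      have hM := hL.envelope_nonneg y
      calc g j y ^ 4 = |g j y| ^ 4 := by rw [← abs_pow, abs_of_nonneg (by positivity)]
        _ ≤ (2 * M y + 2 * C) ^ 4 := by gcongr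
        _ ≤ 2 ^ (4 - 1) * ((2 * M y) ^ 4 + (2 * C) ^ 4) :=
            add_pow_le (by positivity) (by positivity) 4
        _ = _ := by ring
    refine (avg_mono z hy).trans ?_
    rw [avg_add, avg_const z hn, avg_const_mul]
    linarith [hz.fourth]
  have h1 : ∀ ρ, resampleDev f Θ θ₀ M h θhat z ρ ^ 4
      ≤ (K + 6) ^ 3 * ∑ j, avg (z ∘ ρ) (g j) ^ 4 := by
    intro ρ
    have := pow_sum_div_card_le_sum_pow (s := Finset.univ) (f := fun j => |avg (z ∘ ρ) (g j)|)
      (fun _ _ => abs_nonneg _) 3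
    rw [hcard, div_le_iff₀ (by positivity)] at this
    refine this.trans_eq ?_
    rw [mul_comm]
    congr 1
    exact Finset.sum_congr rfl fun j _ =>
      Even.pow_abs (by decide : Even 4) _
  have h2 : resampleAvg (fun ρ => (K + 6 : ℝ) ^ 3 * ∑ j, avg (z ∘ ρ) (g j) ^ 4)
      = (K + 6) ^ 3 * ∑ j, resampleAvg fun ρ => avg (z ∘ ρ) (g j) ^ 4 := by
    simp only [resampleAvg, ← Finset.mul_sum]
    rw [Finset.sum_comm]
    ring
  refine (resampleAvg_mono h1).trans ?_
  rw [h2]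
  have h3 : ∑ j, resampleAvg (fun ρ => avg (z ∘ ρ) (g j) ^ 4)
      ≤ (K + 6) * ((n : ℝ)⁻¹ ^ 2 * (3 * (8 * (16 * B + (2 * C) ^ 4)))) := by
    calc _ ≤ ∑ _j : Fin K ⊕ Fin 4 ⊕ Fin 2, (n : ℝ)⁻¹ ^ 2 * (3 * (8 * (16 * B + (2 * C) ^ 4))) :=
          Finset.sum_le_sum fun j _ =>
            (resampleAvg_avg_pow_four_le hn (avg_centredFamily hn z) j).trans
              (by have := hg4 j; gcongr)
      _ = _ := by rw [Finset.sum_const, nsmul_eq_mul, hcard]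
  calc _ ≤ (K + 6 : ℝ) ^ 3 * ((K + 6) * ((n : ℝ)⁻¹ ^ 2 * (3 * (8 * (16 * B + (2 * C) ^ 4))))) := by
        gcongr
    _ = _ := by ring

/-- Expansion of the bootstrap estimate about the estimate, with an error that is of fourth order
in the deviation of the resample. Resamples that are not local have a large deviation, so that for
them the boundedness of the parameter set suffices. -/
lemma exists_resample_expansion (hL : LocalModel f Θ θ₀ M r κ C h) (hθ : IsMLE f Θ θhat)
    (hη : 0 < η) :
    ∃ A, 0 ≤ A ∧ ∀ (n : ℕ) (z : Fin n → 𝓩), IsGoodSample f Θ θ₀ M κ C η B h z →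
      ∀ ρ : Fin n → Fin n, |θhat n (z ∘ ρ) - θhat n z -
        (rootLin (avgDeriv f Θ θhat z 2) (derivDiff f Θ θhat z (z ∘ ρ) 1)
        + rootLin (avgDeriv f Θ θhat z 2) (derivDiff f Θ θhat z (z ∘ ρ) 1)
          * rootSlope (avgDeriv f Θ θhat z 2) (avgDeriv f Θ θhat z 3)
            (derivDiff f Θ θhat z (z ∘ ρ) 1) (derivDiff f Θ θhat z (z ∘ ρ) 2)
        + rootCubic (avgDeriv f Θ θhat z 2) (avgDeriv f Θ θhat z 3) (avgDeriv f Θ θhat z 4)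
            (derivDiff f Θ θhat z (z ∘ ρ) 1) (derivDiff f Θ θhat z (z ∘ ρ) 2)
            (derivDiff f Θ θhat z (z ∘ ρ) 3))|
        ≤ A * resampleDev f Θ θ₀ M h θhat z ρ ^ 4 := by
  obtain ⟨B₁, hB₁, hexp⟩ := exists_estimate_expansion hL hθ
  obtain ⟨B₂, hB₂, hterm⟩ := exists_root_terms_le hL hθ
  have hC := hL.C_pos
  refine ⟨B₁ + (C * η⁻¹ ^ 4 + (B₂ * η⁻¹ ^ 3 + B₂ ^ 2 * η⁻¹ ^ 2 + B₂ * η⁻¹)), by positivity,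
    fun n z hz ρ => ?_⟩
  have hz' := hz.isLocalSample hη
  have hn := hz'.ne_zero hL
  set W := resampleDev f Θ θ₀ M h θhat z ρ with hW
  have hε : derivDiffSize f Θ θhat z (z ∘ ρ) ≤ W := derivDiffSize_le_resampleDev hn z ρ
  have hε0 : 0 ≤ derivDiffSize f Θ θhat z (z ∘ ρ) := derivDiffSize_nonneg
  have hW0 : 0 ≤ W := hε0.trans hε
  rw [add_mul]
  by_cases hWη : W < η
  · have hloc : IsLocalSample f Θ θ₀ M κ C h (z ∘ ρ) := by
      have hdev : ∀ j, |avg (z ∘ ρ) (controlFamily f Θ θ₀ M h (θhat n z) j)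
          - avg z (controlFamily f Θ θ₀ M h (θhat n z) j)| < η := fun j => by
        rw [← avg_comp_centredFamily hn]
        exact (abs_avg_centredFamily_le z ρ j).trans_lt hWη
      exact hz.isLocalSample_of_close (hdev (.inr (.inr 0))) (fun k => hdev (.inl k))
        (hdev (.inr (.inr 1)))
    refine (hexp _ _ z (z ∘ ρ) hz' hloc).trans ?_
    have h1 : B₁ * derivDiffSize f Θ θhat z (z ∘ ρ) ^ 4 ≤ B₁ * W ^ 4 := by gcongr
    have h2 : 0 ≤ (C * η⁻¹ ^ 4 + (B₂ * η⁻¹ ^ 3 + B₂ ^ 2 * η⁻¹ ^ 2 + B₂ * η⁻¹)) * W ^ 4 := by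
      positivity
    linarith
  · have hηW : 1 ≤ η⁻¹ * W := by
      rw [inv_mul_eq_div, le_div_iff₀ hη]; linarith [not_lt.1 hWη]
    obtain ⟨hx, hy, hc⟩ := hterm _ _ z (z ∘ ρ) hz'
    set x := rootLin (avgDeriv f Θ θhat z 2) (derivDiff f Θ θhat z (z ∘ ρ) 1)
    set y := rootSlope (avgDeriv f Θ θhat z 2) (avgDeriv f Θ θhat z 3)
      (derivDiff f Θ θhat z (z ∘ ρ) 1) (derivDiff f Θ θhat z (z ∘ ρ) 2)
    set c := rootCubic (avgDeriv f Θ θhat z 2) (avgDeriv f Θ θhat z 3) (avgDeriv f Θ θhat z 4)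
      (derivDiff f Θ θhat z (z ∘ ρ) 1) (derivDiff f Θ θhat z (z ∘ ρ) 2)
      (derivDiff f Θ θhat z (z ∘ ρ) 3)
    have hpow : ∀ k : ℕ, 1 ≤ (η⁻¹ * W) ^ k := fun k => one_le_pow₀ hηW
    have d0 : |θhat n (z ∘ ρ) - θhat n z| ≤ C * η⁻¹ ^ 4 * W ^ 4 := by
      refine (hL.diam _ (hθ n _).1 _ (hθ n z).1).trans ?_
      calc C ≤ C * (η⁻¹ * W) ^ 4 := le_mul_of_one_le_right hC.le (hpow 4)
        _ = _ := by ring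
    have d1 : |x| ≤ B₂ * η⁻¹ ^ 3 * W ^ 4 := by
      calc |x| ≤ B₂ * W := hx.trans (by gcongr)
        _ ≤ B₂ * W * (η⁻¹ * W) ^ 3 := le_mul_of_one_le_right (by positivity) (hpow 3)
        _ = _ := by ring
    have d2 : |x * y| ≤ B₂ ^ 2 * η⁻¹ ^ 2 * W ^ 4 := by
      rw [abs_mul]
      calc |x| * |y| ≤ (B₂ * W) * (B₂ * W) :=
            mul_le_mul (hx.trans (by gcongr)) (hy.trans (by gcongr)) (abs_nonneg _)
              (by positivity)
        _ ≤ (B₂ * W) * (B₂ * W) * (η⁻¹ * W) ^ 2 :=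
            le_mul_of_one_le_right (by positivity) (hpow 2)
        _ = _ := by ring
    have d3 : |c| ≤ B₂ * η⁻¹ * W ^ 4 := by
      calc |c| ≤ B₂ * W ^ 3 := hc.trans (by gcongr)
        _ ≤ B₂ * W ^ 3 * (η⁻¹ * W) ^ 1 := le_mul_of_one_le_right (by positivity) (hpow 1)
        _ = _ := by ring
    have h1 : 0 ≤ B₁ * W ^ 4 := by positivity
    have h2 : |θhat n (z ∘ ρ) - θhat n z - (x + x * y + c)|
        ≤ |θhat n (z ∘ ρ) - θhat n z| + (|x| + |x * y| + |c|) :=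
      (abs_sub _ _).trans (add_le_add le_rfl (abs_add_three _ _ _))
    linarith

set_option maxHeartbeats 1000000 in
/-- The bootstrap bias correction agrees with `analyticNoInfo` up to `O(n⁻²)`: the first-order term
of the expansion has mean zero under resampling, the second-order term has mean equal to the
analytical bias estimate divided by `n`, and the third-order term has mean `O(n⁻²)`. -/
lemma exists_bootstrap_close (hL : LocalModel f Θ θ₀ M r κ C h) (hθ : IsMLE f Θ θhat)
    (hη : 0 < η) (hB : 0 ≤ B) :
    ∃ A : ℝ, ∀ (n : ℕ) (z : Fin n → 𝓩), IsGoodSample f Θ θ₀ M κ C η B h z →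
      |bootstrap θhat n z - analyticNoInfo f Θ θhat n z| ≤ A * ((n : ℝ) ^ 2)⁻¹ := by
  obtain ⟨A₁, hA₁, hdev⟩ := exists_resampleAvg_dev_le hL hθ hη hB
  obtain ⟨A₂, hA₂, hexp⟩ := exists_resample_expansion (B := B) hL hθ hη
  have hC := hL.C_pos
  have hκ := hL.κ_pos
  set A₃ := 4 * (C ^ 3 + 1 + B) with hA₃
  have hA₃0 : 0 ≤ A₃ := by positivity
  set j₀ := 2 / κ with hj₀
  have hj₀0 : 0 ≤ j₀ := by positivity
  refine ⟨(j₀ ^ 3 + 3 / 2 * j₀ ^ 4 * C + (j₀ ^ 5 * C ^ 2 / 2 + j₀ ^ 4 * C / 6) + j₀ ^ 3 / 2) * A₃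
    + A₂ * A₁, fun n z hz => ?_⟩
  have hz' := hz.isLocalSample hη
  have hn := hz'.ne_zero hL
  have hθΘ := (hθ n z).1
  set J := avgDeriv f Θ θhat z 2 with hJ
  set Q := avgDeriv f Θ θhat z 3 with hQ
  set T := avgDeriv f Θ θhat z 4 with hT
  have hJle : |J⁻¹| ≤ j₀ := by
    have h1 := hz'.curvature_le hL (hz'.mem_ball hL hθ)
    rw [abs_inv, hj₀, ← inv_div]
    refine inv_anti₀ (by positivity) ?_
    rw [hJ, avgDeriv, abs_of_neg (by linarith)]
    linarith
  have hQle : |Q| ≤ C := hz'.abs_avg_logLikDeriv_le hL (by norm_num) hθΘ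
  have hTle : |T| ≤ C := hz'.abs_avg_logLikDeriv_le hL (by norm_num) hθΘ
  -- the centred derivatives of orders one to four at the estimate
  set g : Fin 4 → 𝓩 → ℝ := fun m => centredFamily f Θ θ₀ M h θhat z (.inr (.inl m)) with hg
  have hg0 : ∀ m, avg z (g m) = 0 := fun m => avg_centredFamily hn z _
  have hgle : ∀ m y, |g m y| ≤ C + M y := fun m y => by
    rw [add_comm]
    refine (abs_sub _ _).trans (add_le_add (hL.bound _ (by omega) _ hθΘ y) ?_)
    exact hz'.abs_avg_logLikDeriv_le hL (by omega) hθΘ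
  have hthird : ∀ p q t, |avg z fun y => g p y * g q y * g t y| ≤ A₃ := fun p q t => by
    have h1 : ∀ y, |g p y * g q y * g t y| ≤ 4 * (C ^ 3 + 1) + 4 * M y ^ 4 := fun y => by
      have hM := hL.envelope_nonneg y
      rw [abs_mul, abs_mul]
      calc |g p y| * |g q y| * |g t y| ≤ (C + M y) * (C + M y) * (C + M y) := by
            gcongr <;> exact hgle _ y
        _ = (C + M y) ^ 3 := by ring
        _ ≤ 2 ^ (3 - 1) * (C ^ 3 + M y ^ 3) := add_pow_le hC.le hM 3
        _ ≤ _ := by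
          have h3 : M y ^ 3 ≤ 1 + M y ^ 4 := by
            nlinarith [sq_nonneg (M y ^ 2 - M y), sq_nonneg (M y ^ 2 - 1),
              sq_nonneg (M y), sq_nonneg (M y - 1)]
          norm_num
          linarith
    refine (abs_avg_le z h1).trans ?_
    rw [avg_add, avg_const z hn, avg_const_mul, hA₃]
    linarith [hz.fourth]
  set c : Fin 4 → (Fin n → Fin n) → ℝ := fun m ρ => avg (z ∘ ρ) (g m) with hc
  have hd : ∀ (m : Fin 4) ρ, derivDiff f Θ θhat z (z ∘ ρ) (m + 1) = c m ρ := fun m ρ =>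
    derivDiff_resample hn z ρ m
  have hd1 : ∀ ρ, derivDiff f Θ θhat z (z ∘ ρ) 1 = c 0 ρ := hd 0
  have hd2 : ∀ ρ, derivDiff f Θ θhat z (z ∘ ρ) 2 = c 1 ρ := hd 1
  have hd3 : ∀ ρ, derivDiff f Θ θhat z (z ∘ ρ) 3 = c 2 ρ := hd 2
  set P : (Fin n → Fin n) → ℝ := fun ρ => rootLin J (c 0 ρ) + rootLin J (c 0 ρ)
    * rootSlope J Q (c 0 ρ) (c 1 ρ) + rootCubic J Q T (c 0 ρ) (c 1 ρ) (c 2 ρ) with hP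
  have hPle : ∀ ρ, |θhat n (z ∘ ρ) - θhat n z - P ρ|
      ≤ A₂ * resampleDev f Θ θ₀ M h θhat z ρ ^ 4 := fun ρ => by
    have := hexp n z hz ρ
    rwa [hd1, hd2, hd3] at this
  have hPeq : ∀ ρ, P ρ = -J⁻¹ * c 0 ρ + (-(J⁻¹ ^ 3 * Q / 2) * (c 0 ρ * c 0 ρ)
      + (J⁻¹ ^ 2 * (c 0 ρ * c 1 ρ) + (-J⁻¹ ^ 3 * (c 0 ρ * c 1 ρ * c 1 ρ)
      + (3 / 2 * J⁻¹ ^ 4 * Q * (c 0 ρ * c 0 ρ * c 1 ρ)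
      + ((-(J⁻¹ ^ 5 * Q ^ 2 / 2) + J⁻¹ ^ 4 * T / 6) * (c 0 ρ * c 0 ρ * c 0 ρ)
      + -(J⁻¹ ^ 3 / 2) * (c 0 ρ * c 0 ρ * c 2 ρ)))))) := fun ρ => by
    simp only [hP, rootLin, rootSlope, rootCubic]
    ring
  have hmean : resampleAvg P = (n : ℝ)⁻¹ * noInfoBias f Θ θhat z + (n : ℝ)⁻¹ ^ 2 *
      (-J⁻¹ ^ 3 * avg z (fun y => g 0 y * g 1 y * g 1 y)
      + 3 / 2 * J⁻¹ ^ 4 * Q * avg z (fun y => g 0 y * g 0 y * g 1 y)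
      + (-(J⁻¹ ^ 5 * Q ^ 2 / 2) + J⁻¹ ^ 4 * T / 6) * avg z (fun y => g 0 y * g 0 y * g 0 y)
      + -(J⁻¹ ^ 3 / 2) * avg z (fun y => g 0 y * g 0 y * g 2 y)) := by
    have hs : avg z (fun y => logLikDeriv f Θ 1 y (θhat n z)) = 0 := hz'.score_eq_zero hL hθ
    have hg0' : ∀ y, g 0 y = score f Θ y (θhat n z) := fun y => by
      have : g 0 y = score f Θ y (θhat n z) - avg z (fun y => score f Θ y (θhat n z)) := rfl
      rw [this, hs, sub_zero]
    have hg1' : ∀ y, g 1 y = score' f Θ y (θhat n z) - J := fun y => rfl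
    have e1 : avg z (fun y => g 0 y * g 0 y) = avg z fun y => score f Θ y (θhat n z) ^ 2 := by
      simp only [hg0', pow_two]
    have e2 : avg z (fun y => g 0 y * g 1 y)
        = avg z fun y => score f Θ y (θhat n z) * score' f Θ y (θhat n z) := by
      have := avg_sub z (fun y => score f Θ y (θhat n z) * score' f Θ y (θhat n z))
        (fun y => J * score f Θ y (θhat n z))
      rw [avg_const_mul, hs, mul_zero, sub_zero] at this
      rw [← this]
      congr 1
      funext y
      rw [hg0', hg1']
      ring
    have hb : noInfoBias f Θ θhat z
        = -(J⁻¹ ^ 3 * Q / 2) * avg z (fun y => g 0 y * g 0 y)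
          + J⁻¹ ^ 2 * avg z (fun y => g 0 y * g 1 y) := by
      rw [e1, e2, noInfoBias, div_eq_mul_inv, mul_inv, div_eq_mul_inv, inv_pow, inv_pow]; ring
    rw [funext hPeq]
    simp only [resampleAvg_add, resampleAvg_const_mul]
    rw [resampleAvg_avg hn hg0, resampleAvg_avg_mul_avg hn hg0, resampleAvg_avg_mul_avg hn hg0,
      resampleAvg_avg_mul_avg_mul_avg hn hg0, resampleAvg_avg_mul_avg_mul_avg hn hg0,
      resampleAvg_avg_mul_avg_mul_avg hn hg0, resampleAvg_avg_mul_avg_mul_avg hn hg0, hb]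
    ring
  have hboot : bootstrap θhat n z - analyticNoInfo f Θ θhat n z
      = -(resampleAvg fun ρ => θhat n (z ∘ ρ) - θhat n z - P ρ)
        - (resampleAvg P - (n : ℝ)⁻¹ * noInfoBias f Θ θhat z) := by
    rw [resampleAvg_sub, resampleAvg_sub, resampleAvg_const hn, analyticNoInfo_eq, bootstrap,
      resampleAvg]
    ring
  have hrem : |resampleAvg fun ρ => θhat n (z ∘ ρ) - θhat n z - P ρ|
      ≤ A₂ * (A₁ * (n : ℝ)⁻¹ ^ 2) := by
    refine (abs_resampleAvg_le _).trans ((resampleAvg_mono hPle).trans ?_)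
    rw [resampleAvg_const_mul]
    exact mul_le_mul_of_nonneg_left (hdev n z hz) hA₂
  rw [hboot, hmean, add_sub_cancel_left, ← inv_pow, add_mul _ (A₂ * A₁),
    add_comm _ (A₂ * A₁ * _)]
  refine (abs_sub _ _).trans (add_le_add ((abs_neg _).trans_le (hrem.trans_eq (by ring))) ?_)
  rw [abs_mul, abs_of_nonneg (by positivity : (0 : ℝ) ≤ (n : ℝ)⁻¹ ^ 2), mul_comm]
  refine mul_le_mul_of_nonneg_right ?_ (by positivity)
  have hjk : ∀ k : ℕ, |J⁻¹ ^ k| ≤ j₀ ^ k := fun k => by rw [abs_pow]; gcongr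
  have hmul : ∀ {a b c d : ℝ}, |a| ≤ c → |b| ≤ d → |a * b| ≤ c * d := fun {a b c d} ha hb => by
    rw [abs_mul]; exact mul_le_mul ha hb (abs_nonneg _) ((abs_nonneg _).trans ha)
  have hneg : ∀ {a c : ℝ}, |a| ≤ c → |-a| ≤ c := fun {a c} ha => by rwa [abs_neg]
  have hdiv : ∀ {a c k : ℝ}, 0 < k → |a| ≤ c → |a / k| ≤ c / k := fun {a c k} hk ha => by
    rw [abs_div, abs_of_pos hk]; gcongr
  have hadd : ∀ {a b c d : ℝ}, |a| ≤ c → |b| ≤ d → |a + b| ≤ c + d := fun {a b c d} ha hb =>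
    (abs_add_le _ _).trans (add_le_add ha hb)
  have hQ2 : |Q ^ 2| ≤ C ^ 2 := by rw [abs_pow]; gcongr
  rw [add_mul _ (j₀ ^ 3 / 2) A₃, add_mul _ (j₀ ^ 5 * C ^ 2 / 2 + j₀ ^ 4 * C / 6) A₃,
    add_mul _ (3 / 2 * j₀ ^ 4 * C) A₃]
  refine hadd (hadd (hadd (hmul (hneg (hjk 3)) (hthird _ _ _)) (hmul (hmul (hmul ?_ (hjk 4)) hQle)
    (hthird _ _ _))) (hmul (hadd (hneg (hdiv two_pos (hmul (hjk 5) hQ2)))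
    (hdiv (by norm_num) (hmul (hjk 4) hTle)))
    (hthird _ _ _))) (hmul (hneg (hdiv two_pos (hjk 3))) (hthird _ _ _))
  rw [abs_of_pos (by norm_num)]

end Bootstrap

/-! ### Regularity of the model near the true parameter -/

section Model

variable {𝓩 : Type*} [MeasurableSpace 𝓩] {μ : Measure 𝓩} {f : 𝓩 → ℝ → ℝ} {Θ : Set ℝ} {θ₀ : ℝ}
  {M : 𝓩 → ℝ}

namespace RegularityConditions

lemma aemeasurable_law {g : 𝓩 → ℝ} (hg : AEMeasurable g μ) : AEMeasurable g (law μ f θ₀) :=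
  hg.mono_ac (withDensity_absolutelyContinuous _ _)

variable (hreg : RegularityConditions μ f Θ θ₀ M)
include hreg

lemma center_mem : θ₀ ∈ Θ := interior_subset hreg.interior

lemma isProbabilityMeasure_law : IsProbabilityMeasure (law μ f θ₀) := by
  refine ⟨?_⟩
  rw [law, withDensity_apply _ MeasurableSet.univ, Measure.restrict_univ]
  exact hreg.density_one θ₀ hreg.center_mem

lemma envelope_nonneg (z : 𝓩) : 0 ≤ M z :=
  (abs_nonneg _).trans (hreg.envelope 0 (by norm_num) θ₀ hreg.center_mem z)

lemma density_eq_exp {θ : ℝ} (hθ : θ ∈ Θ) (z : 𝓩) : f z θ = Real.exp (logLikDeriv f Θ 0 z θ) := by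
  simp [logLikDeriv, Real.exp_log (hreg.density_pos θ hθ z)]

lemma aemeasurable_density {θ : ℝ} (hθ : θ ∈ Θ) : AEMeasurable (fun z => f z θ) μ := by
  rw [funext fun z => hreg.density_eq_exp hθ z]
  exact (hreg.measurable θ hθ 0 (by norm_num)).exp

lemma absolutelyContinuous_law : μ ≪ law μ f θ₀ :=
  withDensity_absolutelyContinuous' (hreg.aemeasurable_density hreg.center_mem).ennreal_ofReal
    (ae_of_all _ fun z => by simpa using hreg.density_pos θ₀ hreg.center_mem z)

lemma integrable_law_iff {g : 𝓩 → ℝ} :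
    Integrable g (law μ f θ₀) ↔ Integrable (fun z => g z * f z θ₀) μ := by
  rw [law, integrable_withDensity_iff_integrable_smul₀'
    (hreg.aemeasurable_density hreg.center_mem).ennreal_ofReal (ae_of_all _ fun z => by simp)]
  refine integrable_congr (ae_of_all _ fun z => ?_)
  simp [ENNReal.toReal_ofReal (hreg.density_pos θ₀ hreg.center_mem z).le, mul_comm]

lemma integral_law (g : 𝓩 → ℝ) : ∫ z, g z ∂(law μ f θ₀) = ∫ z, g z * f z θ₀ ∂μ := by
  rw [law, integral_withDensity_eq_integral_toReal_smul₀
    (hreg.aemeasurable_density hreg.center_mem).ennreal_ofReal (ae_of_all _ fun z => by simp)]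
  refine integral_congr_ae (ae_of_all _ fun z => ?_)
  simp [ENNReal.toReal_ofReal (hreg.density_pos θ₀ hreg.center_mem z).le, mul_comm]

lemma memLp_envelope : MemLp M 16 (law μ f θ₀) := by
  have := hreg.isProbabilityMeasure_law
  obtain ⟨q, hq, hM⟩ := hreg.moment
  refine hM.mono_exponent ?_
  rw [show (16 : ℝ≥0∞) = ENNReal.ofReal 16 by norm_num]
  exact ENNReal.ofReal_le_ofReal hq.le

lemma memLp_logLikDeriv {m : ℕ} (hm : m ≤ 7) {θ : ℝ} (hθ : θ ∈ Θ) :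
    MemLp (fun z => logLikDeriv f Θ m z θ) 16 (law μ f θ₀) :=
  hreg.memLp_envelope.mono (aemeasurable_law (hreg.measurable θ hθ m hm)).aestronglyMeasurable
    (ae_of_all _ fun z => (hreg.envelope m hm θ hθ z).trans (le_abs_self _))

lemma hasDerivAt_logLikDeriv {m : ℕ} (hm : m ≤ 6) {θ : ℝ} (hθ : θ ∈ _root_.interior Θ) (z : 𝓩) :
    HasDerivAt (logLikDeriv f Θ m z) (logLikDeriv f Θ (m + 1) z θ) θ := by
  set g : ℝ → ℝ := fun t => Real.log (f z t) with hg
  have heq : ∀ k, ∀ t ∈ _root_.interior Θ, logLikDeriv f Θ k z t = iteratedDeriv k g t := by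
    intro k t ht
    have hs : Θ =ᶠ[𝓝 t] Set.univ := by
      filter_upwards [mem_interior_iff_mem_nhds.1 ht] with x hx
      exact propext ⟨fun _ => trivial, fun _ => hx⟩
    rw [logLikDeriv, iteratedDerivWithin, iteratedFDerivWithin_congr_set hs, iteratedDeriv,
      iteratedFDerivWithin_univ]
  have hcd : ContDiffAt ℝ 7 g θ := (hreg.smooth z).contDiffAt (mem_interior_iff_mem_nhds.1 hθ)
  have hd : DifferentiableAt ℝ (iteratedDeriv m g) θ := by
    have h7 : (m : WithTop ℕ∞) < 7 := by
      have : m < 7 := by omega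
      exact_mod_cast this
    have := hcd.contDiffWithinAt (s := Set.univ) |>.differentiableWithinAt_iteratedDerivWithin h7
      (by simp)
    rw [iteratedDerivWithin_univ] at this
    exact differentiableWithinAt_univ.1 this
  rw [heq _ θ hθ, iteratedDeriv_succ]
  refine hd.hasDerivAt.congr_of_eventuallyEq ?_
  filter_upwards [isOpen_interior.mem_nhds hθ] with t ht using heq m t ht

lemma hasDerivAt_density {θ : ℝ} (hθ : θ ∈ _root_.interior Θ) (z : 𝓩) :
    HasDerivAt (f z) (logLikDeriv f Θ 1 z θ * f z θ) θ := by
  have h := (hreg.hasDerivAt_logLikDeriv (m := 0) (by norm_num) hθ z).exp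
  rw [← hreg.density_eq_exp (interior_subset hθ), mul_comm] at h
  refine h.congr_of_eventuallyEq ?_
  filter_upwards [isOpen_interior.mem_nhds hθ] with t ht
  exact hreg.density_eq_exp (interior_subset ht) z

/-- Differentiation under the integral sign near the true parameter. -/
lemma hasDerivAt_integral {g g' : 𝓩 → ℝ → ℝ} (hdom : DominatedNear μ f θ₀ g)
    (hg : ∀ z, ∀ θ ∈ _root_.interior Θ, HasDerivAt (g z) (g' z θ) θ)
    (hgm : ∀ θ ∈ Θ, AEMeasurable (fun z => g z θ) μ)
    (hgm' : ∀ θ ∈ Θ, AEMeasurable (fun z => g' z θ) μ)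
    (hint : Integrable (fun z => g z θ₀) (law μ f θ₀)) :
    ∀ᶠ θ in 𝓝 θ₀, Integrable (fun z => g z θ * f z θ) μ ∧
      Integrable (fun z => (g' z θ + g z θ * logLikDeriv f Θ 1 z θ) * f z θ) μ ∧
      HasDerivAt (fun t => ∫ z, g z t * f z t ∂μ)
        (∫ z, (g' z θ + g z θ * logLikDeriv f Θ 1 z θ) * f z θ ∂μ) θ := by
  obtain ⟨δ, hδ, G, hG, hGb⟩ := hdom
  obtain ⟨ρ, hρ, hρΘ⟩ := Metric.isOpen_iff.1 isOpen_interior θ₀ hreg.interior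
  set s := Metric.ball θ₀ (min δ ρ) with hs
  have hsΘ : s ⊆ _root_.interior Θ := (Metric.ball_subset_ball (min_le_right _ _)).trans hρΘ
  have hderiv : ∀ z, ∀ θ ∈ s, HasDerivAt (fun t => g z t * f z t)
      ((g' z θ + g z θ * logLikDeriv f Θ 1 z θ) * f z θ) θ := fun z θ hθ => by
    refine ((hg z θ (hsΘ hθ)).mul (hreg.hasDerivAt_density (hsΘ hθ) z)).congr_deriv ?_
    ring
  have hbound : ∀ᵐ z ∂μ, ∀ θ ∈ s,
      ‖(g' z θ + g z θ * logLikDeriv f Θ 1 z θ) * f z θ‖ ≤ G z := by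
    filter_upwards [hGb] with z hz θ hθ
    rw [← (hderiv z θ hθ).deriv]
    refine hz θ ?_
    have := Metric.mem_ball.1 hθ
    rw [Real.dist_eq] at this
    exact this.trans_le (min_le_left _ _)
  have hmeas : ∀ θ ∈ s, AEStronglyMeasurable (fun z => g z θ * f z θ) μ := fun θ hθ =>
    ((hgm θ (interior_subset (hsΘ hθ))).mul
      (hreg.aemeasurable_density (interior_subset (hsΘ hθ)))).aestronglyMeasurable
  have hmeas' : ∀ θ ∈ s, AEStronglyMeasurable
      (fun z => (g' z θ + g z θ * logLikDeriv f Θ 1 z θ) * f z θ) μ := fun θ hθ => by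
    have hΘ := interior_subset (hsΘ hθ)
    exact (((hgm' θ hΘ).add ((hgm θ hΘ).mul (hreg.measurable θ hΘ 1 (by norm_num)))).mul
      (hreg.aemeasurable_density hΘ)).aestronglyMeasurable
  have hcenter : θ₀ ∈ s := Metric.mem_ball_self (lt_min hδ hρ)
  have hint' : ∀ θ ∈ s, Integrable (fun z => g z θ * f z θ) μ := by
    intro θ hθ
    refine ((hreg.integrable_law_iff.1 hint).norm.add (hG.mul_const |θ - θ₀|)).mono'
      (hmeas θ hθ) ?_
    filter_upwards [hbound] with z hz
    have h1 := abs_taylor_zero_le (convex_ball θ₀ (min δ ρ)) (K := G z) (fun t ht => hderiv z t ht)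
      hcenter hθ hz
    have h2 : g z θ * f z θ = g z θ₀ * f z θ₀ + (g z θ * f z θ - g z θ₀ * f z θ₀) := by ring
    rw [h2]
    exact (norm_add_le _ _).trans (add_le_add le_rfl h1)
  filter_upwards [Metric.ball_mem_nhds θ₀ (lt_min hδ hρ)] with θ hθ
  have hn : s ∈ 𝓝 θ := Metric.isOpen_ball.mem_nhds hθ
  refine ⟨hint' θ hθ, ?_⟩
  exact hasDerivAt_integral_of_dominated_loc_of_deriv_le (F := fun t z => g z t * f z t)
    (F' := fun t z => (g' z t + g z t * logLikDeriv f Θ 1 z t) * f z t) hn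
    (by filter_upwards [hn] with t ht using hmeas t ht) (hint' θ hθ) (hmeas' θ hθ) hbound hG
    (ae_of_all _ hderiv)

lemma integrable_logLikDeriv {m : ℕ} (hm : m ≤ 7) :
    Integrable (fun z => logLikDeriv f Θ m z θ₀) (law μ f θ₀) := by
  have := hreg.isProbabilityMeasure_law
  exact (hreg.memLp_logLikDeriv hm hreg.center_mem).integrable (by norm_num)

lemma memLp_logLikDeriv_mul {m k : ℕ} (hm : m ≤ 7) (hk : k ≤ 7) :
    MemLp (fun z => logLikDeriv f Θ m z θ₀ * logLikDeriv f Θ k z θ₀) 8 (law μ f θ₀) :=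
  MemLp.mul_sixteen (hreg.memLp_logLikDeriv hm hreg.center_mem)
    (hreg.memLp_logLikDeriv hk hreg.center_mem)

lemma integrable_logLikDeriv_mul {m k : ℕ} (hm : m ≤ 7) (hk : k ≤ 7) :
    Integrable (fun z => logLikDeriv f Θ m z θ₀ * logLikDeriv f Θ k z θ₀) (law μ f θ₀) := by
  have := hreg.isProbabilityMeasure_law
  exact (hreg.memLp_logLikDeriv_mul hm hk).integrable (by norm_num)

lemma eventually_integral_score :
    ∀ᶠ θ in 𝓝 θ₀, Integrable (fun z => logLikDeriv f Θ 1 z θ * f z θ) μ ∧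
      ∫ z, logLikDeriv f Θ 1 z θ * f z θ ∂μ = 0 := by
  have := hreg.isProbabilityMeasure_law
  have h := hreg.hasDerivAt_integral (g := fun _ _ => 1) (g' := fun _ _ => 0) hreg.dom_one
    (fun z θ _ => hasDerivAt_const θ 1) (fun _ _ => aemeasurable_const)
    (fun _ _ => aemeasurable_const) (integrable_const _)
  filter_upwards [h, isOpen_interior.mem_nhds hreg.interior] with θ hθ hΘ
  obtain ⟨-, h1, h2⟩ := hθ
  simp only [one_mul, zero_add] at h1 h2
  refine ⟨h1, ?_⟩
  have hone : (fun t => ∫ z, f z t ∂μ) =ᶠ[𝓝 θ] fun _ => 1 := by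
    filter_upwards [isOpen_interior.mem_nhds hΘ] with t ht
    have htΘ := interior_subset ht
    rw [integral_eq_lintegral_of_nonneg_ae (ae_of_all _ fun z => (hreg.density_pos t htΘ z).le)
      (hreg.aemeasurable_density htΘ).aestronglyMeasurable, hreg.density_one t htΘ]
    simp
  exact h2.unique ((hasDerivAt_const θ (1 : ℝ)).congr_of_eventuallyEq hone)

lemma integral_score : ∫ z, logLikDeriv f Θ 1 z θ₀ ∂(law μ f θ₀) = 0 := by
  rw [hreg.integral_law]
  exact hreg.eventually_integral_score.self_of_nhds.2

lemma eventually_integral_score' :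
    ∀ᶠ θ in 𝓝 θ₀, ∫ z, (logLikDeriv f Θ 2 z θ
      + logLikDeriv f Θ 1 z θ * logLikDeriv f Θ 1 z θ) * f z θ ∂μ = 0 := by
  have h := hreg.hasDerivAt_integral (g := logLikDeriv f Θ 1) (g' := logLikDeriv f Θ 2)
    hreg.dom_score (fun z θ hθ => hreg.hasDerivAt_logLikDeriv (by norm_num) hθ z)
    (fun θ hθ => hreg.measurable θ hθ 1 (by norm_num))
    (fun θ hθ => hreg.measurable θ hθ 2 (by norm_num))
    (hreg.integrable_logLikDeriv (by norm_num))
  filter_upwards [h, hreg.eventually_integral_score.eventually_nhds] with θ hθ h0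
  exact hθ.2.2.unique
    ((hasDerivAt_const θ (0 : ℝ)).congr_of_eventuallyEq (h0.mono fun t ht => ht.2))

/-- The information equality. -/
lemma integral_score_sq :
    ∫ z, logLikDeriv f Θ 1 z θ₀ * logLikDeriv f Θ 1 z θ₀ ∂(law μ f θ₀) = info μ f Θ θ₀ := by
  have h := hreg.eventually_integral_score'.self_of_nhds
  rw [← hreg.integral_law (fun z => logLikDeriv f Θ 2 z θ₀
    + logLikDeriv f Θ 1 z θ₀ * logLikDeriv f Θ 1 z θ₀), integral_add
    (hreg.integrable_logLikDeriv (by norm_num))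
    (hreg.integrable_logLikDeriv_mul (by norm_num) (by norm_num))] at h
  rw [info]
  linarith

lemma hasDerivAt_integral_score' :
    ∀ᶠ θ in 𝓝 θ₀, Integrable (fun z => logLikDeriv f Θ 2 z θ * f z θ) μ ∧
      Integrable (fun z => (logLikDeriv f Θ 3 z θ
        + logLikDeriv f Θ 2 z θ * logLikDeriv f Θ 1 z θ) * f z θ) μ ∧
      HasDerivAt (fun t => ∫ z, logLikDeriv f Θ 2 z t * f z t ∂μ)
        (∫ z, (logLikDeriv f Θ 3 z θ
          + logLikDeriv f Θ 2 z θ * logLikDeriv f Θ 1 z θ) * f z θ ∂μ) θ :=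
  hreg.hasDerivAt_integral (g := logLikDeriv f Θ 2) (g' := logLikDeriv f Θ 3)
    hreg.dom_score' (fun z θ hθ => hreg.hasDerivAt_logLikDeriv (by norm_num) hθ z)
    (fun θ hθ => hreg.measurable θ hθ 2 (by norm_num))
    (fun θ hθ => hreg.measurable θ hθ 3 (by norm_num))
    (hreg.integrable_logLikDeriv (by norm_num))

/-- The third Bartlett identity. -/
lemma integral_bartlett_three :
    (∫ z, logLikDeriv f Θ 3 z θ₀ ∂(law μ f θ₀))
      + 3 * (∫ z, logLikDeriv f Θ 1 z θ₀ * logLikDeriv f Θ 2 z θ₀ ∂(law μ f θ₀))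
      + ∫ z, logLikDeriv f Θ 1 z θ₀ * logLikDeriv f Θ 1 z θ₀ * logLikDeriv f Θ 1 z θ₀
          ∂(law μ f θ₀) = 0 := by
  have := hreg.isProbabilityMeasure_law
  have h2 := hreg.hasDerivAt_integral_score'
  have h1 := hreg.hasDerivAt_integral (g := fun z θ => logLikDeriv f Θ 1 z θ ^ 2)
    (g' := fun z θ => 2 * (logLikDeriv f Θ 1 z θ * logLikDeriv f Θ 2 z θ))
    hreg.dom_score_sq (fun z θ hθ => by
      refine ((hreg.hasDerivAt_logLikDeriv (m := 1) (by norm_num) hθ z).pow 2).congr_deriv ?_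
      simp; ring)
    (fun θ hθ => (hreg.measurable θ hθ 1 (by norm_num)).pow_const 2)
    (fun θ hθ => ((hreg.measurable θ hθ 1 (by norm_num)).mul
      (hreg.measurable θ hθ 2 (by norm_num))).const_mul 2)
    (by simpa only [pow_two] using hreg.integrable_logLikDeriv_mul (by norm_num) (by norm_num))
  have hz : (fun t => (∫ z, logLikDeriv f Θ 2 z t * f z t ∂μ)
      + ∫ z, logLikDeriv f Θ 1 z t ^ 2 * f z t ∂μ) =ᶠ[𝓝 θ₀] fun _ => 0 := by
    filter_upwards [h1, h2, hreg.eventually_integral_score'] with θ k1 k2 k0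
    rw [← integral_add k2.1 k1.1, ← k0]
    congr 1
    funext z
    ring
  have hd := (h2.self_of_nhds.2.2.add h1.self_of_nhds.2.2).unique
    ((hasDerivAt_const θ₀ (0 : ℝ)).congr_of_eventuallyEq hz)
  rw [← hreg.integral_law (fun z => logLikDeriv f Θ 3 z θ₀
      + logLikDeriv f Θ 2 z θ₀ * logLikDeriv f Θ 1 z θ₀),
    ← hreg.integral_law (fun z => 2 * (logLikDeriv f Θ 1 z θ₀ * logLikDeriv f Θ 2 z θ₀)
      + logLikDeriv f Θ 1 z θ₀ ^ 2 * logLikDeriv f Θ 1 z θ₀)] at hd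
  have i3 := hreg.integrable_logLikDeriv (m := 3) (by norm_num)
  have i12 := hreg.integrable_logLikDeriv_mul (m := 1) (k := 2) (by norm_num) (by norm_num)
  have m1 : MemLp (fun z => logLikDeriv f Θ 1 z θ₀) 4 (law μ f θ₀) :=
    (hreg.memLp_logLikDeriv (by norm_num) hreg.center_mem).mono_exponent (by norm_num)
  have i111 := MemLp.integrable_mul_mul m1 m1 m1
  have e1 : (fun z => logLikDeriv f Θ 3 z θ₀ + logLikDeriv f Θ 2 z θ₀ * logLikDeriv f Θ 1 z θ₀)
      = fun z => logLikDeriv f Θ 3 z θ₀ + logLikDeriv f Θ 1 z θ₀ * logLikDeriv f Θ 2 z θ₀ := by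
    funext z; ring
  have e2 : (fun z => 2 * (logLikDeriv f Θ 1 z θ₀ * logLikDeriv f Θ 2 z θ₀)
      + logLikDeriv f Θ 1 z θ₀ ^ 2 * logLikDeriv f Θ 1 z θ₀)
      = fun z => 2 * (logLikDeriv f Θ 1 z θ₀ * logLikDeriv f Θ 2 z θ₀)
        + logLikDeriv f Θ 1 z θ₀ * logLikDeriv f Θ 1 z θ₀ * logLikDeriv f Θ 1 z θ₀ := by
    funext z; ring
  rw [e1, e2, integral_add i3 i12, integral_add (i12.const_mul 2) i111, integral_const_mul] at hd
  linarith

end RegularityConditions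

end Model

/-! ### Identification and uniform separation of the likelihood -/

section Separation

variable {𝓩 : Type*} [MeasurableSpace 𝓩] {μ : Measure 𝓩} {f : 𝓩 → ℝ → ℝ} {Θ : Set ℝ} {θ₀ : ℝ}
  {M : 𝓩 → ℝ}

namespace RegularityConditions

variable (hreg : RegularityConditions μ f Θ θ₀ M)
include hreg

/-- The Kullback–Leibler divergence of `f (·, θ)` from `f (·, θ₀)` is positive, since
`1 + x < exp x` for `x ≠ 0`. -/
lemma integral_logLik_sub_neg {θ : ℝ} (hθ : θ ∈ Θ) (hne : θ ≠ θ₀) :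
    ∫ z, (Real.log (f z θ) - Real.log (f z θ₀)) ∂(law μ f θ₀) < 0 := by
  have := hreg.isProbabilityMeasure_law
  have h0 := hreg.center_mem
  set D : 𝓩 → ℝ := fun z => Real.log (f z θ) - Real.log (f z θ₀) with hD
  have hl : ∀ t ∈ Θ, Integrable (fun z => Real.log (f z t)) (law μ f θ₀) := fun t ht => by
    have := (hreg.memLp_logLikDeriv (m := 0) (by norm_num) ht).integrable (by norm_num)
    simpa [logLikDeriv] using this
  have hDi : Integrable D (law μ f θ₀) := (hl θ hθ).sub (hl θ₀ h0)
  have hexp : ∀ z, Real.exp (D z) * f z θ₀ = f z θ := fun z => by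
    rw [hD]
    simp only
    rw [Real.exp_sub, Real.exp_log (hreg.density_pos θ hθ z),
      Real.exp_log (hreg.density_pos θ₀ h0 z), div_mul_cancel₀ _ (hreg.density_pos θ₀ h0 z).ne']
  have hfi : Integrable (fun z => f z θ) μ := by
    refine ⟨(hreg.aemeasurable_density hθ).aestronglyMeasurable, ?_⟩
    rw [hasFiniteIntegral_iff_ofReal (ae_of_all _ fun z => (hreg.density_pos θ hθ z).le),
      hreg.density_one θ hθ]
    exact ENNReal.one_lt_top
  have hf1 : ∫ z, f z θ ∂μ = 1 := by
    rw [integral_eq_lintegral_of_nonneg_ae (ae_of_all _ fun z => (hreg.density_pos θ hθ z).le)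
      (hreg.aemeasurable_density hθ).aestronglyMeasurable, hreg.density_one θ hθ]
    simp
  have hEi : Integrable (fun z => Real.exp (D z)) (law μ f θ₀) := by
    rw [hreg.integrable_law_iff]
    simpa only [hexp] using hfi
  have hE : ∫ z, Real.exp (D z) ∂(law μ f θ₀) = 1 := by
    rw [hreg.integral_law]
    simpa only [hexp] using hf1
  have hsum : ∫ z, (Real.exp (D z) - (D z + 1)) ∂(law μ f θ₀) = -∫ z, D z ∂(law μ f θ₀) := by
    rw [integral_sub (g := fun z => D z + 1) hEi (hDi.add (integrable_const _)),
      integral_add hDi (integrable_const _), hE]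
    simp
  have hnn : 0 ≤ fun z => Real.exp (D z) - (D z + 1) := fun z =>
    sub_nonneg.2 (Real.add_one_le_exp _)
  have hge := integral_nonneg (μ := law μ f θ₀) hnn
  rw [hsum] at hge
  refine lt_of_le_of_ne (by linarith) fun heq => hreg.identified θ hθ hne ?_
  rw [heq, neg_zero, integral_eq_zero_iff_of_nonneg hnn
    (hEi.sub (hDi.add (integrable_const _)))] at hsum
  refine hreg.absolutelyContinuous_law.ae_le ?_
  filter_upwards [hsum] with z hz
  have hDz : D z = 0 := by
    by_contra hcon
    have := Real.add_one_lt_exp hcon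
    simp only [Pi.zero_apply] at hz
    linarith
  have := hexp z
  rw [hDz, Real.exp_zero, one_mul] at this
  exact this.symm

lemma continuousOn_logLik (z : 𝓩) : ContinuousOn (fun θ => Real.log (f z θ)) Θ :=
  (hreg.smooth z).continuousOn

/-- Near a wrong parameter `θ` the log-likelihood ratio against `θ₀` is bounded by a single function
with negative mean: the supremum of the ratio over a shrinking neighbourhood of `θ` decreases to the
ratio at `θ`. -/
lemma exists_separation_near {θ : ℝ} (hθ : θ ∈ Θ) (hne : θ ≠ θ₀) :
    ∃ ρ > 0, ∃ h : 𝓩 → ℝ, AEMeasurable h (law μ f θ₀) ∧ (∀ z, |h z| ≤ 2 * M z) ∧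
      ∫ z, h z ∂(law μ f θ₀) < 0 ∧
      ∀ t ∈ Θ, |t - θ| < ρ → ∀ z, Real.log (f z t) - Real.log (f z θ₀) ≤ h z := by
  have := hreg.isProbabilityMeasure_law
  have h0 := hreg.center_mem
  have hlog : ∀ t ∈ Θ, ∀ z, |Real.log (f z t)| ≤ M z := fun t ht z => by
    simpa [logLikDeriv] using hreg.envelope 0 (by norm_num) t ht z
  have hb : ∀ t ∈ Θ, ∀ z, |Real.log (f z t) - Real.log (f z θ₀)| ≤ 2 * M z := fun t ht z => by
    linarith [abs_sub (Real.log (f z t)) (Real.log (f z θ₀)), hlog t ht z, hlog θ₀ h0 z]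
  -- suprema over countable dense subsets are measurable
  have hT : ∀ n : ℕ, ∃ s ⊆ Θ ∩ Metric.ball θ ((n : ℝ) + 1)⁻¹, s.Countable ∧
      Θ ∩ Metric.ball θ ((n : ℝ) + 1)⁻¹ ⊆ closure s := fun n =>
    (TopologicalSpace.IsSeparable.of_separableSpace _).exists_countable_dense_subset
  choose s hsT hsc hsd using hT
  have hmem : ∀ n : ℕ, θ ∈ Θ ∩ Metric.ball θ ((n : ℝ) + 1)⁻¹ := fun n =>
    ⟨hθ, Metric.mem_ball_self (by positivity)⟩
  have hsne : ∀ n, (s n).Nonempty := fun n => closure_nonempty_iff.1 ⟨θ, hsd n (hmem n)⟩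
  have hbdd : ∀ n z, BddAbove (Set.range fun t : s n => Real.log (f z t) - Real.log (f z θ₀)) := by
    rintro n z
    refine ⟨2 * M z, ?_⟩
    rintro _ ⟨t, rfl⟩
    exact (le_abs_self _).trans (hb t (hsT n t.2).1 z)
  set S : ℕ → 𝓩 → ℝ := fun n z => ⨆ t : s n, (Real.log (f z t) - Real.log (f z θ₀)) with hS
  have hSm : ∀ n, AEMeasurable (S n) (law μ f θ₀) := fun n => by
    have := (hsc n).to_subtype
    refine AEMeasurable.iSup fun t => aemeasurable_law ?_
    have hl : ∀ t ∈ Θ, AEMeasurable (fun z => Real.log (f z t)) μ := fun t ht => by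
      simpa [logLikDeriv] using hreg.measurable t ht 0 (by norm_num)
    exact (hl t (hsT n t.2).1).sub (hl θ₀ h0)
  have hSle : ∀ n : ℕ, ∀ t ∈ Θ ∩ Metric.ball θ ((n : ℝ) + 1)⁻¹, ∀ z,
      Real.log (f z t) - Real.log (f z θ₀) ≤ S n z := by
    intro n t ht z
    have hmw := mem_closure_iff_nhdsWithin_neBot.1 (hsd n ht)
    have hcont : Tendsto (fun x => Real.log (f z x) - Real.log (f z θ₀)) (𝓝[s n] t)
        (𝓝 (Real.log (f z t) - Real.log (f z θ₀))) :=
      (((hreg.continuousOn_logLik z) t ht.1).mono_left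
        (nhdsWithin_mono _ ((hsT n).trans Set.inter_subset_left))).sub_const _
    refine le_of_tendsto hcont ?_
    filter_upwards [self_mem_nhdsWithin] with x hx
    exact le_ciSup (hbdd n z) ⟨x, hx⟩
  have hSb : ∀ n z, |S n z| ≤ 2 * M z := by
    intro n z
    have := (hsne n).to_subtype
    refine abs_le.2 ⟨?_, ?_⟩
    · exact (abs_le.1 (hb θ hθ z)).1.trans (hSle n θ (hmem n) z)
    · exact ciSup_le fun t => (le_abs_self _).trans (hb t (hsT n t.2).1 z)
  have hlim : Tendsto (fun n => ∫ z, S n z ∂(law μ f θ₀)) atTop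
      (𝓝 (∫ z, (Real.log (f z θ) - Real.log (f z θ₀)) ∂(law μ f θ₀))) := by
    refine tendsto_integral_of_dominated_convergence (fun z => 2 * M z)
      (fun n => (hSm n).aestronglyMeasurable)
      ((hreg.memLp_envelope.integrable (by norm_num)).const_mul 2)
      (fun n => ae_of_all _ (hSb n)) (ae_of_all _ fun z => ?_)
    rw [Metric.tendsto_atTop]
    intro ε hε
    obtain ⟨δ, hδ, hδe⟩ := Metric.continuousWithinAt_iff.1
      (hreg.continuousOn_logLik z θ hθ) (ε / 2) (half_pos hε)
    obtain ⟨N, hN⟩ := exists_nat_one_div_lt hδ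
    refine ⟨N, fun n hn => ?_⟩
    have := (hsne n).to_subtype
    have h1 := hSle n θ (hmem n) z
    have h2 : S n z ≤ Real.log (f z θ) - Real.log (f z θ₀) + ε / 2 := by
      refine ciSup_le fun t => ?_
      have ht := hsT n t.2
      have h3 : dist (t : ℝ) θ < δ := by
        refine (Metric.mem_ball.1 ht.2).trans_le (le_trans ?_ hN.le)
        rw [one_div]
        gcongr
      have h4 := hδe ht.1 h3
      rw [Real.dist_eq] at h4
      linarith [(abs_lt.1 h4).2]
    rw [Real.dist_eq, abs_lt]
    constructor <;> linarith
  obtain ⟨n, hn⟩ := (hlim.eventually_lt_const (hreg.integral_logLik_sub_neg hθ hne)).exists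
  refine ⟨((n : ℝ) + 1)⁻¹, by positivity, S n, hSm n, hSb n, hn, fun t ht htn z =>
    hSle n t ⟨ht, by rwa [Metric.mem_ball, Real.dist_eq]⟩ z⟩

/-- Wald's argument: outside a neighbourhood of `θ₀` the log-likelihood ratio is bounded by one of
finitely many functions with negative mean. -/
lemma exists_separation {r : ℝ} (hr : 0 < r) :
    ∃ (K : ℕ) (h : Fin K → 𝓩 → ℝ), (∀ k, AEMeasurable (h k) (law μ f θ₀)) ∧
      (∀ k z, |h k z| ≤ 2 * M z) ∧ (∀ k, ∫ z, h k z ∂(law μ f θ₀) < 0) ∧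
      ∀ θ ∈ Θ, r ≤ |θ - θ₀| → ∃ k, ∀ z, Real.log (f z θ) - Real.log (f z θ₀) ≤ h k z := by
  have hne : ∀ θ ∈ Θ \ Metric.ball θ₀ r, θ ≠ θ₀ := by
    rintro θ ⟨-, h⟩ rfl
    exact h (Metric.mem_ball_self hr)
  choose! ρ hρ h hm hb hneg hle using
    fun θ (hθ : θ ∈ Θ \ Metric.ball θ₀ r) => hreg.exists_separation_near hθ.1 (hne θ hθ)
  obtain ⟨t, htΘ, ht⟩ := (hreg.compact.diff Metric.isOpen_ball).elim_nhds_subcover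
    (fun θ => Metric.ball θ (ρ θ)) fun θ hθ => Metric.ball_mem_nhds θ (hρ θ hθ)
  refine ⟨t.card, fun k => h (t.equivFin.symm k), fun k => hm _ (htΘ _ (t.equivFin.symm k).2),
    fun k => hb _ (htΘ _ (t.equivFin.symm k).2), fun k => hneg _ (htΘ _ (t.equivFin.symm k).2),
    fun θ hθ hrθ => ?_⟩
  have hθ' : θ ∈ Θ \ Metric.ball θ₀ r := ⟨hθ, by rw [Metric.mem_ball, Real.dist_eq]; linarith⟩
  obtain ⟨x, hx, hxθ⟩ := Set.mem_iUnion₂.1 (ht hθ')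
  refine ⟨t.equivFin ⟨x, hx⟩, fun z => ?_⟩
  simp only [Equiv.symm_apply_apply]
  exact hle x (htΘ x hx) θ hθ (by rwa [Metric.mem_ball, Real.dist_eq] at hxθ) z

/-- Samples from the model are good with probability tending to one. -/
lemma exists_localModel :
    ∃ (r κ C η B : ℝ) (K : ℕ) (h : Fin K → 𝓩 → ℝ), LocalModel f Θ θ₀ M r κ C h ∧ 0 < η ∧ 0 ≤ B ∧
      ∀ {Ω : Type _} [MeasurableSpace Ω] (Pr : Measure Ω) [IsProbabilityMeasure Pr]
        (Z : ℕ → Ω → 𝓩), IIDSample Pr (law μ f θ₀) Z →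
        ∀ᶠ p in whp Pr, IsGoodSample f Θ θ₀ M κ C η B h (sample Z p.1 p.2) := by
  have hP := hreg.isProbabilityMeasure_law
  have hI := hreg.info_pos
  have hM := hreg.memLp_envelope
  obtain ⟨D, hD⟩ := hreg.compact.isBounded.exists_norm_le
  obtain ⟨ρ, hρ, hρΘ⟩ := Metric.isOpen_iff.1 isOpen_interior θ₀ hreg.interior
  set C : ℝ := |∫ z, M z ∂(law μ f θ₀)| + 2 + 2 * |D| with hC
  have hCp : 0 < C := by positivity
  -- the radius makes the second derivative vary by less than a fraction of the information
  set r : ℝ := min ρ (info μ f Θ θ₀ / (16 * C)) with hr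
  have hrp : 0 < r := lt_min hρ (by positivity)
  have hball : Metric.ball θ₀ r ⊆ _root_.interior Θ :=
    (Metric.ball_subset_ball (min_le_left _ _)).trans hρΘ
  obtain ⟨K, h, hm, hb, hneg, hfar⟩ := hreg.exists_separation hrp
  have hη : ∃ η > 0, η ≤ 1 ∧ η ≤ info μ f Θ θ₀ / 4 ∧ ∀ k, ∫ z, h k z ∂(law μ f θ₀) < -η := by
    have h1 : ∀ᶠ η in 𝓝[>] (0 : ℝ), ∀ k, ∫ z, h k z ∂(law μ f θ₀) < -η := by
      rw [eventually_all]
      intro k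
      have : Tendsto (fun η : ℝ => -η) (𝓝[>] 0) (𝓝 (-0)) :=
        (continuous_neg.tendsto 0).mono_left nhdsWithin_le_nhds
      rw [neg_zero] at this
      exact this.eventually_const_lt (hneg k)
    have h2 : ∀ᶠ η in 𝓝[>] (0 : ℝ), η ≤ min 1 (info μ f Θ θ₀ / 4) :=
      nhdsWithin_le_nhds (Iic_mem_nhds (by positivity))
    obtain ⟨η, ⟨h1, h2⟩, h3⟩ := ((h1.and h2).and self_mem_nhdsWithin).exists
    exact ⟨η, h3, h2.trans (min_le_left _ _), h2.trans (min_le_right _ _), h1⟩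
  obtain ⟨η, hηp, hη1, hηI, hηk⟩ := hη
  have hM2 : MemLp M 2 (law μ f θ₀) := hM.mono_exponent (by norm_num)
  have hM4 : MemLp (fun z => M z ^ 4) 2 (law μ f θ₀) := by
    have h1 := MemLp.mul_sixteen hM hM
    have h2 := MemLp.mul_eight h1 h1
    refine (h2.mono_exponent (by norm_num)).ae_eq (ae_of_all _ fun z => ?_)
    simp only
    ring
  refine ⟨r, info μ f Θ θ₀ / 2, C, η, ∫ z, M z ^ 4 ∂(law μ f θ₀) + 1, K, h, ?_, hηp, ?_, ?_⟩
  · refine ⟨hrp, by positivity, hCp, hball.trans interior_subset,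
      fun z m hm θ hθ => hreg.hasDerivAt_logLikDeriv hm (hball hθ) z, hreg.envelope, ?_, ?_, hfar,
      hb⟩
    · intro θ hθ θ' hθ'
      have h1 := hD θ hθ
      have h2 := hD θ' hθ'
      rw [Real.norm_eq_abs] at h1 h2
      have h3 := abs_sub θ θ'
      have h4 := le_abs_self D
      have h5 := abs_nonneg (∫ z, M z ∂(law μ f θ₀))
      linarith
    · have h1 : r ≤ info μ f Θ θ₀ / (16 * C) := min_le_right _ _
      rw [le_div_iff₀ (by positivity)] at h1
      linarith
  · have : 0 ≤ ∫ z, M z ^ 4 ∂(law μ f θ₀) := integral_nonneg fun z => by positivity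
    linarith
  · intro Ω _ Pr _ Z hZ
    have h1 := (hZ.tendsto_avg hM2).eventually_lt_const (u := C - η) (by
      have := le_abs_self (∫ z, M z ∂(law μ f θ₀))
      have := abs_nonneg D
      linarith)
    have h2 : ∀ᶠ p in whp Pr, ∀ k, avg (sample Z p.1 p.2) (h k) < -η := by
      rw [eventually_all]
      intro k
      refine (hZ.tendsto_avg ?_).eventually_lt_const (hηk k)
      refine (hM2.const_mul 2).mono (hm k).aestronglyMeasurable (ae_of_all _ fun z => ?_)
      exact (hb k z).trans (le_abs_self _)
    have h3 := (hZ.tendsto_avg ((hreg.memLp_logLikDeriv (m := 2) (by norm_num)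
      hreg.center_mem).mono_exponent (by norm_num))).eventually_lt_const
      (u := -(info μ f Θ θ₀ / 2) - η) (by
        have : ∫ z, logLikDeriv f Θ 2 z θ₀ ∂(law μ f θ₀) = -info μ f Θ θ₀ := by
          rw [info, neg_neg]
        rw [this]
        linarith)
    have h4 := (hZ.tendsto_avg hM4).eventually_lt_const (lt_add_one _)
    filter_upwards [h1, h2, h3, h4] with p p1 p2 p3 p4
    exact ⟨p1.le, fun k => (p2 k).le, p3.le, p4.le⟩

end RegularityConditions

end Separation

/-! ### Asymptotically linear statistics -/

section LinearExpansion

lemma normSum_add {𝓩 : Type*} {n : ℕ} (z : Fin n → 𝓩) (g h : 𝓩 → ℝ) :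
    normSum z (fun y => g y + h y) = normSum z g + normSum z h := by
  simp [normSum, Finset.sum_add_distrib, mul_add]

lemma normSum_const_mul {𝓩 : Type*} {n : ℕ} (z : Fin n → 𝓩) (c : ℝ) (h : 𝓩 → ℝ) :
    normSum z (fun y => c * h y) = c * normSum z h := by
  rw [normSum, normSum, ← Finset.mul_sum]
  ring

variable {Ω : Type*} [MeasurableSpace Ω] {Pr : Measure Ω} {𝓩 : Type*} [MeasurableSpace 𝓩]
  {P : Measure 𝓩} {Z : ℕ → Ω → 𝓩} {ψ : 𝓩 → ℝ}

lemma sqrt_pos_whp : ∀ᶠ p in whp Pr, 0 < Real.sqrt p.1 := by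
  filter_upwards [tendsto_fst_whp.eventually (eventually_gt_atTop 0)] with p hp
  exact Real.sqrt_pos.2 (Nat.cast_pos.2 hp)

lemma OpOne.isLittleO {A B : ℕ × Ω → ℝ} (hB : OpOne Pr B) (h : A =o[whp Pr] B) :
    Tendsto A (whp Pr) (𝓝 0) := by
  obtain ⟨u, hu, hA⟩ := isLittleO_iff_exists_eq_mul.1 h
  exact (hB u hu).congr' hA.symm

/-- A statistic `A` is asymptotically linear: `√n (A - a)` is a normalized sum of an influence
function `φ`, up to a term that tends to zero in probability. The number `κ` is the asymptotic
covariance of `√n (A - a)` with the normalized sum of `ψ`. -/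
def LinExp (Pr : Measure Ω) (P : Measure 𝓩) (Z : ℕ → Ω → 𝓩) (ψ : 𝓩 → ℝ) (A : ℕ × Ω → ℝ)
    (a κ : ℝ) : Prop :=
  ∃ φ : 𝓩 → ℝ, MemLp φ 4 P ∧ ∫ z, φ z ∂P = 0 ∧ ∫ z, ψ z * φ z ∂P = κ ∧
    Tendsto (fun p => Real.sqrt p.1 * (A p - a) - normSum (sample Z p.1 p.2) φ) (whp Pr) (𝓝 0)

namespace LinExp

variable {A B : ℕ × Ω → ℝ} {a b κ κ' : ℝ}

lemma congr (hA : LinExp Pr P Z ψ A a κ) (hAB : ∀ᶠ p in whp Pr, B p = A p) (hb : b = a)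
    (hκ : κ' = κ) : LinExp Pr P Z ψ B b κ' := by
  subst hb hκ
  obtain ⟨φ, h1, h2, h3, h4⟩ := hA
  refine ⟨φ, h1, h2, h3, h4.congr' ?_⟩
  filter_upwards [hAB] with p hp
  rw [hp]

lemma const_mul (c : ℝ) (hA : LinExp Pr P Z ψ A a κ) :
    LinExp Pr P Z ψ (fun p => c * A p) (c * a) (c * κ) := by
  obtain ⟨φ, h1, h2, h3, h4⟩ := hA
  refine ⟨fun z => c * φ z, h1.const_mul c, ?_, ?_, ?_⟩
  · rw [integral_const_mul, h2, mul_zero]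
  · simp only [mul_left_comm (ψ _)]
    rw [integral_const_mul, h3]
  · refine ((h4.const_mul c).congr fun p => ?_).trans (by simp)
    rw [normSum_const_mul]
    ring

variable [IsProbabilityMeasure P]

lemma add (hψ : MemLp ψ 4 P) (hA : LinExp Pr P Z ψ A a κ) (hB : LinExp Pr P Z ψ B b κ') :
    LinExp Pr P Z ψ (fun p => A p + B p) (a + b) (κ + κ') := by
  obtain ⟨φ, h1, h2, h3, h4⟩ := hA
  obtain ⟨φ', h1', h2', h3', h4'⟩ := hB
  refine ⟨fun z => φ z + φ' z, h1.add h1', ?_, ?_, ?_⟩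
  · rw [integral_add (h1.integrable (by norm_num)) (h1'.integrable (by norm_num)), h2, h2']
    simp
  · simp only [mul_add]
    rw [integral_add (MemLp.integrable_mul_four hψ h1) (MemLp.integrable_mul_four hψ h1'), h3, h3']
  · refine ((h4.add h4').congr fun p => ?_).trans (by simp)
    rw [normSum_add]
    ring

variable [IsProbabilityMeasure Pr] (hZ : IIDSample Pr P Z)
include hZ

lemma opOne (hA : LinExp Pr P Z ψ A a κ) : OpOne Pr fun p => Real.sqrt p.1 * (A p - a) := by
  obtain ⟨φ, h1, h2, -, h4⟩ := hA
  have := (OpOne.of_tendsto h4).add (hZ.opOne_normSum (h1.mono_exponent (by norm_num)) h2)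
  simpa using this

lemma tendsto (hA : LinExp Pr P Z ψ A a κ) : Tendsto A (whp Pr) (𝓝 a) := by
  have h := (hA.opOne hZ _ tendsto_inv_sqrt_whp).add_const a
  rw [zero_add] at h
  refine h.congr' ?_
  filter_upwards [sqrt_pos_whp] with p hp
  field_simp
  ring

lemma mul (hψ : MemLp ψ 4 P) (hA : LinExp Pr P Z ψ A a κ) (hB : LinExp Pr P Z ψ B b κ') :
    LinExp Pr P Z ψ (fun p => A p * B p) (a * b) (b * κ + a * κ') := by
  have hAO := hA.opOne hZ
  have hB0 : Tendsto (fun p => B p - b) (whp Pr) (𝓝 0) := by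
    simpa using (hB.tendsto hZ).sub_const b
  obtain ⟨φ, h1, h2, h3, h4⟩ := (hA.const_mul b).add hψ (hB.const_mul a)
  refine ⟨φ, h1, h2, h3, ?_⟩
  refine ((h4.add (hAO _ hB0)).congr fun p => ?_).trans (by simp)
  ring

lemma inv (hA : LinExp Pr P Z ψ A a κ) (ha : a ≠ 0) :
    LinExp Pr P Z ψ (fun p => (A p)⁻¹) a⁻¹ (-(a ^ 2)⁻¹ * κ) := by
  have hAO := hA.opOne hZ
  have hAt := hA.tendsto hZ
  have hA0 : Tendsto (fun p => (a ^ 2)⁻¹ - (A p * a)⁻¹) (whp Pr) (𝓝 0) := by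
    have := ((hAt.mul_const a).inv₀ (mul_self_ne_zero.2 ha)).const_sub (a ^ 2)⁻¹
    rwa [← pow_two, sub_self] at this
  obtain ⟨φ, h1, h2, h3, h4⟩ := hA.const_mul (-(a ^ 2)⁻¹)
  refine ⟨φ, h1, h2, h3, ?_⟩
  have h5 := h4.add (hAO _ hA0)
  rw [add_zero] at h5
  refine h5.congr' ?_
  filter_upwards [hAt.eventually_ne ha] with p hp
  field_simp
  ring

end LinExp

variable [IsProbabilityMeasure P] [IsProbabilityMeasure Pr] {est : Estimator 𝓩} {θ₀ : ℝ}

/-- The delta method. -/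
lemma LinExp.comp_hasDerivAt {σ : ℝ} (hZ : IIDSample Pr P Z) {F : ℝ → ℝ} {D : ℝ}
    (hF : HasDerivAt F D θ₀) {T : ℕ × Ω → ℝ} (hT : LinExp Pr P Z ψ T θ₀ σ) :
    LinExp Pr P Z ψ (fun p => F (T p)) (F θ₀) (D * σ) := by
  have hO := hT.opOne hZ
  have h0 := (hasDerivAt_iff_isLittleO.1 hF).comp_tendsto (hT.tendsto hZ)
  have h1 : Tendsto (fun p => Real.sqrt p.1 * (F (T p) - F θ₀ - (T p - θ₀) * D)) (whp Pr) (𝓝 0) :=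
    hO.isLittleO ((isBigO_refl (fun p : ℕ × Ω => Real.sqrt p.1) (whp Pr)).mul_isLittleO h0)
  obtain ⟨φ, k1, k2, k3, k4⟩ := hT.const_mul D
  refine ⟨φ, k1, k2, k3, ((h1.add k4).congr fun p => ?_).trans (by simp)⟩
  ring

/-- An average of functions of the estimated parameter is asymptotically linear. -/
lemma LinExp.avg_estimate {σ : ℝ} (hZ : IIDSample Pr P Z) (hψ : MemLp ψ 4 P) {T : ℕ × Ω → ℝ}
    (hT : LinExp Pr P Z ψ T θ₀ σ) {g g' g'' : 𝓩 → ℝ → ℝ} {G : 𝓩 → ℝ} {s : Set ℝ}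
    (hs : Convex ℝ s) (hs0 : s ∈ 𝓝 θ₀)
    (hg : ∀ z, ∀ θ ∈ s, HasDerivAt (g z) (g' z θ) θ)
    (hg' : ∀ z, ∀ θ ∈ s, HasDerivAt (g' z) (g'' z θ) θ)
    (hG : ∀ z, ∀ θ ∈ s, |g'' z θ| ≤ G z) (hGm : MemLp G 2 P)
    (hm : MemLp (fun z => g z θ₀) 4 P) (hm' : MemLp (fun z => g' z θ₀) 2 P) :
    LinExp Pr P Z ψ (fun p => avg (sample Z p.1 p.2) fun y => g y (T p)) (∫ z, g z θ₀ ∂P)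
      ((∫ z, ψ z * (g z θ₀ - ∫ y, g y θ₀ ∂P) ∂P) + (∫ z, g' z θ₀ ∂P) * σ) := by
  have hO := hT.opOne hZ
  have hTt := hT.tendsto hZ
  -- the average at the true parameter and the effect of estimating it
  have h1 : LinExp Pr P Z ψ (fun p => avg (sample Z p.1 p.2) fun y => g y θ₀) (∫ z, g z θ₀ ∂P)
      (∫ z, ψ z * (g z θ₀ - ∫ y, g y θ₀ ∂P) ∂P) := by
    refine ⟨fun z => g z θ₀ - ∫ y, g y θ₀ ∂P, hm.sub (memLp_const _), ?_, rfl, ?_⟩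
    · rw [integral_sub (hm.integrable (by norm_num)) (integrable_const _)]
      simp
    · simp [sqrt_mul_avg_sub, tendsto_const_nhds]
  obtain ⟨φ, k1, k2, k3, k4⟩ := h1.add hψ (hT.const_mul (∫ z, g' z θ₀ ∂P))
  refine ⟨φ, k1, k2, k3, ?_⟩
  have h2 : Tendsto (fun p => (avg (sample Z p.1 p.2) (fun y => g' y θ₀) - ∫ z, g' z θ₀ ∂P)
      * (Real.sqrt p.1 * (T p - θ₀))) (whp Pr) (𝓝 0) :=
    hO _ (by simpa using (hZ.tendsto_avg hm').sub_const (∫ z, g' z θ₀ ∂P))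
  have h3 : Tendsto (fun p => Real.sqrt p.1 * (avg (sample Z p.1 p.2) (fun y => g y (T p))
      - (avg (sample Z p.1 p.2) (fun y => g y θ₀)
        + avg (sample Z p.1 p.2) (fun y => g' y θ₀) * (T p - θ₀)))) (whp Pr) (𝓝 0) := by
    have hb := ((OpOne.of_tendsto (hZ.tendsto_avg hGm)).mul (hO.pow 2)) _ tendsto_inv_sqrt_whp
    refine squeeze_zero_norm' ?_ (tendsto_zero_iff_norm_tendsto_zero.1 hb)
    filter_upwards [hTt hs0, sqrt_pos_whp] with p hp hp0
    have ht := abs_taylor_one_le hs (K := avg (sample Z p.1 p.2) G)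
      (g₀ := fun t => avg (sample Z p.1 p.2) fun y => g y t)
      (g₁ := fun t => avg (sample Z p.1 p.2) fun y => g' y t)
      (g₂ := fun t => avg (sample Z p.1 p.2) fun y => g'' y t)
      (fun t ht => hasDerivAt_avg _ fun y => hg y t ht)
      (fun t ht => hasDerivAt_avg _ fun y => hg' y t ht) (mem_of_mem_nhds hs0) hp
      (fun t ht => abs_avg_le _ fun y => hG y t ht)
    rw [norm_mul, Real.norm_of_nonneg hp0.le, Real.norm_eq_abs, Real.norm_eq_abs]
    refine (mul_le_mul_of_nonneg_left ht hp0.le).trans (le_trans (le_of_eq ?_) (le_abs_self _))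
    rw [sq_abs]
    field_simp
  refine (((k4.add h2).add h3).congr fun p => ?_).trans (by simp)
  ring

end LinearExpansion

/-! ### Expansion of the maximum likelihood estimator -/

section Estimate

variable {𝓩 : Type*} [MeasurableSpace 𝓩] {μ : Measure 𝓩} {f : 𝓩 → ℝ → ℝ} {Θ : Set ℝ} {θ₀ : ℝ}
  {M : 𝓩 → ℝ}

/-- `𝓠₂ = E[∂³ℓ(Z, θ₀)/∂θ³]`. -/
def Q₂ (μ : Measure 𝓩) (f : 𝓩 → ℝ → ℝ) (Θ : Set ℝ) (θ₀ : ℝ) : ℝ :=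
  ∫ z, logLikDeriv f Θ 4 z θ₀ ∂(law μ f θ₀)

/-- `W(z) = ℓ^θθ(z, θ₀) - E[ℓ^θθ(Z, θ₀)]`. -/
def W (μ : Measure 𝓩) (f : 𝓩 → ℝ → ℝ) (Θ : Set ℝ) (θ₀ : ℝ) (z : 𝓩) : ℝ :=
  score'' f Θ z θ₀ - Q₁ μ f Θ θ₀

/-- The third-order term of the expansion of `√n (θhat - θ₀)`, as a function of the normalized sums
`x, y, v, w` of `X, Y, V, W`. -/
def cubicTerm (μ : Measure 𝓩) (f : 𝓩 → ℝ → ℝ) (Θ : Set ℝ) (θ₀ x y v w : ℝ) : ℝ :=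
  (info μ f Θ θ₀)⁻¹ * (v * (x * y) + w * x ^ 2 / 2 + Q₁ μ f Θ θ₀ * x * (x * y)
    + Q₂ μ f Θ θ₀ * x ^ 3 / 6)

namespace RegularityConditions

variable (hreg : RegularityConditions μ f Θ θ₀ M)
include hreg

lemma memLp_logLikDeriv_sub {m : ℕ} (hm : m ≤ 7) (c : ℝ) :
    MemLp (fun z => logLikDeriv f Θ m z θ₀ - c) 16 (law μ f θ₀) := by
  have := hreg.isProbabilityMeasure_law
  exact (hreg.memLp_logLikDeriv hm hreg.center_mem).sub (memLp_const c)

lemma integral_logLikDeriv_sub {m : ℕ} (hm : m ≤ 7) :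
    ∫ z, (logLikDeriv f Θ m z θ₀ - ∫ y, logLikDeriv f Θ m y θ₀ ∂(law μ f θ₀)) ∂(law μ f θ₀)
      = 0 := by
  have := hreg.isProbabilityMeasure_law
  rw [integral_sub (hreg.integrable_logLikDeriv hm) (integrable_const _)]
  simp

lemma memLp_U : MemLp (U f Θ θ₀) 16 (law μ f θ₀) :=
  hreg.memLp_logLikDeriv (by norm_num) hreg.center_mem

lemma memLp_V : MemLp (V μ f Θ θ₀) 16 (law μ f θ₀) :=
  hreg.memLp_logLikDeriv_sub (by norm_num) _

lemma memLp_W : MemLp (W μ f Θ θ₀) 16 (law μ f θ₀) :=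
  hreg.memLp_logLikDeriv_sub (by norm_num) _

lemma memLp_X : MemLp (X μ f Θ θ₀) 16 (law μ f θ₀) := hreg.memLp_U.const_mul _

lemma memLp_Y : MemLp (Y μ f Θ θ₀) 16 (law μ f θ₀) :=
  (hreg.memLp_U.const_mul _).add (hreg.memLp_V.const_mul _)

lemma integral_V : ∫ z, V μ f Θ θ₀ z ∂(law μ f θ₀) = 0 :=
  hreg.integral_logLikDeriv_sub (m := 2) (by norm_num)

lemma integral_W : ∫ z, W μ f Θ θ₀ z ∂(law μ f θ₀) = 0 :=
  hreg.integral_logLikDeriv_sub (m := 3) (by norm_num)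

lemma integral_X : ∫ z, X μ f Θ θ₀ z ∂(law μ f θ₀) = 0 := by
  simp only [X, U]
  rw [integral_const_mul, hreg.integral_score, mul_zero]

lemma integral_Y : ∫ z, Y μ f Θ θ₀ z ∂(law μ f θ₀) = 0 := by
  have := hreg.isProbabilityMeasure_law
  simp only [Y]
  rw [integral_add ((hreg.memLp_U.const_mul _).integrable (by norm_num))
    ((hreg.memLp_V.const_mul _).integrable (by norm_num)), integral_const_mul, integral_const_mul,
    hreg.integral_V]
  simp only [U]
  rw [hreg.integral_score]
  simp

variable {Ω : Type*} [MeasurableSpace Ω] {Pr : Measure Ω} [IsProbabilityMeasure Pr]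
  {Z : ℕ → Ω → 𝓩} (hZ : IIDSample Pr (law μ f θ₀) Z) {θhat : Estimator 𝓩} (hθ : IsMLE f Θ θhat)
include hZ

lemma opOne_normSum {h : 𝓩 → ℝ} (hh : MemLp h 16 (law μ f θ₀))
    (h0 : ∫ z, h z ∂(law μ f θ₀) = 0) : OpOne Pr fun p => normSum (sample Z p.1 p.2) h := by
  have := hreg.isProbabilityMeasure_law
  exact hZ.opOne_normSum (hh.mono_exponent (by norm_num)) h0

include hθ

/-- Third-order expansion of the maximum likelihood estimator about the true parameter. -/
lemma tendsto_mle_remainder :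
    Tendsto (fun p : ℕ × Ω => (p.1 : ℝ) * (Real.sqrt p.1 * (θhat p.1 (sample Z p.1 p.2) - θ₀)
      - (normSum (sample Z p.1 p.2) (X μ f Θ θ₀)
        + normSum (sample Z p.1 p.2) (X μ f Θ θ₀) * normSum (sample Z p.1 p.2) (Y μ f Θ θ₀)
          / Real.sqrt p.1
        + cubicTerm μ f Θ θ₀ (normSum (sample Z p.1 p.2) (X μ f Θ θ₀))
          (normSum (sample Z p.1 p.2) (Y μ f Θ θ₀)) (normSum (sample Z p.1 p.2) (V μ f Θ θ₀))
          (normSum (sample Z p.1 p.2) (W μ f Θ θ₀)) / p.1))) (whp Pr) (𝓝 0) := by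
  have hP := hreg.isProbabilityMeasure_law
  obtain ⟨r, κ, C, η, B, K, h, hL, hη, -, hgood⟩ := hreg.exists_localModel
  have hloc : ∀ᶠ p in whp Pr, IsLocalSample f Θ θ₀ M κ C h (sample Z p.1 p.2) :=
    (hgood Pr Z hZ).mono fun p hp => hp.isLocalSample hη
  have hI := hreg.info_pos
  set I := info μ f Θ θ₀ with hI_def
  set R : 𝓩 → ℝ := fun z => logLikDeriv f Θ 4 z θ₀ - Q₂ μ f Θ θ₀ with hR
  set u := fun p : ℕ × Ω => normSum (sample Z p.1 p.2) (U f Θ θ₀) with hu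
  set v := fun p : ℕ × Ω => normSum (sample Z p.1 p.2) (V μ f Θ θ₀) with hv
  set w := fun p : ℕ × Ω => normSum (sample Z p.1 p.2) (W μ f Θ θ₀) with hw
  set q := fun p : ℕ × Ω => normSum (sample Z p.1 p.2) R with hq
  set N := fun p : ℕ × Ω => |u p| + |v p| + |w p| + |q p| with hN
  set s := fun p : ℕ × Ω => (Real.sqrt p.1)⁻¹ with hs
  have hs0 : ∀ p, 0 ≤ s p := fun p => by positivity
  have hNO : OpOne Pr N :=
    (((hreg.opOne_normSum hZ hreg.memLp_U hreg.integral_score).abs.add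
      (hreg.opOne_normSum hZ hreg.memLp_V hreg.integral_V).abs).add
      (hreg.opOne_normSum hZ hreg.memLp_W hreg.integral_W).abs).add
      (hreg.opOne_normSum hZ (hreg.memLp_logLikDeriv_sub (m := 4) (by norm_num) _)
        (hreg.integral_logLikDeriv_sub (by norm_num))).abs
  have havg : ∀ᶠ p in whp Pr, ∀ m c, avg (sample Z p.1 p.2) (fun y => logLikDeriv f Θ m y θ₀) - c
      = s p * normSum (sample Z p.1 p.2) fun y => logLikDeriv f Θ m y θ₀ - c := by
    filter_upwards [sqrt_pos_whp] with p hp m c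
    rw [← sqrt_mul_avg_sub, hs]
    field_simp
  have hbig : ∀ {a : ℕ × Ω → ℝ}, (∀ p, |a p| ≤ N p) →
      (fun p => s p * a p) =O[whp Pr] fun p => (s p * N p) ^ 1 := fun {a} ha => by
    refine IsBigO.of_bound 1 (Eventually.of_forall fun p => ?_)
    rw [pow_one, one_mul, Real.norm_eq_abs, Real.norm_eq_abs, abs_mul, abs_mul]
    exact mul_le_mul_of_nonneg_left ((ha p).trans (le_abs_self _)) (abs_nonneg _)
  have hu' : ∀ p, |u p| ≤ N p := fun p => by
    linarith [abs_nonneg (v p), abs_nonneg (w p), abs_nonneg (q p)]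
  have hv' : ∀ p, |v p| ≤ N p := fun p => by
    linarith [abs_nonneg (u p), abs_nonneg (w p), abs_nonneg (q p)]
  have hw' : ∀ p, |w p| ≤ N p := fun p => by
    linarith [abs_nonneg (v p), abs_nonneg (u p), abs_nonneg (q p)]
  have hq' : ∀ p, |q p| ≤ N p := fun p => by
    linarith [abs_nonneg (v p), abs_nonneg (w p), abs_nonneg (u p)]
  have hconst : ∀ c : ℝ, (fun _ : ℕ × Ω => c) =O[whp Pr] fun p => (s p * N p) ^ 0 := fun c => by
    simpa using isBigO_const_const c (one_ne_zero (α := ℝ)) (whp Pr)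
  have hc1 : ∀ᶠ p in whp Pr,
      avg (sample Z p.1 p.2) (fun y => logLikDeriv f Θ 1 y θ₀) = s p * u p := by
    filter_upwards [havg] with p hp
    have := hp 1 0
    simp only [sub_zero] at this
    exact this
  have hδ : (fun p : ℕ × Ω => θhat p.1 (sample Z p.1 p.2) - θ₀)
      =O[whp Pr] fun p => (s p * N p) ^ 1 := by
    refine IsBigO.trans (IsBigO.of_bound (4 / κ) ?_) (hbig hu')
    filter_upwards [hloc, hc1] with p hp h1
    have := hp.abs_sub_le hL hθ (Metric.mem_ball_self hL.r_pos)
    rwa [h1] at this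
  have hroot := root_expansion (l := whp Pr) (ε := fun p => s p * N p)
    (J := fun _ => -I) (K₃ := fun _ => Q₁ μ f Θ θ₀)
    (K₄ := fun _ => Q₂ μ f Θ θ₀) (c₁ := fun p => s p * u p) (e₂ := fun p => s p * v p)
    (e₃ := fun p => s p * w p) (e₄ := fun p => s p * q p)
    (δ := fun p => θhat p.1 (sample Z p.1 p.2) - θ₀)
    (r := fun p => 0 - (avg (sample Z p.1 p.2) (fun y => logLikDeriv f Θ 1 y θ₀)
      + avg (sample Z p.1 p.2) (fun y => logLikDeriv f Θ 2 y θ₀)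
        * (θhat p.1 (sample Z p.1 p.2) - θ₀)
      + avg (sample Z p.1 p.2) (fun y => logLikDeriv f Θ 3 y θ₀)
        * (θhat p.1 (sample Z p.1 p.2) - θ₀) ^ 2 / 2
      + avg (sample Z p.1 p.2) (fun y => logLikDeriv f Θ 4 y θ₀)
        * (θhat p.1 (sample Z p.1 p.2) - θ₀) ^ 3 / 6))
    ((hNO _ tendsto_inv_sqrt_whp).isBigO_one ℝ)
    (Eventually.of_forall fun _ => by simpa using hI.ne')
    (hconst _) (hconst _) (hconst _) (hbig hu') (hbig hv') (hbig hw') (hbig hq') hδ ?_ ?_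
  · -- the remainder is of order `n^{-2}`
    have h0 : Tendsto (fun p : ℕ × Ω => (p.1 : ℝ) * Real.sqrt p.1 * (s p * N p) ^ 4) (whp Pr)
        (𝓝 0) := by
      refine (hNO.pow 4 _ tendsto_inv_sqrt_whp).congr' ?_
      filter_upwards [sqrt_pos_whp] with p hp
      have h2 : (p.1 : ℝ) = Real.sqrt p.1 ^ 2 := (Real.sq_sqrt (Nat.cast_nonneg _)).symm
      rw [hs]
      simp only
      generalize Real.sqrt p.1 = t at *
      rw [h2]
      field_simp
    refine (((isBigO_refl (fun p : ℕ × Ω => (p.1 : ℝ) * Real.sqrt p.1) (whp Pr)).mul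
      hroot).trans_tendsto h0).congr' ?_
    filter_upwards [sqrt_pos_whp] with p hp
    have h2 : (p.1 : ℝ) = Real.sqrt p.1 ^ 2 := (Real.sq_sqrt (Nat.cast_nonneg _)).symm
    have hx : normSum (sample Z p.1 p.2) (X μ f Θ θ₀) = I⁻¹ * u p := normSum_const_mul _ _ _
    have hy : normSum (sample Z p.1 p.2) (Y μ f Θ θ₀)
        = 1 / 2 * I⁻¹ ^ 2 * Q₁ μ f Θ θ₀ * u p + I⁻¹ * v p := by
      rw [hu, hv]
      simp only
      rw [← normSum_const_mul, ← normSum_const_mul, ← normSum_add]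
      rfl
    have hv1 : normSum (sample Z p.1 p.2) (V μ f Θ θ₀) = v p := rfl
    have hw1 : normSum (sample Z p.1 p.2) (W μ f Θ θ₀) = w p := rfl
    have hs1 : s p = (Real.sqrt p.1)⁻¹ := rfl
    rw [hx, hy, hv1, hw1, hs1, cubicTerm, ← hI_def]
    simp only [rootLin, rootSlope, rootCubic]
    generalize Real.sqrt p.1 = t at *
    rw [h2]
    field_simp
  · refine IsBigO.trans (IsBigO.of_bound C ?_) ((hδ.pow 4).congr_right fun p => by rw [pow_one])
    filter_upwards [hloc] with p hp
    simpa using hp.score_taylor hL hθ (Metric.mem_ball_self hL.r_pos)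
  · filter_upwards [hc1, havg] with p h1 hp
    have e2 : avg (sample Z p.1 p.2) (fun y => logLikDeriv f Θ 2 y θ₀) = -I + s p * v p := by
      have := hp 2 (∫ y, logLikDeriv f Θ 2 y θ₀ ∂(law μ f θ₀))
      have h3 : s p * v p = _ := this.symm
      rw [h3, hI_def, info]
      ring
    have e3 : avg (sample Z p.1 p.2) (fun y => logLikDeriv f Θ 3 y θ₀)
        = Q₁ μ f Θ θ₀ + s p * w p := by
      have h3 : s p * w p = _ := (hp 3 (Q₁ μ f Θ θ₀)).symm
      rw [h3]
      ring
    have e4 : avg (sample Z p.1 p.2) (fun y => logLikDeriv f Θ 4 y θ₀)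
        = Q₂ μ f Θ θ₀ + s p * q p := by
      have h3 : s p * q p = _ := (hp 4 (Q₂ μ f Θ θ₀)).symm
      rw [h3]
      ring
    rw [h1, e2, e3, e4]
    ring

end RegularityConditions

end Estimate

/-! ### Conditions on an estimate of the bias -/

section Bias

variable {𝓩 : Type*} [MeasurableSpace 𝓩] {μ : Measure 𝓩} {f : 𝓩 → ℝ → ℝ} {Θ : Set ℝ} {θ₀ : ℝ}
  {M : 𝓩 → ℝ}

/-- The limit of the covariance of the first-order term `x` of the expansion with the cubic term:
the expectation of `x * cubicTerm x y v w` for jointly Gaussian `x, y, v, w` with the covariances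
of `X, Y, V, W`. -/
def cubicCov (μ : Measure 𝓩) (f : 𝓩 → ℝ → ℝ) (Θ : Set ℝ) (θ₀ : ℝ) : ℝ :=
  (info μ f Θ θ₀)⁻¹ *
    ((∫ z, X μ f Θ θ₀ z * X μ f Θ θ₀ z ∂(law μ f θ₀))
        * (∫ z, V μ f Θ θ₀ z * Y μ f Θ θ₀ z ∂(law μ f θ₀))
      + 2 * (∫ z, X μ f Θ θ₀ z * V μ f Θ θ₀ z ∂(law μ f θ₀))
        * (∫ z, X μ f Θ θ₀ z * Y μ f Θ θ₀ z ∂(law μ f θ₀))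
      + 3 / 2 * (∫ z, X μ f Θ θ₀ z * X μ f Θ θ₀ z ∂(law μ f θ₀))
        * (∫ z, X μ f Θ θ₀ z * W μ f Θ θ₀ z ∂(law μ f θ₀))
      + 3 * Q₁ μ f Θ θ₀ * (∫ z, X μ f Θ θ₀ z * X μ f Θ θ₀ z ∂(law μ f θ₀))
        * (∫ z, X μ f Θ θ₀ z * Y μ f Θ θ₀ z ∂(law μ f θ₀))
      + 1 / 2 * Q₂ μ f Θ θ₀ * (∫ z, X μ f Θ θ₀ z * X μ f Θ θ₀ z ∂(law μ f θ₀)) ^ 2)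

/-- `T` estimates `E[XY]`, the limit of `n` times the bias of the maximum likelihood estimator, and
its covariance with the first-order term of the expansion is the one that makes the bias correction
cancel the contributions of `E[X²Y]` and of the cubic term to the higher-order variance. -/
def IsBiasEstimate {Ω : Type*} [MeasurableSpace Ω] (Pr : Measure Ω) (μ : Measure 𝓩)
    (f : 𝓩 → ℝ → ℝ) (Θ : Set ℝ) (θ₀ : ℝ) (Z : ℕ → Ω → 𝓩) (T : ℕ × Ω → ℝ) : Prop :=
  LinExp Pr (law μ f θ₀) Z (X μ f Θ θ₀) T (∫ z, X μ f Θ θ₀ z * Y μ f Θ θ₀ z ∂(law μ f θ₀))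
    ((∫ z, X μ f Θ θ₀ z * X μ f Θ θ₀ z * Y μ f Θ θ₀ z ∂(law μ f θ₀)) + cubicCov μ f Θ θ₀)

/-- `E[∂ᵐlog f ∂ᵏlog f]` at the true parameter. -/
def crossMoment (μ : Measure 𝓩) (f : 𝓩 → ℝ → ℝ) (Θ : Set ℝ) (θ₀ : ℝ) (m k : ℕ) : ℝ :=
  ∫ z, logLikDeriv f Θ m z θ₀ * logLikDeriv f Θ k z θ₀ ∂(law μ f θ₀)

/-- `E[ℓ² ℓ^θ]` at the true parameter. -/
def scoreSqMoment (μ : Measure 𝓩) (f : 𝓩 → ℝ → ℝ) (Θ : Set ℝ) (θ₀ : ℝ) : ℝ :=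
  ∫ z, logLikDeriv f Θ 1 z θ₀ * logLikDeriv f Θ 1 z θ₀ * logLikDeriv f Θ 2 z θ₀ ∂(law μ f θ₀)

lemma V_eq (z : 𝓩) : V μ f Θ θ₀ z = logLikDeriv f Θ 2 z θ₀ + info μ f Θ θ₀ := by
  simp [V, info, sub_eq_add_neg]

namespace RegularityConditions

variable (hreg : RegularityConditions μ f Θ θ₀ M)
include hreg

lemma hasMean_score : HasMean (law μ f θ₀) (fun z => logLikDeriv f Θ 1 z θ₀) 0 :=
  ⟨hreg.integrable_logLikDeriv (by norm_num), hreg.integral_score⟩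

lemma hasMean_mul {m k : ℕ} (hm : m ≤ 7) (hk : k ≤ 7) :
    HasMean (law μ f θ₀) (fun z => logLikDeriv f Θ m z θ₀ * logLikDeriv f Θ k z θ₀)
      (crossMoment μ f Θ θ₀ m k) :=
  ⟨hreg.integrable_logLikDeriv_mul hm hk, rfl⟩

lemma hasMean_score_sq : HasMean (law μ f θ₀)
    (fun z => logLikDeriv f Θ 1 z θ₀ * logLikDeriv f Θ 1 z θ₀) (info μ f Θ θ₀) :=
  ⟨hreg.integrable_logLikDeriv_mul (by norm_num) (by norm_num), hreg.integral_score_sq⟩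

lemma hasMean_score_sq_mul {m : ℕ} (hm : m ≤ 7) : HasMean (law μ f θ₀)
    (fun z => logLikDeriv f Θ 1 z θ₀ * logLikDeriv f Θ 1 z θ₀ * logLikDeriv f Θ m z θ₀)
    (∫ z, logLikDeriv f Θ 1 z θ₀ * logLikDeriv f Θ 1 z θ₀ * logLikDeriv f Θ m z θ₀
      ∂(law μ f θ₀)) := by
  have := hreg.isProbabilityMeasure_law
  have h : ∀ {m : ℕ}, m ≤ 7 → MemLp (fun z => logLikDeriv f Θ m z θ₀) 4 (law μ f θ₀) :=
    fun hm => (hreg.memLp_logLikDeriv hm hreg.center_mem).mono_exponent (by norm_num)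
  exact ⟨MemLp.integrable_mul_mul (h (by norm_num)) (h (by norm_num)) (h hm), rfl⟩

lemma integral_XX : ∫ z, X μ f Θ θ₀ z * X μ f Θ θ₀ z ∂(law μ f θ₀) = (info μ f Θ θ₀)⁻¹ := by
  refine ((hreg.hasMean_score_sq.const_mul ((info μ f Θ θ₀)⁻¹ ^ 2)).congr (fun z => ?_) ?_).2
  · simp only [X, U]; ring
  · have := hreg.info_pos.ne'; field_simp

lemma integral_XY : ∫ z, X μ f Θ θ₀ z * Y μ f Θ θ₀ z ∂(law μ f θ₀)
    = (info μ f Θ θ₀)⁻¹ ^ 2 * (Q₁ μ f Θ θ₀ / 2 + crossMoment μ f Θ θ₀ 1 2) := by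
  refine (((hreg.hasMean_score_sq.const_mul (1 / 2 * (info μ f Θ θ₀)⁻¹ ^ 3 * Q₁ μ f Θ θ₀)).add
    (((hreg.hasMean_mul (m := 1) (k := 2) (by norm_num) (by norm_num)).add
      (hreg.hasMean_score.const_mul (info μ f Θ θ₀))).const_mul ((info μ f Θ θ₀)⁻¹ ^ 2))).congr
      (fun z => ?_) ?_).2
  · simp only [X, Y, U, V_eq]; ring
  · have := hreg.info_pos.ne'; field_simp; ring

lemma integral_XV : ∫ z, X μ f Θ θ₀ z * V μ f Θ θ₀ z ∂(law μ f θ₀)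
    = (info μ f Θ θ₀)⁻¹ * crossMoment μ f Θ θ₀ 1 2 := by
  refine ((((hreg.hasMean_mul (m := 1) (k := 2) (by norm_num) (by norm_num)).add
      (hreg.hasMean_score.const_mul (info μ f Θ θ₀))).const_mul (info μ f Θ θ₀)⁻¹).congr
      (fun z => ?_) ?_).2
  · simp only [X, U, V_eq]; ring
  · ring

lemma integral_VY : ∫ z, V μ f Θ θ₀ z * Y μ f Θ θ₀ z ∂(law μ f θ₀)
    = 1 / 2 * (info μ f Θ θ₀)⁻¹ ^ 2 * Q₁ μ f Θ θ₀ * crossMoment μ f Θ θ₀ 1 2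
      + (info μ f Θ θ₀)⁻¹ * (crossMoment μ f Θ θ₀ 2 2 - info μ f Θ θ₀ ^ 2) := by
  have hP := hreg.isProbabilityMeasure_law
  have h2 : HasMean (law μ f θ₀) (fun z => logLikDeriv f Θ 2 z θ₀) (-info μ f Θ θ₀) :=
    ⟨hreg.integrable_logLikDeriv (by norm_num), by simp [info]⟩
  refine (((((hreg.hasMean_mul (m := 1) (k := 2) (by norm_num) (by norm_num)).add
      (hreg.hasMean_score.const_mul (info μ f Θ θ₀))).const_mul
        (1 / 2 * (info μ f Θ θ₀)⁻¹ ^ 2 * Q₁ μ f Θ θ₀)).add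
    (((hreg.hasMean_mul (m := 2) (k := 2) (by norm_num) (by norm_num)).add
      ((h2.const_mul (2 * info μ f Θ θ₀)).add (HasMean.const (info μ f Θ θ₀ ^ 2)))).const_mul
        (info μ f Θ θ₀)⁻¹)).congr (fun z => ?_) ?_).2
  · simp only [Y, U, V_eq]; ring
  · ring

lemma integral_XW : ∫ z, X μ f Θ θ₀ z * W μ f Θ θ₀ z ∂(law μ f θ₀)
    = (info μ f Θ θ₀)⁻¹ * crossMoment μ f Θ θ₀ 1 3 := by
  refine ((((hreg.hasMean_mul (m := 1) (k := 3) (by norm_num) (by norm_num)).sub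
      (hreg.hasMean_score.const_mul (Q₁ μ f Θ θ₀))).const_mul (info μ f Θ θ₀)⁻¹).congr
      (fun z => ?_) ?_).2
  · simp only [X, U, W]; ring
  · ring

/-- By the third Bartlett identity, `E[ℓ³] = -𝓠₁ - 3 E[ℓ ℓ^θ]`. -/
lemma integral_XXY : ∫ z, X μ f Θ θ₀ z * X μ f Θ θ₀ z * Y μ f Θ θ₀ z ∂(law μ f θ₀)
    = 1 / 2 * (info μ f Θ θ₀)⁻¹ ^ 4 * Q₁ μ f Θ θ₀
        * (-Q₁ μ f Θ θ₀ - 3 * crossMoment μ f Θ θ₀ 1 2)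
      + (info μ f Θ θ₀)⁻¹ ^ 3 * (scoreSqMoment μ f Θ θ₀ + info μ f Θ θ₀ ^ 2) := by
  have h3 := hreg.integral_bartlett_three
  refine ((((hreg.hasMean_score_sq_mul (m := 1) (by norm_num)).const_mul
      (1 / 2 * (info μ f Θ θ₀)⁻¹ ^ 4 * Q₁ μ f Θ θ₀)).add
    (((hreg.hasMean_score_sq_mul (m := 2) (by norm_num)).add
      (hreg.hasMean_score_sq.const_mul (info μ f Θ θ₀))).const_mul ((info μ f Θ θ₀)⁻¹ ^ 3))).congr
      (fun z => ?_) ?_).2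
  · simp only [X, Y, U, V_eq]; ring
  · rw [show (-Q₁ μ f Θ θ₀ - 3 * crossMoment μ f Θ θ₀ 1 2)
      = ∫ z, logLikDeriv f Θ 1 z θ₀ * logLikDeriv f Θ 1 z θ₀ * logLikDeriv f Θ 1 z θ₀
        ∂(law μ f θ₀) by rw [Q₁, crossMoment]; linarith, scoreSqMoment]
    ring

lemma integral_X_mul_sub {h : 𝓩 → ℝ} (hh : MemLp h 4 (law μ f θ₀)) (c : ℝ) :
    ∫ z, X μ f Θ θ₀ z * (h z - c) ∂(law μ f θ₀)
      = (info μ f Θ θ₀)⁻¹ * ∫ z, logLikDeriv f Θ 1 z θ₀ * h z ∂(law μ f θ₀) := by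
  have := hreg.isProbabilityMeasure_law
  have h1 : HasMean (law μ f θ₀) (fun z => logLikDeriv f Θ 1 z θ₀ * h z)
      (∫ z, logLikDeriv f Θ 1 z θ₀ * h z ∂(law μ f θ₀)) :=
    ⟨MemLp.integrable_mul_four (hreg.memLp_U.mono_exponent (by norm_num)) hh, rfl⟩
  refine (((h1.sub (hreg.hasMean_score.const_mul c)).const_mul (info μ f Θ θ₀)⁻¹).congr
      (fun z => ?_) ?_).2
  · simp only [X, U]; ring
  · ring

variable {Ω : Type*} [MeasurableSpace Ω] {Pr : Measure Ω} [IsProbabilityMeasure Pr]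
  {Z : ℕ → Ω → 𝓩} (hZ : IIDSample Pr (law μ f θ₀) Z) {θhat : Estimator 𝓩} (hθ : IsMLE f Θ θhat)
include hZ

/-- The bias formula that does not use the information equality, applied to asymptotically linear
estimates of its ingredients. -/
lemma isBiasEstimate_noInfo {Q S J R : ℕ × Ω → ℝ}
    (hQ : LinExp Pr (law μ f θ₀) Z (X μ f Θ θ₀) Q (Q₁ μ f Θ θ₀)
      ((info μ f Θ θ₀)⁻¹ * (crossMoment μ f Θ θ₀ 1 3 + Q₂ μ f Θ θ₀)))
    (hS : LinExp Pr (law μ f θ₀) Z (X μ f Θ θ₀) S (info μ f Θ θ₀)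
      ((info μ f Θ θ₀)⁻¹ * (-Q₁ μ f Θ θ₀ - crossMoment μ f Θ θ₀ 1 2)))
    (hJ : LinExp Pr (law μ f θ₀) Z (X μ f Θ θ₀) J (-info μ f Θ θ₀)
      ((info μ f Θ θ₀)⁻¹ * (crossMoment μ f Θ θ₀ 1 2 + Q₁ μ f Θ θ₀)))
    (hR : LinExp Pr (law μ f θ₀) Z (X μ f Θ θ₀) R (crossMoment μ f Θ θ₀ 1 2)
      ((info μ f Θ θ₀)⁻¹ * (scoreSqMoment μ f Θ θ₀
        + (crossMoment μ f Θ θ₀ 2 2 + crossMoment μ f Θ θ₀ 1 3)))) :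
    IsBiasEstimate Pr μ f Θ θ₀ Z fun p => -(Q p * S p) / (2 * J p ^ 3) + R p / J p ^ 2 := by
  have hP := hreg.isProbabilityMeasure_law
  have hI := hreg.info_pos.ne'
  have hX : MemLp (X μ f Θ θ₀) 4 (law μ f θ₀) := hreg.memLp_X.mono_exponent (by norm_num)
  have hi := hJ.inv hZ (neg_ne_zero.2 hI)
  have hi2 := hi.mul hZ hX hi
  refine ((((hQ.mul hZ hX hS).mul hZ hX (hi2.mul hZ hX hi)).const_mul (-(1 / 2))).add hX
    (hR.mul hZ hX hi2)).congr (Eventually.of_forall fun p => ?_) ?_ ?_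
  · simp only [div_eq_mul_inv, mul_inv]
    ring
  · rw [hreg.integral_XY]
    field_simp
  · rw [cubicCov, hreg.integral_XXY, hreg.integral_XX, hreg.integral_XY, hreg.integral_XV,
      hreg.integral_VY, hreg.integral_XW]
    field_simp
    ring

/-- The bias formula that uses the information equality, applied to asymptotically linear estimates
of its ingredients. -/
lemma isBiasEstimate_info {Q J R : ℕ × Ω → ℝ}
    (hQ : LinExp Pr (law μ f θ₀) Z (X μ f Θ θ₀) Q (Q₁ μ f Θ θ₀)
      ((info μ f Θ θ₀)⁻¹ * (crossMoment μ f Θ θ₀ 1 3 + Q₂ μ f Θ θ₀)))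
    (hJ : LinExp Pr (law μ f θ₀) Z (X μ f Θ θ₀) J (-info μ f Θ θ₀)
      ((info μ f Θ θ₀)⁻¹ * (crossMoment μ f Θ θ₀ 1 2 + Q₁ μ f Θ θ₀)))
    (hR : LinExp Pr (law μ f θ₀) Z (X μ f Θ θ₀) R (crossMoment μ f Θ θ₀ 1 2)
      ((info μ f Θ θ₀)⁻¹ * (scoreSqMoment μ f Θ θ₀
        + (crossMoment μ f Θ θ₀ 2 2 + crossMoment μ f Θ θ₀ 1 3)))) :
    IsBiasEstimate Pr μ f Θ θ₀ Z fun p => Q p / (2 * J p ^ 2) + R p / J p ^ 2 := by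
  have hP := hreg.isProbabilityMeasure_law
  have hI := hreg.info_pos.ne'
  have hX : MemLp (X μ f Θ θ₀) 4 (law μ f θ₀) := hreg.memLp_X.mono_exponent (by norm_num)
  have hi := hJ.inv hZ (neg_ne_zero.2 hI)
  have hi2 := hi.mul hZ hX hi
  refine (((hQ.mul hZ hX hi2).const_mul (1 / 2)).add hX
    (hR.mul hZ hX hi2)).congr (Eventually.of_forall fun p => ?_) ?_ ?_
  · simp only [div_eq_mul_inv, mul_inv]
    ring
  · rw [hreg.integral_XY]
    field_simp
  · rw [cubicCov, hreg.integral_XXY, hreg.integral_XX, hreg.integral_XY, hreg.integral_XV,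
      hreg.integral_VY, hreg.integral_XW]
    field_simp
    ring

include hθ

lemma linExp_mle : LinExp Pr (law μ f θ₀) Z (X μ f Θ θ₀)
    (fun p => θhat p.1 (sample Z p.1 p.2)) θ₀ (info μ f Θ θ₀)⁻¹ := by
  have hX := hreg.opOne_normSum hZ hreg.memLp_X hreg.integral_X
  have hY := hreg.opOne_normSum hZ hreg.memLp_Y hreg.integral_Y
  have hV := hreg.opOne_normSum hZ hreg.memLp_V hreg.integral_V
  have hW := hreg.opOne_normSum hZ hreg.memLp_W hreg.integral_W
  have hP := hreg.isProbabilityMeasure_law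
  refine ⟨X μ f Θ θ₀, hreg.memLp_X.mono_exponent (by norm_num), hreg.integral_X, hreg.integral_XX,
    ?_⟩
  have hs : Tendsto (fun p : ℕ × Ω => (Real.sqrt p.1)⁻¹ ^ 2) (whp Pr) (𝓝 0) := by
    simpa using tendsto_inv_sqrt_whp.pow 2
  have hc := (OpOne.const (info μ f Θ θ₀)⁻¹).mul ((((hV.mul (hX.mul hY)).add
    ((OpOne.const (1 / 2)).mul (hW.mul (hX.pow 2)))).add
      (((OpOne.const (Q₁ μ f Θ θ₀)).mul hX).mul (hX.mul hY))).add
      ((OpOne.const (Q₂ μ f Θ θ₀ / 6)).mul (hX.pow 3)))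
  have h1 := ((hs.mul (hreg.tendsto_mle_remainder hZ hθ)).add
    ((hX.mul hY) _ tendsto_inv_sqrt_whp)).add (hc _ hs)
  simp only [mul_zero, add_zero] at h1
  refine h1.congr' ?_
  filter_upwards [sqrt_pos_whp] with p hp
  have h2 : (p.1 : ℝ) = Real.sqrt p.1 ^ 2 := (Real.sq_sqrt (Nat.cast_nonneg _)).symm
  rw [cubicTerm]
  generalize Real.sqrt p.1 = t at *
  rw [h2]
  field_simp
  ring

/-- An average of functions of the estimated parameter. The two parts of the covariance with `X`
come from the sampling variation of the average and from the estimation of the parameter. -/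
lemma linExp_avg {g g' g'' : 𝓩 → ℝ → ℝ} {G : 𝓩 → ℝ}
    (hg : ∀ z, ∀ θ ∈ _root_.interior Θ, HasDerivAt (g z) (g' z θ) θ)
    (hg' : ∀ z, ∀ θ ∈ _root_.interior Θ, HasDerivAt (g' z) (g'' z θ) θ)
    (hG : ∀ z, ∀ θ ∈ Θ, |g'' z θ| ≤ G z) (hGm : MemLp G 2 (law μ f θ₀))
    (hm : MemLp (fun z => g z θ₀) 4 (law μ f θ₀))
    (hm' : MemLp (fun z => g' z θ₀) 2 (law μ f θ₀)) :
    LinExp Pr (law μ f θ₀) Z (X μ f Θ θ₀)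
      (fun p => avg (sample Z p.1 p.2) fun y => g y (θhat p.1 (sample Z p.1 p.2)))
      (∫ z, g z θ₀ ∂(law μ f θ₀))
      ((info μ f Θ θ₀)⁻¹ * ((∫ z, logLikDeriv f Θ 1 z θ₀ * g z θ₀ ∂(law μ f θ₀))
        + ∫ z, g' z θ₀ ∂(law μ f θ₀))) := by
  have hP := hreg.isProbabilityMeasure_law
  obtain ⟨ρ, hρ, hρΘ⟩ := Metric.isOpen_iff.1 isOpen_interior θ₀ hreg.interior
  refine (LinExp.avg_estimate hZ (hreg.memLp_X.mono_exponent (by norm_num))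
    (hreg.linExp_mle hZ hθ) (convex_ball θ₀ ρ) (Metric.ball_mem_nhds θ₀ hρ)
    (fun z θ h => hg z θ (hρΘ h)) (fun z θ h => hg' z θ (hρΘ h))
    (fun z θ h => hG z θ (interior_subset (hρΘ h))) hGm hm hm').congr
    (Eventually.of_forall fun p => rfl) rfl ?_
  rw [hreg.integral_X_mul_sub hm]
  ring

end RegularityConditions

end Bias

/-! ### The analytical bias estimates -/

section BiasEstimates

variable {𝓩 : Type*} [MeasurableSpace 𝓩] {μ : Measure 𝓩} {f : 𝓩 → ℝ → ℝ} {Θ : Set ℝ} {θ₀ : ℝ}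
  {M : 𝓩 → ℝ}

namespace RegularityConditions

variable (hreg : RegularityConditions μ f Θ θ₀ M)
include hreg

lemma memLp_envelope_sq : MemLp (fun z => 4 * (M z * M z)) 2 (law μ f θ₀) := by
  have := hreg.isProbabilityMeasure_law
  exact ((MemLp.mul_sixteen hreg.memLp_envelope hreg.memLp_envelope).const_mul 4).mono_exponent
    (by norm_num)

lemma abs_logLikDeriv_mul_le {m k : ℕ} (hm : m ≤ 7) (hk : k ≤ 7) {θ : ℝ} (hθ : θ ∈ Θ) (z : 𝓩) :
    |logLikDeriv f Θ m z θ * logLikDeriv f Θ k z θ| ≤ M z * M z := by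
  rw [abs_mul]
  exact mul_le_mul (hreg.envelope m hm θ hθ z) (hreg.envelope k hk θ hθ z) (abs_nonneg _)
    (hreg.envelope_nonneg z)

variable {Ω : Type*} [MeasurableSpace Ω] {Pr : Measure Ω} [IsProbabilityMeasure Pr]
  {Z : ℕ → Ω → 𝓩} (hZ : IIDSample Pr (law μ f θ₀) Z) {θhat : Estimator 𝓩} (hθ : IsMLE f Θ θhat)
include hZ hθ

lemma linExp_avg_logLikDeriv {m : ℕ} (hm : m ≤ 5) :
    LinExp Pr (law μ f θ₀) Z (X μ f Θ θ₀)
      (fun p => avg (sample Z p.1 p.2) fun y =>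
        logLikDeriv f Θ m y (θhat p.1 (sample Z p.1 p.2)))
      (∫ z, logLikDeriv f Θ m z θ₀ ∂(law μ f θ₀))
      ((info μ f Θ θ₀)⁻¹ * (crossMoment μ f Θ θ₀ 1 m
        + ∫ z, logLikDeriv f Θ (m + 1) z θ₀ ∂(law μ f θ₀))) := by
  have hP := hreg.isProbabilityMeasure_law
  exact hreg.linExp_avg hZ hθ (g := logLikDeriv f Θ m) (g' := logLikDeriv f Θ (m + 1))
    (g'' := logLikDeriv f Θ (m + 2)) (fun z θ h => hreg.hasDerivAt_logLikDeriv (by omega) h z)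
    (fun z θ h => hreg.hasDerivAt_logLikDeriv (by omega) h z)
    (fun z θ h => hreg.envelope (m + 2) (by omega) θ h z)
    (hreg.memLp_envelope.mono_exponent (by norm_num))
    ((hreg.memLp_logLikDeriv (by omega) hreg.center_mem).mono_exponent (by norm_num))
    ((hreg.memLp_logLikDeriv (by omega) hreg.center_mem).mono_exponent (by norm_num))

lemma linExp_avg_score_sq :
    LinExp Pr (law μ f θ₀) Z (X μ f Θ θ₀)
      (fun p => avg (sample Z p.1 p.2) fun y =>
        logLikDeriv f Θ 1 y (θhat p.1 (sample Z p.1 p.2)) ^ 2) (info μ f Θ θ₀)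
      ((info μ f Θ θ₀)⁻¹ * (-Q₁ μ f Θ θ₀ - crossMoment μ f Θ θ₀ 1 2)) := by
  have hP := hreg.isProbabilityMeasure_law
  have h12 := hreg.memLp_logLikDeriv_mul (m := 1) (k := 2) (by norm_num) (by norm_num)
  have h11 := hreg.memLp_logLikDeriv_mul (m := 1) (k := 1) (by norm_num) (by norm_num)
  simp only [← pow_two] at h11
  refine (hreg.linExp_avg hZ hθ (g := fun z θ => logLikDeriv f Θ 1 z θ ^ 2)
    (g' := fun z θ => 2 * (logLikDeriv f Θ 1 z θ * logLikDeriv f Θ 2 z θ))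
    (g'' := fun z θ => 2 * (logLikDeriv f Θ 2 z θ * logLikDeriv f Θ 2 z θ
      + logLikDeriv f Θ 1 z θ * logLikDeriv f Θ 3 z θ))
    (fun z θ h => ?_) (fun z θ h => ?_) (fun z θ h => ?_) hreg.memLp_envelope_sq
    (h11.mono_exponent (by norm_num)) ((h12.const_mul 2).mono_exponent (by norm_num))).congr
    (Eventually.of_forall fun p => rfl) ?_ ?_
  · refine ((hreg.hasDerivAt_logLikDeriv (m := 1) (by norm_num) h z).pow 2).congr_deriv ?_
    simp
    ring
  · exact ((hreg.hasDerivAt_logLikDeriv (m := 1) (by norm_num) h z).mul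
      (hreg.hasDerivAt_logLikDeriv (m := 2) (by norm_num) h z)).const_mul 2
  · have h1 := hreg.abs_logLikDeriv_mul_le (m := 2) (k := 2) (by norm_num) (by norm_num) h z
    have h2 := hreg.abs_logLikDeriv_mul_le (m := 1) (k := 3) (by norm_num) (by norm_num) h z
    rw [abs_mul, abs_two]
    linarith [abs_add_le (logLikDeriv f Θ 2 z θ * logLikDeriv f Θ 2 z θ)
      (logLikDeriv f Θ 1 z θ * logLikDeriv f Θ 3 z θ)]
  · rw [← hreg.integral_score_sq]
    simp only [pow_two]
  · have h3 := hreg.integral_bartlett_three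
    have e : (fun z => logLikDeriv f Θ 1 z θ₀ * logLikDeriv f Θ 1 z θ₀ ^ 2)
        = fun z => logLikDeriv f Θ 1 z θ₀ * logLikDeriv f Θ 1 z θ₀ * logLikDeriv f Θ 1 z θ₀ := by
      funext z; ring
    rw [integral_const_mul, e]
    congr 1
    rw [Q₁, crossMoment]
    linarith

lemma linExp_avg_score_mul :
    LinExp Pr (law μ f θ₀) Z (X μ f Θ θ₀)
      (fun p => avg (sample Z p.1 p.2) fun y =>
        logLikDeriv f Θ 1 y (θhat p.1 (sample Z p.1 p.2))
          * logLikDeriv f Θ 2 y (θhat p.1 (sample Z p.1 p.2))) (crossMoment μ f Θ θ₀ 1 2)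
      ((info μ f Θ θ₀)⁻¹ * (scoreSqMoment μ f Θ θ₀
        + (crossMoment μ f Θ θ₀ 2 2 + crossMoment μ f Θ θ₀ 1 3))) := by
  have hP := hreg.isProbabilityMeasure_law
  have h12 := hreg.memLp_logLikDeriv_mul (m := 1) (k := 2) (by norm_num) (by norm_num)
  have h22 := hreg.memLp_logLikDeriv_mul (m := 2) (k := 2) (by norm_num) (by norm_num)
  have h13 := hreg.memLp_logLikDeriv_mul (m := 1) (k := 3) (by norm_num) (by norm_num)
  refine (hreg.linExp_avg hZ hθ (g := fun z θ => logLikDeriv f Θ 1 z θ * logLikDeriv f Θ 2 z θ)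
    (g' := fun z θ => logLikDeriv f Θ 2 z θ * logLikDeriv f Θ 2 z θ
      + logLikDeriv f Θ 1 z θ * logLikDeriv f Θ 3 z θ)
    (g'' := fun z θ => logLikDeriv f Θ 3 z θ * logLikDeriv f Θ 2 z θ
      + logLikDeriv f Θ 2 z θ * logLikDeriv f Θ 3 z θ
      + (logLikDeriv f Θ 2 z θ * logLikDeriv f Θ 3 z θ
      + logLikDeriv f Θ 1 z θ * logLikDeriv f Θ 4 z θ))
    (fun z θ h => ?_) (fun z θ h => ?_) (fun z θ h => ?_) hreg.memLp_envelope_sq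
    (h12.mono_exponent (by norm_num)) ((h22.add h13).mono_exponent (by norm_num))).congr
    (Eventually.of_forall fun p => rfl) rfl ?_
  · exact (hreg.hasDerivAt_logLikDeriv (m := 1) (by norm_num) h z).mul
      (hreg.hasDerivAt_logLikDeriv (m := 2) (by norm_num) h z)
  · exact ((hreg.hasDerivAt_logLikDeriv (m := 2) (by norm_num) h z).mul
      (hreg.hasDerivAt_logLikDeriv (m := 2) (by norm_num) h z)).add
      ((hreg.hasDerivAt_logLikDeriv (m := 1) (by norm_num) h z).mul
      (hreg.hasDerivAt_logLikDeriv (m := 3) (by norm_num) h z))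
  · have h1 := hreg.abs_logLikDeriv_mul_le (m := 3) (k := 2) (by norm_num) (by norm_num) h z
    have h2 := hreg.abs_logLikDeriv_mul_le (m := 2) (k := 3) (by norm_num) (by norm_num) h z
    have h3 := hreg.abs_logLikDeriv_mul_le (m := 1) (k := 4) (by norm_num) (by norm_num) h z
    refine (abs_add_le _ _).trans ?_
    refine (add_le_add (abs_add_le _ _) (abs_add_le _ _)).trans ?_
    linarith
  · rw [integral_add (h22.integrable (by norm_num)) (h13.integrable (by norm_num)), scoreSqMoment]
    simp only [crossMoment, mul_assoc]

lemma isBiasEstimate_analyticNoInfo :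
    IsBiasEstimate Pr μ f Θ θ₀ Z fun p => noInfoBias f Θ θhat (sample Z p.1 p.2) := by
  have hQ := hreg.linExp_avg_logLikDeriv hZ hθ (m := 3) (by norm_num)
  have hJ := (hreg.linExp_avg_logLikDeriv hZ hθ (m := 2) (by norm_num)).congr
    (b := -info μ f Θ θ₀) (Eventually.of_forall fun p => rfl) (by simp [info]) rfl
  exact hreg.isBiasEstimate_noInfo hZ hQ (hreg.linExp_avg_score_sq hZ hθ) hJ
    (hreg.linExp_avg_score_mul hZ hθ)

lemma isBiasEstimate_analyticInfo :
    IsBiasEstimate Pr μ f Θ θ₀ Z fun p =>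
      avg (sample Z p.1 p.2) (fun y => score'' f Θ y (θhat p.1 (sample Z p.1 p.2)))
        / (2 * avg (sample Z p.1 p.2)
          (fun y => score' f Θ y (θhat p.1 (sample Z p.1 p.2))) ^ 2)
      + avg (sample Z p.1 p.2) (fun y => score f Θ y (θhat p.1 (sample Z p.1 p.2))
          * score' f Θ y (θhat p.1 (sample Z p.1 p.2)))
        / avg (sample Z p.1 p.2)
          (fun y => score' f Θ y (θhat p.1 (sample Z p.1 p.2))) ^ 2 := by
  have hQ := hreg.linExp_avg_logLikDeriv hZ hθ (m := 3) (by norm_num)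
  have hJ := (hreg.linExp_avg_logLikDeriv hZ hθ (m := 2) (by norm_num)).congr
    (b := -info μ f Θ θ₀) (Eventually.of_forall fun p => rfl) (by simp [info]) rfl
  exact hreg.isBiasEstimate_info hZ hQ hJ (hreg.linExp_avg_score_mul hZ hθ)

/-- The expectation of `g (·, θ)` under `f (·, θ)` at the estimate. The influence function differs
from that of the corresponding sample average, but has the same covariance with `X`. -/
lemma linExp_integral {g g' : 𝓩 → ℝ → ℝ} (hdom : DominatedNear μ f θ₀ g)
    (hg : ∀ z, ∀ θ ∈ _root_.interior Θ, HasDerivAt (g z) (g' z θ) θ)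
    (hgm : ∀ θ ∈ Θ, AEMeasurable (fun z => g z θ) μ)
    (hgm' : ∀ θ ∈ Θ, AEMeasurable (fun z => g' z θ) μ)
    (hm : MemLp (fun z => g z θ₀) 4 (law μ f θ₀))
    (hm' : MemLp (fun z => g' z θ₀) 4 (law μ f θ₀)) :
    LinExp Pr (law μ f θ₀) Z (X μ f Θ θ₀)
      (fun p => ∫ y, g y (θhat p.1 (sample Z p.1 p.2)) * f y (θhat p.1 (sample Z p.1 p.2)) ∂μ)
      (∫ z, g z θ₀ ∂(law μ f θ₀))
      ((info μ f Θ θ₀)⁻¹ * ((∫ z, logLikDeriv f Θ 1 z θ₀ * g z θ₀ ∂(law μ f θ₀))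
        + ∫ z, g' z θ₀ ∂(law μ f θ₀))) := by
  have hP := hreg.isProbabilityMeasure_law
  have hd := (hreg.hasDerivAt_integral hdom hg hgm hgm'
    (hm.integrable (by norm_num))).self_of_nhds.2.2
  refine (LinExp.comp_hasDerivAt hZ hd (hreg.linExp_mle hZ hθ)).congr
    (Eventually.of_forall fun p => rfl) (hreg.integral_law _) ?_
  have hi : Integrable (fun z => g z θ₀ * logLikDeriv f Θ 1 z θ₀) (law μ f θ₀) :=
    MemLp.integrable_mul_four hm (hreg.memLp_U.mono_exponent (by norm_num))
  rw [← hreg.integral_law fun z => g' z θ₀ + g z θ₀ * logLikDeriv f Θ 1 z θ₀,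
    integral_add (hm'.integrable (by norm_num)) hi]
  simp only [mul_comm (g _ _)]
  ring

lemma isBiasEstimate_analyticIntegral :
    IsBiasEstimate Pr μ f Θ θ₀ Z fun p =>
      (∫ y, score'' f Θ y (θhat p.1 (sample Z p.1 p.2)) * f y (θhat p.1 (sample Z p.1 p.2)) ∂μ)
        / (2 * (∫ y, score' f Θ y (θhat p.1 (sample Z p.1 p.2))
          * f y (θhat p.1 (sample Z p.1 p.2)) ∂μ) ^ 2)
      + (∫ y, score f Θ y (θhat p.1 (sample Z p.1 p.2))
          * score' f Θ y (θhat p.1 (sample Z p.1 p.2)) * f y (θhat p.1 (sample Z p.1 p.2)) ∂μ)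
        / (∫ y, score' f Θ y (θhat p.1 (sample Z p.1 p.2))
          * f y (θhat p.1 (sample Z p.1 p.2)) ∂μ) ^ 2 := by
  have hP := hreg.isProbabilityMeasure_law
  have h0 := hreg.center_mem
  have h12 := hreg.memLp_logLikDeriv_mul (m := 1) (k := 2) (by norm_num) (by norm_num)
  have h22 := hreg.memLp_logLikDeriv_mul (m := 2) (k := 2) (by norm_num) (by norm_num)
  have h13 := hreg.memLp_logLikDeriv_mul (m := 1) (k := 3) (by norm_num) (by norm_num)
  have hm : ∀ m ≤ 7, MemLp (fun z => logLikDeriv f Θ m z θ₀) 4 (law μ f θ₀) := fun m hm =>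
    (hreg.memLp_logLikDeriv hm h0).mono_exponent (by norm_num)
  have hQ := hreg.linExp_integral hZ hθ hreg.dom_score''
    (fun z θ h => hreg.hasDerivAt_logLikDeriv (m := 3) (by norm_num) h z)
    (fun θ h => hreg.measurable θ h 3 (by norm_num))
    (fun θ h => hreg.measurable θ h 4 (by norm_num)) (hm 3 (by norm_num)) (hm 4 (by norm_num))
  have hJ := (hreg.linExp_integral hZ hθ hreg.dom_score'
    (fun z θ h => hreg.hasDerivAt_logLikDeriv (m := 2) (by norm_num) h z)
    (fun θ h => hreg.measurable θ h 2 (by norm_num))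
    (fun θ h => hreg.measurable θ h 3 (by norm_num)) (hm 2 (by norm_num))
      (hm 3 (by norm_num))).congr
    (b := -info μ f Θ θ₀) (Eventually.of_forall fun p => rfl) (by simp [info]) rfl
  have hR := (hreg.linExp_integral hZ hθ hreg.dom_score_score'
    (g' := fun z θ => logLikDeriv f Θ 2 z θ * logLikDeriv f Θ 2 z θ
      + logLikDeriv f Θ 1 z θ * logLikDeriv f Θ 3 z θ)
    (fun z θ h => (hreg.hasDerivAt_logLikDeriv (m := 1) (by norm_num) h z).mul
      (hreg.hasDerivAt_logLikDeriv (m := 2) (by norm_num) h z))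
    (fun θ h => (hreg.measurable θ h 1 (by norm_num)).mul (hreg.measurable θ h 2 (by norm_num)))
    (fun θ h => ((hreg.measurable θ h 2 (by norm_num)).mul
      (hreg.measurable θ h 2 (by norm_num))).add
      ((hreg.measurable θ h 1 (by norm_num)).mul (hreg.measurable θ h 3 (by norm_num))))
    (h12.mono_exponent (by norm_num)) ((h22.add h13).mono_exponent (by norm_num))).congr
    (κ' := (info μ f Θ θ₀)⁻¹ * (scoreSqMoment μ f Θ θ₀
        + (crossMoment μ f Θ θ₀ 2 2 + crossMoment μ f Θ θ₀ 1 3)))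
    (Eventually.of_forall fun p => rfl) rfl (by
      rw [integral_add (h22.integrable (by norm_num)) (h13.integrable (by norm_num)),
        scoreSqMoment]
      simp only [crossMoment, mul_assoc])
  exact hreg.isBiasEstimate_info hZ hQ hJ hR

end RegularityConditions

end BiasEstimates

/-! ### Higher-order variance -/

section Variance

variable {𝓩 : Type*} [MeasurableSpace 𝓩] {μ : Measure 𝓩} {f : 𝓩 → ℝ → ℝ} {Θ : Set ℝ} {θ₀ : ℝ}
  {M : 𝓩 → ℝ}

/-- The polynomial `x y - b`, in the variables `x, y, v, w, l`. -/
def quadraticPoly (b : ℝ) : MvPolynomial (Fin 5) ℝ :=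
  MvPolynomial.X 0 * MvPolynomial.X 1 - MvPolynomial.C b

/-- The polynomial `a (v x y + w x² / 2 + q x² y + q' x³ / 6) - l`, in the variables
`x, y, v, w, l`. -/
def cubicPoly (a q q' : ℝ) : MvPolynomial (Fin 5) ℝ :=
  MvPolynomial.C a *
      (MvPolynomial.X 2 * (MvPolynomial.X 0 * MvPolynomial.X 1)
        + MvPolynomial.C (1 / 2) * (MvPolynomial.X 3 * (MvPolynomial.X 0 * MvPolynomial.X 0))
        + MvPolynomial.C q * (MvPolynomial.X 0 * (MvPolynomial.X 0 * MvPolynomial.X 1))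
        + MvPolynomial.C (q' / 6)
          * (MvPolynomial.X 0 * (MvPolynomial.X 0 * MvPolynomial.X 0)))
    - MvPolynomial.X 4

lemma eval_quadraticPoly (b : ℝ) (x : Fin 5 → ℝ) :
    MvPolynomial.eval x (quadraticPoly b) = x 0 * x 1 - b := by
  simp [quadraticPoly]

lemma eval_cubicPoly (a q q' : ℝ) (x : Fin 5 → ℝ) :
    MvPolynomial.eval x (cubicPoly a q q') = a * (x 2 * (x 0 * x 1) + x 3 * x 0 ^ 2 / 2
      + q * x 0 * (x 0 * x 1) + q' * x 0 ^ 3 / 6) - x 4 := by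
  simp only [cubicPoly, map_sub, map_mul, map_add, MvPolynomial.eval_X, MvPolynomial.eval_C]
  ring

lemma totalDegree_X_le (i : Fin 5) :
    (MvPolynomial.X i : MvPolynomial (Fin 5) ℝ).totalDegree ≤ 1 :=
  (MvPolynomial.totalDegree_X i).le

lemma totalDegree_quadraticPoly_le (b : ℝ) : (quadraticPoly b).totalDegree ≤ 2 := by
  refine (MvPolynomial.totalDegree_sub _ _).trans (max_le ?_ (by simp))
  exact (MvPolynomial.totalDegree_mul _ _).trans
    (add_le_add (totalDegree_X_le 0) (totalDegree_X_le 1))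

lemma totalDegree_cubicPoly_le (a q q' : ℝ) : (cubicPoly a q q').totalDegree ≤ 3 := by
  have h3 : ∀ i j k : Fin 5, (MvPolynomial.X i * (MvPolynomial.X j * MvPolynomial.X k) :
      MvPolynomial (Fin 5) ℝ).totalDegree ≤ 3 := fun i j k =>
    (MvPolynomial.totalDegree_mul _ _).trans (add_le_add (totalDegree_X_le i)
      ((MvPolynomial.totalDegree_mul _ _).trans
        (add_le_add (totalDegree_X_le j) (totalDegree_X_le k))))
  have hC : ∀ (c : ℝ) (p : MvPolynomial (Fin 5) ℝ), p.totalDegree ≤ 3 →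
      (MvPolynomial.C c * p).totalDegree ≤ 3 := fun c p hp =>
    (MvPolynomial.totalDegree_mul _ _).trans (by simpa using hp)
  refine (MvPolynomial.totalDegree_sub _ _).trans
    (max_le (hC _ _ ?_) ((totalDegree_X_le 4).trans (by simp)))
  refine (MvPolynomial.totalDegree_add _ _).trans (max_le ?_ (hC _ _ (h3 _ _ _)))
  refine (MvPolynomial.totalDegree_add _ _).trans (max_le ?_ (hC _ _ (h3 _ _ _)))
  exact (MvPolynomial.totalDegree_add _ _).trans (max_le (h3 _ _ _) (hC _ _ (h3 _ _ _)))

/-- The first three terms of the expansion of a bias-corrected estimator; `b` is the limit of the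
bias estimate and `φ` its influence function. -/
def correctedTerms (hreg : RegularityConditions μ f Θ θ₀ M) (b : ℝ) {φ : 𝓩 → ℝ}
    (hφ : MemLp φ 4 (law μ f θ₀)) (h0 : ∫ z, φ z ∂(law μ f θ₀) = 0) :
    ExpansionTerms (law μ f θ₀) where
  ψ := X μ f Θ θ₀
  k := 5
  g := ![X μ f Θ θ₀, Y μ f Θ θ₀, V μ f Θ θ₀, W μ f Θ θ₀, φ]
  p₂ := quadraticPoly b
  p₃ := cubicPoly (info μ f Θ θ₀)⁻¹ (Q₁ μ f Θ θ₀) (Q₂ μ f Θ θ₀)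
  memLp_ψ := by
    have := hreg.isProbabilityMeasure_law
    exact hreg.memLp_X.mono_exponent (by norm_num)
  mean_ψ := hreg.integral_X
  memLp_g := by
    have := hreg.isProbabilityMeasure_law
    intro j
    fin_cases j
    exacts [hreg.memLp_X.mono_exponent (by norm_num), hreg.memLp_Y.mono_exponent (by norm_num),
      hreg.memLp_V.mono_exponent (by norm_num), hreg.memLp_W.mono_exponent (by norm_num), hφ]
  mean_g := by
    intro j
    fin_cases j
    exacts [hreg.integral_X, hreg.integral_Y, hreg.integral_V, hreg.integral_W, h0]
  degree_p₂ := totalDegree_quadraticPoly_le b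
  degree_p₃ := totalDegree_cubicPoly_le _ _ _

variable (hreg : RegularityConditions μ f Θ θ₀ M) {b : ℝ} {φ : 𝓩 → ℝ}
  (hφ : MemLp φ 4 (law μ f θ₀)) (h0 : ∫ z, φ z ∂(law μ f θ₀) = 0)

lemma correctedTerms_A₁ {n : ℕ} (z : Fin n → 𝓩) :
    (correctedTerms hreg b hφ h0).A₁ z = normSum z (X μ f Θ θ₀) := rfl

lemma correctedTerms_A₂ {n : ℕ} (z : Fin n → 𝓩) : (correctedTerms hreg b hφ h0).A₂ z
    = normSum z (X μ f Θ θ₀) * normSum z (Y μ f Θ θ₀) - b :=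
  eval_quadraticPoly _ _

lemma correctedTerms_A₃ {n : ℕ} (z : Fin n → 𝓩) : (correctedTerms hreg b hφ h0).A₃ z
    = cubicTerm μ f Θ θ₀ (normSum z (X μ f Θ θ₀)) (normSum z (Y μ f Θ θ₀))
      (normSum z (V μ f Θ θ₀)) (normSum z (W μ f Θ θ₀)) - normSum z φ :=
  eval_cubicPoly _ _ _ _

variable {Ω : Type*} [MeasurableSpace Ω] {Pr : Measure Ω} [IsProbabilityMeasure Pr]
  {Z : ℕ → Ω → 𝓩} (hZ : IIDSample Pr (law μ f θ₀) Z)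
include hreg hZ

/-- When the influence function of the bias estimate has the covariance with `X` required of a bias
estimate, the contributions of `E[X²Y]` and of the cubic term to the variance are cancelled by the
bias correction, so that only `Var(A₂)` remains, up to `n⁻¹`. -/
lemma exists_expansionVariance_eq (hb : b = ∫ z, X μ f Θ θ₀ z * Y μ f Θ θ₀ z ∂(law μ f θ₀))
    (hκ : ∫ z, X μ f Θ θ₀ z * φ z ∂(law μ f θ₀)
      = (∫ z, X μ f Θ θ₀ z * X μ f Θ θ₀ z * Y μ f Θ θ₀ z ∂(law μ f θ₀)) + cubicCov μ f Θ θ₀) :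
    ∃ K : ℝ, ∀ n : ℕ, n ≠ 0 → expansionVariance Pr Z (correctedTerms hreg b hφ h0) n
      - ((info μ f Θ θ₀)⁻¹ + Upsilon μ f Θ θ₀ / n) = K * ((n : ℝ) ^ 2)⁻¹ := by
  have hP := hreg.isProbabilityMeasure_law
  let g : Fin 5 → 𝓩 → ℝ := ![X μ f Θ θ₀, Y μ f Θ θ₀, V μ f Θ θ₀, W μ f Θ θ₀, φ]
  have hg : ∀ j, MemLp (g j) 4 (law μ f θ₀) := (correctedTerms hreg b hφ h0).memLp_g
  have hg0 : ∀ j, ∫ z, g j z ∂(law μ f θ₀) = 0 := (correctedTerms hreg b hφ h0).mean_g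
  set σ : Fin 5 → Fin 5 → ℝ := fun i j => ∫ z, g i z * g j z ∂(law μ f θ₀) with hσ
  set τ : ℝ := ∫ z, X μ f Θ θ₀ z * X μ f Θ θ₀ z * Y μ f Θ θ₀ z ∂(law μ f θ₀) with hτ
  set ρ : Fin 5 → Fin 5 → Fin 5 → Fin 5 → ℝ :=
    fun i j k l => ∫ z, g i z * g j z * g k z * g l z ∂(law μ f θ₀) with hρ
  have hcub : cubicCov μ f Θ θ₀ = (info μ f Θ θ₀)⁻¹ * (σ 0 0 * σ 2 1 + 2 * σ 0 2 * σ 0 1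
    + 3 / 2 * σ 0 0 * σ 0 3 + 3 * Q₁ μ f Θ θ₀ * σ 0 0 * σ 0 1
    + 1 / 2 * Q₂ μ f Θ θ₀ * σ 0 0 ^ 2) := rfl
  have hups : Upsilon μ f Θ θ₀ = σ 0 0 * σ 1 1 + σ 0 1 ^ 2 := by
    simp only [Upsilon, pow_two]
    rfl
  refine ⟨ρ 0 0 1 1 - (σ 0 0 * σ 1 1 + 2 * σ 0 1 ^ 2)
    + 2 * ((info μ f Θ θ₀)⁻¹ * (ρ 0 0 2 1 + 1 / 2 * ρ 0 0 0 3 + Q₁ μ f Θ θ₀ * ρ 0 0 0 1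
      + Q₂ μ f Θ θ₀ / 6 * ρ 0 0 0 0) - cubicCov μ f Θ θ₀), fun n hn => ?_⟩
  have hn' : (0 : ℝ) < n := by positivity
  have m1 : ∀ i, HasMean Pr (fun ω => normSum (sample Z n ω) (g i)) 0 := fun i =>
    hZ.hasMean_normSum_one (hg i) (hg0 i) n
  have m2 : ∀ i j, HasMean Pr
      (fun ω => normSum (sample Z n ω) (g i) * normSum (sample Z n ω) (g j)) (σ i j) :=
    fun i j => hZ.hasMean_normSum_two hg hg0 hn i j
  have m3 : HasMean Pr (fun ω => normSum (sample Z n ω) (g 0) * normSum (sample Z n ω) (g 0)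
      * normSum (sample Z n ω) (g 1)) ((Real.sqrt n)⁻¹ * τ) :=
    hZ.hasMean_normSum_three hg hg0 hn 0 0 1
  have m4 : ∀ i j k l, HasMean Pr (fun ω => normSum (sample Z n ω) (g i)
      * normSum (sample Z n ω) (g j) * normSum (sample Z n ω) (g k) * normSum (sample Z n ω) (g l))
      ((n : ℝ)⁻¹ * ρ i j k l + (1 - (n : ℝ)⁻¹)
        * (σ i j * σ k l + σ i k * σ j l + σ i l * σ j k)) :=
    fun i j k l => hZ.hasMean_normSum_four hg hg0 hn i j k l
  have hb' : b = σ 0 1 := hb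
  have v1 : variance (fun ω => (correctedTerms hreg b hφ h0).A₁ (sample Z n ω)) Pr
      = (info μ f Θ θ₀)⁻¹ := by
    change variance (fun ω => normSum (sample Z n ω) (g 0)) Pr = _
    rw [variance_of_integral_eq_zero (m1 0).1.aemeasurable (m1 0).2, ← hreg.integral_XX]
    exact ((m2 0 0).congr (fun ω => pow_two _) rfl).2
  have v2 : variance (fun ω => (correctedTerms hreg b hφ h0).A₂ (sample Z n ω)) Pr
      = (n : ℝ)⁻¹ * ρ 0 0 1 1 + (1 - (n : ℝ)⁻¹) * (σ 0 0 * σ 1 1 + 2 * σ 0 1 ^ 2)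
        - σ 0 1 ^ 2 := by
    have ha := ((m2 0 1).sub (HasMean.const b)).congr
      (B := fun ω => (correctedTerms hreg b hφ h0).A₂ (sample Z n ω)) (v := 0)
      (fun ω => correctedTerms_A₂ hreg hφ h0 _) (by rw [hb', sub_self])
    rw [variance_of_integral_eq_zero ha.1.aemeasurable ha.2]
    refine ((((m4 0 0 1 1).sub ((m2 0 1).const_mul (2 * b))).add (HasMean.const (b ^ 2))).congr
      (fun ω => ?_) ?_).2
    · rw [correctedTerms_A₂]
      change (normSum (sample Z n ω) (g 0) * normSum (sample Z n ω) (g 1) - b) ^ 2 = _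
      ring
    · rw [hb']
      ring
  have c12 : ∫ ω, (correctedTerms hreg b hφ h0).A₁ (sample Z n ω)
      * (correctedTerms hreg b hφ h0).A₂ (sample Z n ω) ∂Pr = (Real.sqrt n)⁻¹ * τ := by
    refine ((m3.sub ((m1 0).const_mul b)).congr (fun ω => ?_) (by ring)).2
    rw [correctedTerms_A₂, correctedTerms_A₁]
    change normSum (sample Z n ω) (g 0)
      * (normSum (sample Z n ω) (g 0) * normSum (sample Z n ω) (g 1) - b) = _
    ring
  have c13 : ∫ ω, (correctedTerms hreg b hφ h0).A₁ (sample Z n ω)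
      * (correctedTerms hreg b hφ h0).A₃ (sample Z n ω) ∂Pr
      = (n : ℝ)⁻¹ * ((info μ f Θ θ₀)⁻¹ * (ρ 0 0 2 1 + 1 / 2 * ρ 0 0 0 3
        + Q₁ μ f Θ θ₀ * ρ 0 0 0 1 + Q₂ μ f Θ θ₀ / 6 * ρ 0 0 0 0) - cubicCov μ f Θ θ₀) - τ := by
    refine ((((((m4 0 0 2 1).add ((m4 0 0 0 3).const_mul (1 / 2))).add
      ((m4 0 0 0 1).const_mul (Q₁ μ f Θ θ₀))).add
      ((m4 0 0 0 0).const_mul (Q₂ μ f Θ θ₀ / 6))).const_mul (info μ f Θ θ₀)⁻¹).sub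
      (m2 0 4) |>.congr (fun ω => ?_) ?_).2
    · rw [correctedTerms_A₃, correctedTerms_A₁, cubicTerm]
      change normSum (sample Z n ω) (g 0) * ((info μ f Θ θ₀)⁻¹ *
        (normSum (sample Z n ω) (g 2) *
            (normSum (sample Z n ω) (g 0) * normSum (sample Z n ω) (g 1))
          + normSum (sample Z n ω) (g 3) * normSum (sample Z n ω) (g 0) ^ 2 / 2
          + Q₁ μ f Θ θ₀ * normSum (sample Z n ω) (g 0)
            * (normSum (sample Z n ω) (g 0) * normSum (sample Z n ω) (g 1))
          + Q₂ μ f Θ θ₀ * normSum (sample Z n ω) (g 0) ^ 3 / 6)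
        - normSum (sample Z n ω) (g 4)) = _
      ring
    · have h04 : σ 0 4 = τ + cubicCov μ f Θ θ₀ := hκ
      rw [h04, hcub]
      ring
  have hsq : Real.sqrt n * (Real.sqrt n)⁻¹ = 1 := mul_inv_cancel₀ (by positivity)
  rw [expansionVariance, v1, v2, c12, c13, hups, mul_assoc 2 (Real.sqrt n),
    ← mul_assoc (Real.sqrt n), hsq]
  field_simp
  ring

/-- An estimator that subtracts `n⁻¹` times a bias estimate from the maximum likelihood estimator,
up to a negligible term, has the higher-order variance `𝓘⁻¹ + Υ / n`. -/
theorem hasHigherOrderVariance_of_isBiasEstimate {θhat : Estimator 𝓩} (hθ : IsMLE f Θ θhat)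
    {T : ℕ × Ω → ℝ} (hT : IsBiasEstimate Pr μ f Θ θ₀ Z T) {est : Estimator 𝓩}
    (hest : Tendsto (fun p : ℕ × Ω => (p.1 : ℝ) * Real.sqrt p.1 * (est p.1 (sample Z p.1 p.2)
      - (θhat p.1 (sample Z p.1 p.2) - (p.1 : ℝ)⁻¹ * T p))) (whp Pr) (𝓝 0)) :
    HasHigherOrderVariance Pr Z (law μ f θ₀) θ₀ est (info μ f Θ θ₀)⁻¹ (Upsilon μ f Θ θ₀) := by
  obtain ⟨φ, hφ, h0, hκ, hlim⟩ := hT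
  refine ⟨correctedTerms hreg (∫ z, X μ f Θ θ₀ z * Y μ f Θ θ₀ z ∂(law μ f θ₀)) hφ h0,
    tendstoInMeasure_of_tendsto_whp ?_, ?_⟩
  · have h1 := ((hreg.tendsto_mle_remainder hZ hθ).sub hlim).add hest
    simp only [sub_zero, add_zero] at h1
    refine h1.congr' ?_
    filter_upwards [sqrt_pos_whp] with p hp
    have h2 : (p.1 : ℝ) = Real.sqrt p.1 ^ 2 := (Real.sq_sqrt (Nat.cast_nonneg _)).symm
    simp only [correctedTerms_A₁, correctedTerms_A₂, correctedTerms_A₃]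
    generalize Real.sqrt p.1 = t at *
    rw [h2]
    field_simp
    ring
  · obtain ⟨K, hK⟩ := exists_expansionVariance_eq (Pr := Pr) hreg hφ h0 hZ rfl hκ
    refine IsBigO.of_bound |K| ?_
    filter_upwards [eventually_ne_atTop 0] with n hn
    rw [hK n hn, norm_mul, Real.norm_eq_abs]

end Variance

/-! ### Negligible differences -/

section Close

variable {𝓩 : Type*} {Ω : Type*} [MeasurableSpace Ω] {Pr : Measure Ω} {Z : ℕ → Ω → 𝓩}

/-- A difference of order `n⁻²` is negligible in the expansion. -/
lemma tendsto_of_abs_le_inv_sq {A : ℝ} {D : ℕ × Ω → ℝ}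
    (hD : ∀ᶠ p in whp Pr, |D p| ≤ A * ((p.1 : ℝ) ^ 2)⁻¹) :
    Tendsto (fun p : ℕ × Ω => (p.1 : ℝ) * Real.sqrt p.1 * D p) (whp Pr) (𝓝 0) := by
  have h1 : Tendsto (fun p : ℕ × Ω => A * (Real.sqrt p.1)⁻¹) (whp Pr) (𝓝 0) := by
    simpa using tendsto_inv_sqrt_whp.const_mul A
  refine squeeze_zero_norm' ?_ h1
  filter_upwards [hD, sqrt_pos_whp] with p hp hs
  have h2 : (p.1 : ℝ) = Real.sqrt p.1 ^ 2 := (Real.sq_sqrt (Nat.cast_nonneg _)).symm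
  rw [norm_mul, Real.norm_eq_abs, Real.norm_eq_abs, abs_of_nonneg (by positivity)]
  refine (mul_le_mul_of_nonneg_left hp (by positivity)).trans (le_of_eq ?_)
  generalize Real.sqrt p.1 = t at *
  rw [h2]
  field_simp

end Close

end BiasCorrectedMLE

end

theorem mainTheorem4 {𝓩 : Type*} [MeasurableSpace 𝓩] (μ : Measure 𝓩) (f : 𝓩 → ℝ → ℝ)
    (Θ : Set ℝ) (θ₀ : ℝ) (M : 𝓩 → ℝ) (hreg : RegularityConditions μ f Θ θ₀ M)
    {Ω : Type*} [MeasurableSpace Ω] (Pr : Measure Ω) [IsProbabilityMeasure Pr]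
    (Z : ℕ → Ω → 𝓩) (hZ_meas : ∀ i, Measurable (Z i)) (hZ_indep : iIndepFun Z Pr)
    (hZ_law : ∀ i, Pr.map (Z i) = law μ f θ₀)
    (θhat : Estimator 𝓩) (hθhat : IsMLE f Θ θhat) :
    HasHigherOrderVariance Pr Z (law μ f θ₀) θ₀ (bootstrap θhat)
        (info μ f Θ θ₀)⁻¹ (Upsilon μ f Θ θ₀) ∧
      HasHigherOrderVariance Pr Z (law μ f θ₀) θ₀ (jackknife θhat)
        (info μ f Θ θ₀)⁻¹ (Upsilon μ f Θ θ₀) ∧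
      HasHigherOrderVariance Pr Z (law μ f θ₀) θ₀ (analyticNoInfo f Θ θhat)
        (info μ f Θ θ₀)⁻¹ (Upsilon μ f Θ θ₀) ∧
      HasHigherOrderVariance Pr Z (law μ f θ₀) θ₀ (analyticInfo f Θ θhat)
        (info μ f Θ θ₀)⁻¹ (Upsilon μ f Θ θ₀) ∧
      HasHigherOrderVariance Pr Z (law μ f θ₀) θ₀ (analyticIntegral μ f Θ θhat)
        (info μ f Θ θ₀)⁻¹ (Upsilon μ f Θ θ₀) := by
  have hZ : IIDSample Pr (law μ f θ₀) Z := ⟨hZ_indep, fun i => ⟨hZ_meas i, hZ_law i⟩⟩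
  obtain ⟨r, κ, C, η, B, K, h, hL, hη, hB, hgood⟩ := hreg.exists_localModel
  have hsample := hgood Pr Z hZ
  have hno := hreg.isBiasEstimate_analyticNoInfo hZ hθhat
  have hzero : Tendsto (fun p : ℕ × Ω => (p.1 : ℝ) * Real.sqrt p.1 * 0) (whp Pr) (𝓝 0) := by
    simpa using tendsto_const_nhds
  refine ⟨?_, ?_, ?_, ?_, ?_⟩
  · obtain ⟨A, hA⟩ := exists_bootstrap_close hL hθhat hη hB
    refine hasHigherOrderVariance_of_isBiasEstimate hreg hZ hθhat hno
      (tendsto_of_abs_le_inv_sq (A := A) ?_)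
    filter_upwards [hsample] with p hp
    exact hA p.1 (sample Z p.1 p.2) hp
  · obtain ⟨N, A, hA⟩ := exists_jackknife_close hL hθhat hη hB
    refine hasHigherOrderVariance_of_isBiasEstimate hreg hZ hθhat hno
      (tendsto_of_abs_le_inv_sq (A := A) ?_)
    filter_upwards [hsample, tendsto_fst_whp.eventually (eventually_ge_atTop N)] with p hp hN
    exact hA p.1 hN (sample Z p.1 p.2) hp
  · refine hasHigherOrderVariance_of_isBiasEstimate hreg hZ hθhat hno
      (hzero.congr fun p => ?_)
    rw [analyticNoInfo_eq, sub_self]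
  · refine hasHigherOrderVariance_of_isBiasEstimate hreg hZ hθhat
      (hreg.isBiasEstimate_analyticInfo hZ hθhat) (hzero.congr fun p => ?_)
    rw [analyticInfo, sub_self]
  · refine hasHigherOrderVariance_of_isBiasEstimate hreg hZ hθhat
      (hreg.isBiasEstimate_analyticIntegral hZ hθhat) (hzero.congr fun p => ?_)
    rw [analyticIntegral, sub_self]
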